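/- **Setting (Fay–Herriot model).** Let $x_1,x_2,\ldots\in\mathbb R^p$ be known covariate vectors, $D_1,D_2,\ldots>0$ known variances, $\beta\in\mathbb R^p$, $0<A<\infty$, and let $\theta_j=x_j'\beta+u_j$, $y_j=\theta_j+e_j$, where all $u_j\sim N(0,A)$ and $e_j\sim N(0,D_j)$ are mutually independent. From $m$ areas one observes $y=(y_1,\ldots,y_m)'$. Put $X=(x_1,\ldots,x_m)'$, $V=V(A)=\mathrm{diag}(A+D_1,\ldots,A+D_m)$, $P=V^{-1}-V^{-1}X(X'V^{-1}X)^{-1}X'V^{-1}$, $B_i(A)=D_i/(A+D_i)$, $\tilde\beta(A)=(X'V^{-1}X)^{-1}X'V^{-1}y$, $$L_{RE}(A|y)=|X'V^{-1}X|^{-1/2}|V|^{-1/2}\exp\{-y'Py/2\},$$ $$g_{1i}(A)=\frac{AD_i}{A+D_i},\quad g_{2i}(A)=\frac{D_i^2}{(A+D_i)^2}x_i'(X'V^{-1}X)^{-1}x_i,\quad g_{3i}(A)=\frac{2D_i^2}{(A+D_i)^3\,\mathrm{tr}(V^{-2})}.$$ For an estimator $\hat A=\hat A(y)\ge 0$ of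 $A$ the EBLUP of $\theta_i$ is $\hat\theta_i^{EB}(\hat A)=(1-B_i(\hat A))y_i+B_i(\hat A)x_i'\tilde\beta(\hat A)$, and its MSE is $E[(\hat\theta_i^{EB}(\hat A)-\theta_i)^2]$. All asymptotics are for $m\to\infty$ with $p$, $\beta$, $A$ and the area $i$ fixed. **Regularity conditions.** $\mathrm{rank}(X)=p$ for all large $m$; the entries of the $x_j$ are uniformly bounded and $\max_{j\le m}x_j'(X'X)^{-1}x_j=O(m^{-1})$; $0<\inf_jD_j\le\sup_jD_j<\infty$. **Factors.** Call $L:[0,\infty)\to[0,\infty)$ *admissible* if it is continuous, positive on $(0,\infty)$, and $\log L$ is four times continuously differentiable, strictly increasing and concave on $(0,\infty)$. For $m\ge i$ let $\tilde L_i=\tilde L_{i,m}$ be admissible (and not depending on $y$) with $\partial^k\log\tilde L_i/\partial A^k=O(1)$, $k=0,\ldots,4$, uniformly on compact subsets of $(0,\infty)$. Let $c_i=c_{i,m}:[0,\infty)\to(-\infty,2]$ be continuous, differentiable on $(0,\infty)$, with $c_{i,m}(A)=O(1)$ for every $A\ge 0$, with $c_i'(A)(A+D_i)-c_i(A)+2\ge0$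 for $A>0$, and $$\frac{\partial\log\tilde L_i(A)}{\partial A}=\frac{2-c_i(A)}{A+D_i}+o(1)\quad\text{uniformly on compact subsets of }(0,\infty).\qquad(1)$$ An *additional factor* is a family $\tilde L_{add}=\tilde L_{add,m}$, $m\ge i$, of admissible functions with $\partial^k\log\tilde L_{add}/\partial A^k=o(1)$, $k=0,\ldots,4$, uniformly on compact subsets of $(0,\infty)$, with $\tilde L_{add}(0)=0$ and each $\tilde L_{add,m}$ bounded above. **Estimators.** For a factor $F=F_m$, an *adjusted REML estimator with factor $F$* is a measurable statistic $\hat A=\hat A(y)\ge0$ for each $m$, even and translation invariant ($\hat A(-y)=\hat A(y)$, $\hat A(y+Xb)=\hat A(y)$), such that for some constants $C_{ad}>0$, $0<\lambda<1$ the event that $\hat A$ maximizes $F(\cdot)L_{RE}(\cdot|y)$ over $[0,\infty)$ and $\hat A<C_{ad}m^\lambda$ has probability $1-O(m^{-q})$ for every $q\in\mathbb N$. The REML case is $F\equiv1$. **Theorem.** Let $\hat A_i$ be an adjusted REML estimator with factor $\tilde L_i$, or with factor $\tilde L_i\tilde L_{add}$ for some additional factor, and let $\hat M_i^g(a)=g_{1i}(a)+g_{2i}(a)+c_i(a)g_{3i}(a)$.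 Then: (i) for large $m$ the MSE is finite, $MSE_i^g:=E[(\hat\theta_i^{EB}(\hat A_i)-\theta_i)^2]=g_{1i}(A)+g_{2i}(A)+g_{3i}(A)+o(m^{-1})$, and it equals the MSE of the EBLUP with any REML estimator up to $o(m^{-1})$; (ii) for large $m$ $\hat M_i^g(\hat A_i)$ is integrable, and $E[\hat M_i^g(\hat A_i)]=MSE_i^g+o(m^{-1})$; (iii) for every $m\ge i$ with $\mathrm{rank}(X)=p$ and $c_i\ge0$: $\hat M_i^g(\hat A_i)>0$ for all data $y$ if $x_i\ne0$, and in any case for all $y$ with $\hat A_i(y)>0$; (iv) let $m\ge i$ with $\mathrm{rank}(X)=p$, and suppose that $\log\tilde L_i(A)-\int_0^A\frac{2-c_i(s)}{s+D_i}ds$ is bounded above on $A>0$ (as it is if (1) holds for this $m$ without the $o(1)$ term). If either $c_i\ge0$ and $m>p+4$, or $m>p$ and $$\exp\Big[\log A^2-\int_1^A\frac{c_i(s)}{s}ds\Big]=o\big(A^{(m-p)/2}\big)\quad(A\to\infty),$$ then for every additional factor $\tilde L_{add}$ and every $y\in\mathbb R^m$ the function $\tilde L_i(A)\tilde L_{add}(A)L_{RE}(A|y)$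 has a strictly positive maximizer over $0\le A<\infty$, and all its maximizers are strictly positive. If $\tilde L_i(0)=0$, the same holds for $\tilde L_i(A)L_{RE}(A|y)$. -/

import Mathlib

open Filter Topology MeasureTheory ProbabilityTheory Asymptotics Matrix

noncomputable section

namespace FayHerriot

/-! ### The model

Areas are numbered `0, 1, 2, …`; with `m` areas in the sample the areas `0, …, m - 1` are observed.
`x j` is the covariate vector of area `j` and `D j` its known sampling variance. -/

/-- The true small-area means `θ_j = x_j' β + u_j`. -/
def areaMean {Ω : Type*} {p : ℕ} (x : ℕ → Fin p → ℝ) (β : Fin p → ℝ) (u : ℕ → Ω → ℝ)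
    (j : ℕ) (ω : Ω) : ℝ :=
  x j ⬝ᵥ β + u j ω

/-- The direct estimators `y_j = θ_j + e_j`. -/
def obs {Ω : Type*} {p : ℕ} (x : ℕ → Fin p → ℝ) (β : Fin p → ℝ) (u e : ℕ → Ω → ℝ)
    (j : ℕ) (ω : Ω) : ℝ :=
  areaMean x β u j ω + e j ω

/-- The data vector `y = (y_0, …, y_{m-1})'`. -/
def obsVec {Ω : Type*} {p : ℕ} (x : ℕ → Fin p → ℝ) (β : Fin p → ℝ) (u e : ℕ → Ω → ℝ)
    (m : ℕ) (ω : Ω) : Fin m → ℝ :=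
  fun j => obs x β u e j ω

/-- Mutually independent normal errors: `u_j ~ N(0, A)`, `e_j ~ N(0, D_j)`. -/
structure NormalErrors {Ω : Type*} [MeasurableSpace Ω] (P : Measure Ω) (A : ℝ) (D : ℕ → ℝ)
    (u e : ℕ → Ω → ℝ) : Prop where
  indep : iIndepFun (Sum.elim u e : ℕ ⊕ ℕ → Ω → ℝ) P
  law_u : ∀ j, HasLaw (u j) (gaussianReal 0 A.toNNReal) P
  law_e : ∀ j, HasLaw (e j) (gaussianReal 0 (D j).toNNReal) P

/-- The `m × p` matrix `X` with rows `x_j'`. -/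
def design {p : ℕ} (x : ℕ → Fin p → ℝ) (m : ℕ) : Matrix (Fin m) (Fin p) ℝ :=
  Matrix.of fun j k => x j k

/-- `V = diag(A + D_0, …, A + D_{m-1})`. -/
def covV (D : ℕ → ℝ) (m : ℕ) (A : ℝ) : Matrix (Fin m) (Fin m) ℝ :=
  Matrix.diagonal fun j => A + D j

/-- `X' V⁻¹ X`. -/
def gram {p : ℕ} (x : ℕ → Fin p → ℝ) (D : ℕ → ℝ) (m : ℕ) (A : ℝ) : Matrix (Fin p) (Fin p) ℝ :=
  (design x m)ᵀ * (covV D m A)⁻¹ * design x m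

/-- `P = V⁻¹ - V⁻¹ X (X' V⁻¹ X)⁻¹ X' V⁻¹`. -/
def projP {p : ℕ} (x : ℕ → Fin p → ℝ) (D : ℕ → ℝ) (m : ℕ) (A : ℝ) : Matrix (Fin m) (Fin m) ℝ :=
  (covV D m A)⁻¹ -
    (covV D m A)⁻¹ * design x m * (gram x D m A)⁻¹ * (design x m)ᵀ * (covV D m A)⁻¹

/-- The residual likelihood
`L_RE(A | y) = |X' V⁻¹ X|^(-1/2) |V|^(-1/2) exp(- y' P y / 2)`. -/
def resLik {p : ℕ} (x : ℕ → Fin p → ℝ) (D : ℕ → ℝ) (m : ℕ) (A : ℝ) (y : Fin m → ℝ) : ℝ :=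
  (gram x D m A).det ^ (-(1 / 2) : ℝ) * (covV D m A).det ^ (-(1 / 2) : ℝ) *
    Real.exp (-(y ⬝ᵥ (projP x D m A *ᵥ y)) / 2)

/-- The weighted least squares estimator `(X' V⁻¹ X)⁻¹ X' V⁻¹ y`. -/
def betaTilde {p : ℕ} (x : ℕ → Fin p → ℝ) (D : ℕ → ℝ) (m : ℕ) (A : ℝ) (y : Fin m → ℝ) :
    Fin p → ℝ :=
  (gram x D m A)⁻¹ *ᵥ ((design x m)ᵀ *ᵥ ((covV D m A)⁻¹ *ᵥ y))

/-- The shrinkage factor `B_i = D_i / (A + D_i)`. -/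
def shrink (D : ℕ → ℝ) (i : ℕ) (A : ℝ) : ℝ := D i / (A + D i)

/-- The predictor `(1 - B_i) y_i + B_i x_i' β̃` of `θ_i`, with the value `a` used for the model
variance; `yi` is the direct estimator of area `i` and `y` the whole data vector. -/
def predictor {p : ℕ} (x : ℕ → Fin p → ℝ) (D : ℕ → ℝ) (m i : ℕ) (a yi : ℝ) (y : Fin m → ℝ) : ℝ :=
  (1 - shrink D i a) * yi + shrink D i a * (x i ⬝ᵥ betaTilde x D m a y)

/-- The prediction error of the EBLUP of `θ_i` built on the estimator `Ahat` from `m` areas. -/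
def eblupError {Ω : Type*} {p : ℕ} (x : ℕ → Fin p → ℝ) (D : ℕ → ℝ) (β : Fin p → ℝ)
    (u e : ℕ → Ω → ℝ) (i m : ℕ) (Ahat : (Fin m → ℝ) → ℝ) (ω : Ω) : ℝ :=
  predictor x D m i (Ahat (obsVec x β u e m ω)) (obs x β u e i ω) (obsVec x β u e m ω) -
    areaMean x β u i ω

/-- The mean squared error of the EBLUP of `θ_i`. -/
def mse {Ω : Type*} [MeasurableSpace Ω] (P : Measure Ω) {p : ℕ} (x : ℕ → Fin p → ℝ) (D : ℕ → ℝ)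
    (β : Fin p → ℝ) (u e : ℕ → Ω → ℝ) (i m : ℕ) (Ahat : (Fin m → ℝ) → ℝ) : ℝ :=
  ∫ ω, eblupError x D β u e i m Ahat ω ^ 2 ∂P

/-- `g_{1i}(A) = A D_i / (A + D_i)`. -/
def g1 (D : ℕ → ℝ) (i : ℕ) (A : ℝ) : ℝ := A * D i / (A + D i)

/-- `g_{2i}(A) = D_i² / (A + D_i)² · x_i' (X' V⁻¹ X)⁻¹ x_i`. -/
def g2 {p : ℕ} (x : ℕ → Fin p → ℝ) (D : ℕ → ℝ) (m i : ℕ) (A : ℝ) : ℝ :=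
  D i ^ 2 / (A + D i) ^ 2 * (x i ⬝ᵥ ((gram x D m A)⁻¹ *ᵥ x i))

/-- `g_{3i}(A) = 2 D_i² / ((A + D_i)³ tr(V⁻²))`. -/
def g3 (D : ℕ → ℝ) (m i : ℕ) (A : ℝ) : ℝ :=
  2 * D i ^ 2 / ((A + D i) ^ 3 * (((covV D m A)⁻¹) ^ 2).trace)

/-- The general MSE estimator `g_{1i}(a) + g_{2i}(a) + c(a) g_{3i}(a)`. -/
def mseEst {p : ℕ} (x : ℕ → Fin p → ℝ) (D : ℕ → ℝ) (m i : ℕ) (c : ℝ → ℝ) (a : ℝ) : ℝ :=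
  g1 D i a + g2 x D m i a + c a * g3 D m i a

/-! ### Conditions -/

/-- Regularity of the covariates and of the sampling variances. -/
structure Regular {p : ℕ} (x : ℕ → Fin p → ℝ) (D : ℕ → ℝ) : Prop where
  rank_eq : ∀ᶠ m in atTop, (design x m).rank = p
  bounded : ∃ C : ℝ, ∀ j k, |x j k| ≤ C
  leverage : ∃ C : ℝ, ∀ᶠ m : ℕ in atTop, ∀ j < m,
    x j ⬝ᵥ (((design x m)ᵀ * design x m)⁻¹ *ᵥ x j) ≤ C / m
  variance : ∃ d₁ d₂ : ℝ, 0 < d₁ ∧ ∀ j, d₁ ≤ D j ∧ D j ≤ d₂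

/-- The shape conditions on a single factor `L : [0, ∞) → [0, ∞)`: it is positive on `(0, ∞)`,
and `log L` is four times continuously differentiable, strictly increasing and concave there. -/
structure FactorShape (L : ℝ → ℝ) : Prop where
  continuousOn : ContinuousOn L (Set.Ici 0)
  pos : ∀ A, 0 < A → 0 < L A
  contDiffOn : ContDiffOn ℝ 4 (fun A => Real.log (L A)) (Set.Ioi 0)
  strictMonoOn : StrictMonoOn (fun A => Real.log (L A)) (Set.Ioi 0)
  concaveOn : ConcaveOn ℝ (Set.Ioi 0) (fun A => Real.log (L A))

/-- The class of adjustment factors `L m` (for area `i`, with `m` areas in the sample): the shape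
conditions, and `log L m` with its derivatives up to order four is `O(1)` as `m → ∞`, uniformly
on compact sets of values `A > 0`. -/
structure AdjFactor (i : ℕ) (L : ℕ → ℝ → ℝ) : Prop where
  shape : ∀ m, i < m → FactorShape (L m)
  bigO : ∀ k ≤ 4, ∀ K : Set ℝ, IsCompact K → K ⊆ Set.Ioi 0 → ∃ C : ℝ, ∀ᶠ m in atTop, ∀ A ∈ K,
    |iteratedDeriv k (fun s => Real.log (L m s)) A| ≤ C

/-- The class of additional adjustment factors: the shape conditions, `log L m` with its
derivatives up to order four is `o(1)` as `m → ∞`, uniformly on compact sets of values `A > 0`,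
and `L m` vanishes at `0` and is bounded above. -/
structure AddFactor (i : ℕ) (L : ℕ → ℝ → ℝ) : Prop where
  shape : ∀ m, i < m → FactorShape (L m)
  littleO : ∀ k ≤ 4, TendstoLocallyUniformlyOn
    (fun m A => iteratedDeriv k (fun s => Real.log (L m s)) A) (fun _ => 0) atTop (Set.Ioi 0)
  zero : ∀ m, i < m → L m 0 = 0
  bounded : ∀ m, i < m → ∃ C : ℝ, ∀ A, 0 < A → L m A < C

/-- The conditions that tie the adjustment factor `L` of area `i` to the function `c`:
`c ≤ 2` is `O(1)`, `c'(A) (A + D_i) - c(A) + 2 ≥ 0`, and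
`(log L)'(A) = (2 - c(A)) / (A + D_i) + o(1)`. -/
structure Coupled (D : ℕ → ℝ) (i : ℕ) (L c : ℕ → ℝ → ℝ) : Prop where
  continuousOn : ∀ m, i < m → ContinuousOn (c m) (Set.Ici 0)
  differentiableOn : ∀ m, i < m → DifferentiableOn ℝ (c m) (Set.Ioi 0)
  le_two : ∀ m, i < m → ∀ A, 0 ≤ A → c m A ≤ 2
  bigO : ∀ A, 0 ≤ A → (fun m => c m A) =O[atTop] (fun _ => (1 : ℝ))
  deriv_nonneg : ∀ m, i < m → ∀ A, 0 < A → 0 ≤ deriv (c m) A * (A + D i) - c m A + 2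
  diff_eq : TendstoLocallyUniformlyOn
    (fun m A => deriv (fun s => Real.log (L m s)) A - (2 - c m A) / (A + D i))
    (fun _ => 0) atTop (Set.Ioi 0)

/-- `a` maximizes `A ↦ F(A) L_RE(A | y)` over `0 ≤ A < ∞`. -/
def IsAdjArgmax {p : ℕ} (x : ℕ → Fin p → ℝ) (D : ℕ → ℝ) (m : ℕ) (F : ℝ → ℝ) (y : Fin m → ℝ)
    (a : ℝ) : Prop :=
  0 ≤ a ∧ ∀ b, 0 ≤ b → F b * resLik x D m b y ≤ F a * resLik x D m a y

/-- `Ahat` is an adjusted maximum likelihood estimator with adjustment factor `F`: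
a nonnegative, even and translation-invariant statistic which maximizes `F · L_RE` and is
smaller than `C m ^ lam`, outside events whose probability is smaller than every power of `m`.
(An unrestricted maximizer is an unbounded function of the normal data, so that the bound
cannot hold for all data.) -/
structure IsAdjEstimator {Ω : Type*} [MeasurableSpace Ω] (P : Measure Ω) {p : ℕ}
    (x : ℕ → Fin p → ℝ) (D : ℕ → ℝ) (β : Fin p → ℝ) (u e : ℕ → Ω → ℝ) (F : ℕ → ℝ → ℝ)
    (Ahat : (m : ℕ) → (Fin m → ℝ) → ℝ) : Prop where
  measurable : ∀ m, Measurable (Ahat m)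
  nonneg : ∀ m y, 0 ≤ Ahat m y
  even : ∀ m y, Ahat m (-y) = Ahat m y
  invariant : ∀ m y b, Ahat m (y + design x m *ᵥ b) = Ahat m y
  argmax_bounded : ∃ C lam : ℝ, 0 < C ∧ 0 < lam ∧ lam < 1 ∧ ∀ q : ℕ,
    (fun m : ℕ => P.real {ω | ¬ (IsAdjArgmax x D m (F m) (obsVec x β u e m ω)
        (Ahat m (obsVec x β u e m ω)) ∧ Ahat m (obsVec x β u e m ω) < C * (m : ℝ) ^ lam)})
      =O[atTop] (fun m : ℕ => ((m : ℝ) ^ q)⁻¹)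

end FayHerriot

end

open FayHerriot

/-! Put z = y - Xβ. The z_j are independent N(0, v_j) with v_j = A + D_j, and the likelihood, as
well as the difference between the EBLUP and the best predictor, depends on the data through z only.
Let τ = tr V(A)⁻² = Σ v_j⁻² and χ_k = Σ (z_j² - v_j) / v_j^k.

Localization. Outside events whose probability is smaller than every power of m, the linear and the
centred quadratic sums in z are of order m^(1/2 + 1/40), uniformly in the variance parameter
(`negligible_not_goodPath`). There the log-likelihood at b falls below its value at A by a multiple
of m ((b - A)/(b + d₂))², up to noise, while by concavity log F gains at most a multiple of (b -
A)⁺. As the maximizer is below C m^λ with λ < 1, it lies within m^(-18/40) of A, hence inside (0,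
∞), and solves the score equation (`RegularFactor.near_and_score`).

Expansion. Expanding the score to second order and substituting the first-order solution gives τ (Â
- A) = χ₂ - 2 χ₃χ₂/τ + 2 (Σ v_j⁻³)(χ₂/τ)² + 2 (regression part of the score) + 2κ + o(1), where κ is
the logarithmic derivative of the factor. The terms before κ have expectation exactly 0
(`integral_leadingSum`), so only the factor creates a bias of order 1/m, namely 2κ/τ. In the mean of
g₁(Â) this bias contributes 2 D_i² κ/(v_i² τ), and the curvature of g₁ contributes -g₃. Condition
(1) says that κ = (2 - c)/v_i + o(1), which makes the first contribution (2 - c) g₃; adding g₂ and c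
g₃ leaves g₁ + g₂ + g₃ (`integral_mseEstLeading`).

Mean squared error. The EBLUP error is the error of the best predictor, which is independent of the
data and has variance g₁, plus an excess with leading term B_i x_i'β̂ + D_i v_i⁻² τ⁻¹ χ₂' z_i, where
β̂ is the weighted least squares fit to z and χ₂' is χ₂ without its i-th summand. Its second moment
is g₂ + g₃ + O(m⁻²) (`integral_sq_errorLeading`). The factor does not enter at this order, so REML
has the same expansion.

Expectations. All statistics involved have moments that grow at most polynomially, so the
exceptional events contribute o(1/m) (`PolyMoments.integral_isLittleO`).

Orders are counted in integer powers of `scale m` = m^(1/40): √m has order 20, noise sums 21, Â - A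
at most -18, and errors of order below -40 are o(1/m).

Part (iii) is a sum of nonnegative terms. For part (iv), L_RE = O(a^((p - m)/2)) at infinity
(`resLik_isBigO`) beats the growth of the factor, which vanishes at 0, so a maximum is attained in
(0, ∞). -/

namespace FayHerriot

/-! ### Matrix expressions of the model as weighted sums over areas -/

variable {p : ℕ}

/-- The weighted moment matrix `∑ x_j x_j' / (a + D_j)^n`. -/
noncomputable def wGram (x : ℕ → Fin p → ℝ) (D : ℕ → ℝ) (m n : ℕ) (a : ℝ) :
    Matrix (Fin p) (Fin p) ℝ :=
  Matrix.of fun k l => ∑ j ∈ Finset.range m, x j k * x j l / (a + D j) ^ n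

/-- The weighted sum `∑ z_j x_j / (a + D_j)^n`. -/
noncomputable def wSum (x : ℕ → Fin p → ℝ) (D : ℕ → ℝ) (m n : ℕ) (a : ℝ) (z : ℕ → ℝ) :
    Fin p → ℝ :=
  fun k => ∑ j ∈ Finset.range m, x j k * z j / (a + D j) ^ n

theorem dotProduct_wGram_mulVec (x : ℕ → Fin p → ℝ) (D : ℕ → ℝ) (m n : ℕ) (a : ℝ)
    (v w : Fin p → ℝ) :
    v ⬝ᵥ (wGram x D m n a *ᵥ w) =
      ∑ j ∈ Finset.range m, (x j ⬝ᵥ v) * (x j ⬝ᵥ w) / (a + D j) ^ n := by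
  simp only [dotProduct, mulVec, wGram, Matrix.of_apply, Finset.sum_mul, Finset.mul_sum,
    Finset.sum_div]
  rw [Finset.sum_comm (s := Finset.range m), Finset.sum_comm]
  refine Finset.sum_congr rfl fun y _ => ?_
  rw [Finset.sum_comm (s := Finset.range m)]
  refine Finset.sum_congr rfl fun y' _ => ?_
  refine Finset.sum_congr rfl fun j _ => ?_
  ring

theorem inv_covV (D : ℕ → ℝ) (m : ℕ) (a : ℝ) (h : ∀ j < m, 0 < a + D j) :
    (covV D m a)⁻¹ = Matrix.diagonal fun j : Fin m => (a + D j)⁻¹ := by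
  apply Matrix.inv_eq_right_inv
  rw [covV, Matrix.diagonal_mul_diagonal, ← Matrix.diagonal_one]
  congr 1
  ext j
  exact mul_inv_cancel₀ (h j j.2).ne'

theorem gram_eq_wGram (x : ℕ → Fin p → ℝ) (D : ℕ → ℝ) (m : ℕ) (a : ℝ)
    (h : ∀ j < m, 0 < a + D j) : gram x D m a = wGram x D m 1 a := by
  ext k l
  rw [gram, inv_covV D m a h, Matrix.mul_apply, wGram, Matrix.of_apply]
  simp only [Matrix.mul_diagonal, design, Matrix.transpose_apply, Matrix.of_apply, pow_one]
  rw [← Fin.sum_univ_eq_sum_range (fun j => x j k * x j l / (a + D j))]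
  refine Finset.sum_congr rfl fun j _ => ?_
  ring

theorem design_transpose_mulVec (x : ℕ → Fin p → ℝ) (D : ℕ → ℝ) (m : ℕ) (a : ℝ)
    (h : ∀ j < m, 0 < a + D j) (z : ℕ → ℝ) :
    (design x m)ᵀ *ᵥ ((covV D m a)⁻¹ *ᵥ fun j : Fin m => z j) = wSum x D m 1 a z := by
  ext k
  rw [inv_covV D m a h]
  simp only [mulVec, dotProduct, Matrix.transpose_apply, design, Matrix.of_apply, wSum, pow_one,
    Matrix.diagonal_apply, ite_mul, zero_mul, Finset.sum_ite_eq, Finset.mem_univ, if_true]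
  rw [← Fin.sum_univ_eq_sum_range (fun j => x j k * z j / (a + D j))]
  refine Finset.sum_congr rfl fun j _ => ?_
  ring

theorem dotProduct_projP_mulVec (x : ℕ → Fin p → ℝ) (D : ℕ → ℝ) (m : ℕ) (a : ℝ)
    (h : ∀ j < m, 0 < a + D j) (z : ℕ → ℝ) :
    (fun j : Fin m => z j) ⬝ᵥ (projP x D m a *ᵥ fun j : Fin m => z j) =
      ∑ j ∈ Finset.range m, z j ^ 2 / (a + D j) -
        wSum x D m 1 a z ⬝ᵥ ((wGram x D m 1 a)⁻¹ *ᵥ wSum x D m 1 a z) := by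
  set y : Fin m → ℝ := fun j => z j with hy
  have hW := design_transpose_mulVec x D m a h z
  rw [← hy] at hW
  have hV := inv_covV D m a h
  rw [projP, Matrix.sub_mulVec, dotProduct_sub]
  congr 1
  · rw [hV, ← Fin.sum_univ_eq_sum_range (fun j => z j ^ 2 / (a + D j))]
    simp only [dotProduct, Matrix.mulVec_diagonal, hy]
    refine Finset.sum_congr rfl fun j _ => ?_
    ring
  · rw [← Matrix.mulVec_mulVec, ← Matrix.mulVec_mulVec, ← Matrix.mulVec_mulVec, hW,
      ← Matrix.mulVec_mulVec, gram_eq_wGram x D m a h, Matrix.dotProduct_mulVec,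
      Matrix.dotProduct_mulVec]
    congr 1
    rw [← hW, ← Matrix.vecMul_transpose, Matrix.transpose_transpose, ← Matrix.vecMul_transpose]
    congr 2
    rw [hV, Matrix.diagonal_transpose]

theorem wSum_add (x : ℕ → Fin p → ℝ) (D : ℕ → ℝ) (m n : ℕ) (a : ℝ) (β : Fin p → ℝ) (z : ℕ → ℝ) :
    wSum x D m n a (fun j => x j ⬝ᵥ β + z j) = wGram x D m n a *ᵥ β + wSum x D m n a z := by
  ext k
  simp only [wSum, Pi.add_apply, mulVec, dotProduct, wGram, Matrix.of_apply, Finset.sum_mul]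
  rw [Finset.sum_comm, ← Finset.sum_add_distrib]
  refine Finset.sum_congr rfl fun j _ => ?_
  rw [mul_add, add_div, Finset.mul_sum, Finset.sum_div]
  congr 1
  refine Finset.sum_congr rfl fun l _ => ?_
  ring

theorem isSymm_wGram (x : ℕ → Fin p → ℝ) (D : ℕ → ℝ) (m n : ℕ) (a : ℝ) :
    (wGram x D m n a)ᵀ = wGram x D m n a := by
  ext k l
  simp [wGram, mul_comm]

theorem betaTilde_eq (x : ℕ → Fin p → ℝ) (D : ℕ → ℝ) (m : ℕ) (a : ℝ)
    (h : ∀ j < m, 0 < a + D j) (hdet : IsUnit (wGram x D m 1 a).det) (β : Fin p → ℝ) (z : ℕ → ℝ) :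
    betaTilde x D m a (fun j : Fin m => x j ⬝ᵥ β + z j) =
      β + (wGram x D m 1 a)⁻¹ *ᵥ wSum x D m 1 a z := by
  rw [betaTilde, design_transpose_mulVec x D m a h (fun j => x j ⬝ᵥ β + z j), wSum_add,
    gram_eq_wGram x D m a h, Matrix.mulVec_add, Matrix.mulVec_mulVec,
    Matrix.nonsing_inv_mul _ hdet, Matrix.one_mulVec]

theorem dotProduct_inv_comm (x : ℕ → Fin p → ℝ) (D : ℕ → ℝ) (m n : ℕ) (a : ℝ)
    (v w : Fin p → ℝ) :
    v ⬝ᵥ ((wGram x D m n a)⁻¹ *ᵥ w) = w ⬝ᵥ ((wGram x D m n a)⁻¹ *ᵥ v) := by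
  rw [Matrix.dotProduct_mulVec, dotProduct_comm, ← Matrix.mulVec_transpose,
    Matrix.transpose_nonsing_inv, isSymm_wGram]

/-- Since P X = 0, the mean Xβ drops out: the normal equations cancel all terms containing β. The
likelihood is therefore a function of z alone. -/
theorem dotProduct_projP_mulVec_add (x : ℕ → Fin p → ℝ) (D : ℕ → ℝ) (m : ℕ) (a : ℝ)
    (h : ∀ j < m, 0 < a + D j) (hdet : IsUnit (wGram x D m 1 a).det) (β : Fin p → ℝ) (z : ℕ → ℝ) :
    (fun j : Fin m => x j ⬝ᵥ β + z j) ⬝ᵥ (projP x D m a *ᵥ fun j : Fin m => x j ⬝ᵥ β + z j) =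
      ∑ j ∈ Finset.range m, z j ^ 2 / (a + D j) -
        wSum x D m 1 a z ⬝ᵥ ((wGram x D m 1 a)⁻¹ *ᵥ wSum x D m 1 a z) := by
  rw [dotProduct_projP_mulVec x D m a h (fun j => x j ⬝ᵥ β + z j), wSum_add, Matrix.mulVec_add,
    Matrix.mulVec_mulVec, Matrix.nonsing_inv_mul _ hdet, Matrix.one_mulVec, dotProduct_add,
    add_dotProduct, add_dotProduct]
  have h1 : (wGram x D m 1 a *ᵥ β) ⬝ᵥ β =
      ∑ j ∈ Finset.range m, (x j ⬝ᵥ β) * (x j ⬝ᵥ β) / (a + D j) := by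
    rw [dotProduct_comm, dotProduct_wGram_mulVec]; simp
  have h2 : wSum x D m 1 a z ⬝ᵥ β = ∑ j ∈ Finset.range m, (x j ⬝ᵥ β) * z j / (a + D j) := by
    simp only [dotProduct, wSum, Finset.sum_mul, pow_one, Finset.sum_div]
    rw [Finset.sum_comm]
    refine Finset.sum_congr rfl fun j _ => Finset.sum_congr rfl fun k _ => ?_
    ring
  have h3 : (wGram x D m 1 a *ᵥ β) ⬝ᵥ ((wGram x D m 1 a)⁻¹ *ᵥ wSum x D m 1 a z) =
      wSum x D m 1 a z ⬝ᵥ β := by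
    rw [dotProduct_inv_comm, Matrix.mulVec_mulVec, Matrix.nonsing_inv_mul _ hdet,
      Matrix.one_mulVec]
  have h4 : ∑ j ∈ Finset.range m, (x j ⬝ᵥ β + z j) ^ 2 / (a + D j) =
      ∑ j ∈ Finset.range m, (x j ⬝ᵥ β) * (x j ⬝ᵥ β) / (a + D j) +
        2 * ∑ j ∈ Finset.range m, (x j ⬝ᵥ β) * z j / (a + D j) +
        ∑ j ∈ Finset.range m, z j ^ 2 / (a + D j) := by
    rw [Finset.mul_sum, ← Finset.sum_add_distrib, ← Finset.sum_add_distrib]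
    refine Finset.sum_congr rfl fun j _ => ?_
    ring
  rw [h3, h1, h2, h4]
  ring

end FayHerriot

/-! ### The residual log-likelihood and its score -/

namespace FayHerriot

variable {p : ℕ}

/-- The covariates of the first `m` areas span. -/
def Spans (x : ℕ → Fin p → ℝ) (m : ℕ) : Prop :=
  ∀ v : Fin p → ℝ, (∀ j < m, x j ⬝ᵥ v = 0) → v = 0

theorem spans_of_rank_eq {x : ℕ → Fin p → ℝ} {m : ℕ} (h : (design x m).rank = p) :
    Spans x m := by
  intro v hv
  have h1 := LinearMap.finrank_range_add_finrank_ker (design x m).mulVecLin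
  rw [Matrix.rank] at h
  rw [h, Module.finrank_fin_fun, Nat.add_eq_left, Submodule.finrank_eq_zero] at h1
  have h2 : v ∈ LinearMap.ker (design x m).mulVecLin := by
    rw [LinearMap.mem_ker, Matrix.mulVecLin_apply]
    ext j
    exact hv j j.2
  rw [h1] at h2
  simpa using h2

theorem posDef_wGram {x : ℕ → Fin p → ℝ} {D : ℕ → ℝ} {m : ℕ} (hs : Spans x m) (n : ℕ) {a : ℝ}
    (h : ∀ j < m, 0 < a + D j) : (wGram x D m n a).PosDef := by
  refine Matrix.PosDef.of_dotProduct_mulVec_pos ?_ ?_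
  · rw [Matrix.IsHermitian, Matrix.conjTranspose_eq_transpose_of_trivial, isSymm_wGram]
  · intro v hv
    rw [star_trivial, dotProduct_wGram_mulVec]
    have hnn : ∀ j ∈ Finset.range m, 0 ≤ x j ⬝ᵥ v * x j ⬝ᵥ v / (a + D j) ^ n := fun j hj =>
      div_nonneg (mul_self_nonneg _) (pow_nonneg (h j (Finset.mem_range.1 hj)).le _)
    refine (Finset.sum_nonneg hnn).lt_of_ne fun h0 => hv (hs v fun j hj => ?_)
    have := (Finset.sum_eq_zero_iff_of_nonneg hnn).1 h0.symm j (Finset.mem_range.2 hj)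
    rcases div_eq_zero_iff.1 this with h1 | h1
    · exact mul_self_eq_zero.1 h1
    · exact absurd h1 (pow_pos (h j hj) _).ne'

theorem isUnit_det_wGram {x : ℕ → Fin p → ℝ} {D : ℕ → ℝ} {m : ℕ} (hs : Spans x m) (n : ℕ) {a : ℝ}
    (h : ∀ j < m, 0 < a + D j) : IsUnit (wGram x D m n a).det :=
  (posDef_wGram hs n h).det_pos.ne'.isUnit

/-- The weighted least squares coefficients of `z`. -/
noncomputable def wls (x : ℕ → Fin p → ℝ) (D : ℕ → ℝ) (m : ℕ) (a : ℝ) (z : ℕ → ℝ) : Fin p → ℝ :=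
  (wGram x D m 1 a)⁻¹ *ᵥ wSum x D m 1 a z

theorem wGram_mulVec_wls {x : ℕ → Fin p → ℝ} {D : ℕ → ℝ} {m : ℕ} (hs : Spans x m) {a : ℝ}
    (h : ∀ j < m, 0 < a + D j) (z : ℕ → ℝ) :
    wGram x D m 1 a *ᵥ wls x D m a z = wSum x D m 1 a z := by
  rw [wls, Matrix.mulVec_mulVec, Matrix.mul_nonsing_inv _ (isUnit_det_wGram hs 1 h),
    Matrix.one_mulVec]

/-- The log-likelihood of the residual vector `z = y - X β`. -/
noncomputable def logLik (x : ℕ → Fin p → ℝ) (D : ℕ → ℝ) (m : ℕ) (z : ℕ → ℝ) (a : ℝ) : ℝ :=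
  -(Real.log (wGram x D m 1 a).det) / 2 - (∑ j ∈ Finset.range m, Real.log (a + D j)) / 2 -
    (∑ j ∈ Finset.range m, z j ^ 2 / (a + D j) - wSum x D m 1 a z ⬝ᵥ wls x D m a z) / 2

theorem resLik_eq_exp {x : ℕ → Fin p → ℝ} {D : ℕ → ℝ} {m : ℕ} (hs : Spans x m) {a : ℝ}
    (h : ∀ j < m, 0 < a + D j) (β : Fin p → ℝ) (z : ℕ → ℝ) :
    resLik x D m a (fun j : Fin m => x j ⬝ᵥ β + z j) = Real.exp (logLik x D m z a) := by
  have hdet : (covV D m a).det = ∏ j ∈ Finset.range m, (a + D j) := by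
    rw [covV, Matrix.det_diagonal, Fin.prod_univ_eq_prod_range (fun j => a + D j)]
  have hpos : 0 < ∏ j ∈ Finset.range m, (a + D j) :=
    Finset.prod_pos fun j hj => h j (Finset.mem_range.1 hj)
  rw [resLik, dotProduct_projP_mulVec_add x D m a h (isUnit_det_wGram hs 1 h),
    gram_eq_wGram x D m a h, hdet, Real.rpow_def_of_pos (posDef_wGram hs 1 h).det_pos,
    Real.rpow_def_of_pos hpos, Real.log_prod (fun j hj => (h j (Finset.mem_range.1 hj)).ne'),
    ← Real.exp_add, ← Real.exp_add, logLik, wls]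
  congr 1
  ring

theorem resLik_pos {x : ℕ → Fin p → ℝ} {D : ℕ → ℝ} {m : ℕ} (hs : Spans x m) {a : ℝ}
    (h : ∀ j < m, 0 < a + D j) (y : Fin m → ℝ) : 0 < resLik x D m a y := by
  -- Every data vector is a residual path for β = 0 after extension by zeros.
  have := resLik_eq_exp hs h 0 (fun j => if hj : j < m then y ⟨j, hj⟩ else 0)
  simp only [dotProduct_zero, zero_add, Fin.is_lt, dite_true, Fin.eta] at this
  rw [this]
  exact Real.exp_pos _

theorem hasDerivAt_wGram_apply (x : ℕ → Fin p → ℝ) (D : ℕ → ℝ) (m n : ℕ) {a : ℝ}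
    (h : ∀ j < m, 0 < a + D j) (k l : Fin p) :
    HasDerivAt (fun b => wGram x D m n b k l) (-(n * wGram x D m (n + 1) a k l)) a := by
  simp only [wGram, Matrix.of_apply, Finset.mul_sum, ← Finset.sum_neg_distrib]
  refine HasDerivAt.fun_sum fun j hj => ?_
  have h0 : (a + D j) ≠ 0 := (h j (Finset.mem_range.1 hj)).ne'
  have h1 : HasDerivAt (fun b => (b + D j) ^ n) (n * (a + D j) ^ (n - 1) * 1) a :=
    ((hasDerivAt_id a).add_const (D j)).pow n
  refine ((h1.fun_inv (pow_ne_zero n h0)).const_mul (x j k * x j l)).congr_deriv ?_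
  rcases n with _ | n
  · simp
  · simp only [Nat.add_sub_cancel]
    field_simp
    ring

theorem hasDerivAt_wSum_apply (x : ℕ → Fin p → ℝ) (D : ℕ → ℝ) (m n : ℕ) {a : ℝ}
    (h : ∀ j < m, 0 < a + D j) (z : ℕ → ℝ) (k : Fin p) :
    HasDerivAt (fun b => wSum x D m n b z k) (-(n * wSum x D m (n + 1) a z k)) a := by
  simp only [wSum, Finset.mul_sum, ← Finset.sum_neg_distrib]
  refine HasDerivAt.fun_sum fun j hj => ?_
  have h0 : (a + D j) ≠ 0 := (h j (Finset.mem_range.1 hj)).ne'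
  have h1 : HasDerivAt (fun b => (b + D j) ^ n) (n * (a + D j) ^ (n - 1) * 1) a :=
    ((hasDerivAt_id a).add_const (D j)).pow n
  refine ((h1.fun_inv (pow_ne_zero n h0)).const_mul (x j k * z j)).congr_deriv ?_
  rcases n with _ | n
  · simp
  · simp only [Nat.add_sub_cancel]
    field_simp
    ring

theorem continuousAt_wGram (x : ℕ → Fin p → ℝ) (D : ℕ → ℝ) (m n : ℕ) {a : ℝ}
    (h : ∀ j < m, 0 < a + D j) : ContinuousAt (fun b => wGram x D m n b) a :=
  continuousAt_pi.2 fun k => continuousAt_pi.2 fun l =>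
    (hasDerivAt_wGram_apply x D m n h k l).continuousAt

theorem continuousAt_inv_wGram {x : ℕ → Fin p → ℝ} {D : ℕ → ℝ} {m : ℕ} (hs : Spans x m) (n : ℕ)
    {a : ℝ} (h : ∀ j < m, 0 < a + D j) : ContinuousAt (fun b => (wGram x D m n b)⁻¹) a := by
  simp only [Matrix.inv_def, Ring.inverse_eq_inv']
  have hG := continuousAt_wGram x D m n h
  have hd : ContinuousAt (fun b => (wGram x D m n b).det) a :=
    (continuous_id.matrix_det.continuousAt (x := wGram x D m n a)).comp hG
  have ha : ContinuousAt (fun b => (wGram x D m n b).adjugate) a :=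
    (continuous_id.matrix_adjugate.continuousAt (x := wGram x D m n a)).comp hG
  exact (hd.inv₀ (posDef_wGram hs n h).det_pos.ne').smul ha

theorem continuousAt_wls {x : ℕ → Fin p → ℝ} {D : ℕ → ℝ} {m : ℕ} (hs : Spans x m)
    {a : ℝ} (h : ∀ j < m, 0 < a + D j) (z : ℕ → ℝ) :
    ContinuousAt (fun b => wls x D m b z) a := by
  refine continuousAt_pi.2 fun k => ?_
  simp only [wls, mulVec, dotProduct]
  refine tendsto_finsetSum _ fun l _ => ContinuousAt.mul ?_
    (hasDerivAt_wSum_apply x D m 1 h z l).continuousAt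
  exact continuousAt_pi.1 (continuousAt_pi.1 (continuousAt_inv_wGram hs 1 h) k) l

/-- Weighted sum of the leverages `x_j' (X' V⁻¹ X)⁻¹ x_j`. -/
noncomputable def levSum (x : ℕ → Fin p → ℝ) (D : ℕ → ℝ) (m n : ℕ) (a : ℝ) : ℝ :=
  ∑ j ∈ Finset.range m, x j ⬝ᵥ ((wGram x D m 1 a)⁻¹ *ᵥ x j) / (a + D j) ^ n

theorem trace_inv_mul_wGram (x : ℕ → Fin p → ℝ) (D : ℕ → ℝ) (m n : ℕ) (a : ℝ) :
    ((wGram x D m 1 a)⁻¹ * wGram x D m n a).trace = levSum x D m n a := by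
  simp only [Matrix.trace, Matrix.diag, Matrix.mul_apply, levSum, dotProduct, mulVec,
    Finset.mul_sum, Finset.sum_div]
  rw [Finset.sum_comm (s := Finset.range m)]
  refine Finset.sum_congr rfl fun k _ => ?_
  rw [Finset.sum_comm (s := Finset.range m)]
  refine Finset.sum_congr rfl fun l _ => ?_
  rw [wGram, wGram, Matrix.of_apply, Finset.mul_sum]
  refine Finset.sum_congr rfl fun j _ => ?_
  ring

/-- The weighted leverages sum to the trace of the hat matrix, that is, to the trace of the identity
of size p. -/
theorem levSum_one {x : ℕ → Fin p → ℝ} {D : ℕ → ℝ} {m : ℕ} (hs : Spans x m)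
    {a : ℝ} (h : ∀ j < m, 0 < a + D j) : levSum x D m 1 a = p := by
  rw [← trace_inv_mul_wGram, Matrix.nonsing_inv_mul _ (isUnit_det_wGram hs 1 h), Matrix.trace_one,
    Fintype.card_fin]

/-- Jacobi's formula: after pulling out det M, the expansion det(1 + rN) = 1 + r tr N + r² P(r) with
a polynomial P gives the derivative at r = 0. -/
theorem hasDerivAt_det_add_smul (M H : Matrix (Fin p) (Fin p) ℝ) (hM : IsUnit M.det) :
    HasDerivAt (fun r : ℝ => (M + r • H).det) (M.det * (M⁻¹ * H).trace) 0 := by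
  obtain ⟨P, hP⟩ : ∃ P : Polynomial ℝ, ∀ r : ℝ, (1 + r • (M⁻¹ * H)).det =
      1 + (M⁻¹ * H).trace * r + P.eval r * r ^ 2 := ⟨_, fun r => Matrix.det_one_add_smul r _⟩
  have h1 : (fun r : ℝ => (M + r • H).det) = fun r : ℝ => M.det * (1 + (M⁻¹ * H).trace * r +
      P.eval r * r ^ 2) := by
    funext r
    rw [← hP, ← Matrix.det_mul, Matrix.mul_add, Matrix.mul_one,
      Matrix.mul_smul, ← Matrix.mul_assoc, Matrix.mul_nonsing_inv _ hM, Matrix.one_mul]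
  rw [h1]
  have h2 := (((hasDerivAt_id (0 : ℝ)).const_mul (M⁻¹ * H).trace).const_add 1).add
    ((P.hasDerivAt 0).mul ((hasDerivAt_id (0 : ℝ)).pow 2))
  refine (h2.const_mul M.det).congr_deriv ?_
  simp

theorem differentiable_det :
    Differentiable ℝ fun M : Fin p → Fin p → ℝ => (Matrix.of M).det := by
  simp only [Matrix.det_apply, Matrix.of_apply]
  fun_prop

/-- The determinant is a polynomial in the entries, so it has a Fréchet derivative T at G. The value
of T in the direction H is read off along the straight line G + rH, where Jacobi's formula applies,
and is then used along the curve of Gram matrices. -/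
theorem hasDerivAt_det_wGram {x : ℕ → Fin p → ℝ} {D : ℕ → ℝ} {m : ℕ} (hs : Spans x m)
    {a : ℝ} (h : ∀ j < m, 0 < a + D j) :
    HasDerivAt (fun b => (wGram x D m 1 b).det)
      (-((wGram x D m 1 a).det * levSum x D m 2 a)) a := by
  set G := wGram x D m 1 a with hG
  set H := -wGram x D m 2 a with hH
  obtain ⟨T, hT⟩ := differentiable_det (p := p) (fun k l => G k l)
  have h1 : HasDerivAt (fun b => (fun k l => wGram x D m 1 b k l : Fin p → Fin p → ℝ))
      (fun k l => H k l) a := by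
    refine hasDerivAt_pi.2 fun k => hasDerivAt_pi.2 fun l => ?_
    refine (hasDerivAt_wGram_apply x D m 1 h k l).congr_deriv ?_
    simp [hH]
  have h2 : HasDerivAt (fun r : ℝ => (fun k l => (G + r • H) k l : Fin p → Fin p → ℝ))
      (fun k l => H k l) 0 := by
    refine hasDerivAt_pi.2 fun k => hasDerivAt_pi.2 fun l => ?_
    simp only [Matrix.add_apply, Matrix.smul_apply, smul_eq_mul]
    simpa using ((hasDerivAt_id (0 : ℝ)).mul_const (H k l)).const_add (G k l)
  have h3 := hT.comp_hasDerivAt a h1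
  have h4 : HasFDerivAt (fun M : Fin p → Fin p → ℝ => (Matrix.of M).det) T
      (fun k l => (G + (0 : ℝ) • H) k l) := by simpa using hT
  have h5 := h4.comp_hasDerivAt (0 : ℝ) h2
  have h6 := h5.unique (hasDerivAt_det_add_smul G H (isUnit_det_wGram hs 1 h))
  rw [h6] at h3
  refine h3.congr_deriv ?_
  rw [hH, Matrix.mul_neg, Matrix.trace_neg, trace_inv_mul_wGram]
  ring

theorem hasDerivAt_log_det_wGram {x : ℕ → Fin p → ℝ} {D : ℕ → ℝ} {m : ℕ} (hs : Spans x m)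
    {a : ℝ} (h : ∀ j < m, 0 < a + D j) :
    HasDerivAt (fun b => Real.log (wGram x D m 1 b).det) (-levSum x D m 2 a) a := by
  have h0 := (posDef_wGram hs 1 h).det_pos.ne'
  refine ((hasDerivAt_det_wGram hs h).log h0).congr_deriv ?_
  field_simp

/-- An exact difference formula for w'G⁻¹w in which the inverse appears only through the two
coefficient vectors. Dividing by b - a, one can differentiate w'G⁻¹w using no more than the
continuity of `wls`. -/
theorem wSum_dotProduct_wls_sub {x : ℕ → Fin p → ℝ} {D : ℕ → ℝ} {m : ℕ} (hs : Spans x m)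
    {a b : ℝ} (ha : ∀ j < m, 0 < a + D j) (hb : ∀ j < m, 0 < b + D j) (z : ℕ → ℝ) :
    wSum x D m 1 b z ⬝ᵥ wls x D m b z - wSum x D m 1 a z ⬝ᵥ wls x D m a z =
      (wSum x D m 1 b z - wSum x D m 1 a z) ⬝ᵥ (wls x D m b z + wls x D m a z) -
        wls x D m a z ⬝ᵥ ((wGram x D m 1 b - wGram x D m 1 a) *ᵥ wls x D m b z) := by
  have hcomm : wls x D m a z ⬝ᵥ (wGram x D m 1 a *ᵥ wls x D m b z) =
      wSum x D m 1 a z ⬝ᵥ wls x D m b z := by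
    rw [Matrix.dotProduct_mulVec, ← Matrix.mulVec_transpose, isSymm_wGram,
      wGram_mulVec_wls hs ha]
  rw [Matrix.sub_mulVec, dotProduct_sub, hcomm, wGram_mulVec_wls hs hb, sub_dotProduct,
    dotProduct_add, dotProduct_add, dotProduct_comm (wls x D m a z)]
  ring

theorem hasDerivAt_wSum_dotProduct_wls {x : ℕ → Fin p → ℝ} {D : ℕ → ℝ} {m : ℕ} (hs : Spans x m)
    {a : ℝ} (h : ∀ j < m, 0 < a + D j) (z : ℕ → ℝ) :
    HasDerivAt (fun b => wSum x D m 1 b z ⬝ᵥ wls x D m b z)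
      (-(2 * wSum x D m 2 a z ⬝ᵥ wls x D m a z) +
        wls x D m a z ⬝ᵥ (wGram x D m 2 a *ᵥ wls x D m a z)) a := by
  have hnear : ∀ᶠ b in 𝓝 a, ∀ j < m, 0 < b + D j := by
    have : ∀ᶠ b in 𝓝 a, ∀ j ∈ Finset.range m, 0 < b + D j := by
      rw [Filter.eventually_all_finset]
      intro j hj
      have hc : ContinuousAt (fun b => b + D j) a := by fun_prop
      exact hc.eventually (lt_mem_nhds (h j (Finset.mem_range.1 hj)))
    filter_upwards [this] with b hb j hj using hb j (Finset.mem_range.2 hj)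
  set β := wls x D m a z
  have hβ := continuousAt_pi.1 (continuousAt_wls hs h z)
  rw [hasDerivAt_iff_tendsto_slope]
  have hw : ∀ k, Tendsto (slope (fun b => wSum x D m 1 b z k) a) (𝓝[≠] a)
      (𝓝 (-wSum x D m 2 a z k)) := fun k => by
    simpa using hasDerivAt_iff_tendsto_slope.1 (hasDerivAt_wSum_apply x D m 1 h z k)
  have hG : ∀ k l, Tendsto (slope (fun b => wGram x D m 1 b k l) a) (𝓝[≠] a)
      (𝓝 (-wGram x D m 2 a k l)) := fun k l => by
    simpa using hasDerivAt_iff_tendsto_slope.1 (hasDerivAt_wGram_apply x D m 1 h k l)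
  have hβ' : ∀ k, Tendsto (fun b => wls x D m b z k) (𝓝[≠] a) (𝓝 (β k)) := fun k =>
    (hβ k).tendsto.mono_left nhdsWithin_le_nhds
  have key : Tendsto (fun b => ∑ k, slope (fun b => wSum x D m 1 b z k) a b *
      (wls x D m b z k + β k) - ∑ k, β k * ∑ l, slope (fun b => wGram x D m 1 b k l) a b *
        wls x D m b z l) (𝓝[≠] a) (𝓝 (∑ k, -wSum x D m 2 a z k * (β k + β k) -
          ∑ k, β k * ∑ l, -wGram x D m 2 a k l * β l)) :=
    (tendsto_finsetSum _ fun k _ => (hw k).mul ((hβ' k).add_const _)).sub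
      (tendsto_finsetSum _ fun k _ => (tendsto_finsetSum _ fun l _ =>
        (hG k l).mul (hβ' l)).const_mul _)
  have e1 : (∑ k, -wSum x D m 2 a z k * (β k + β k) -
          ∑ k, β k * ∑ l, -wGram x D m 2 a k l * β l) =
      -(2 * wSum x D m 2 a z ⬝ᵥ β) + β ⬝ᵥ (wGram x D m 2 a *ᵥ β) := by
    simp only [dotProduct, mulVec, neg_mul, Finset.sum_neg_distrib, mul_neg, sub_neg_eq_add,
      Finset.mul_sum, ← two_mul]
    congr 2
    refine Finset.sum_congr rfl fun k _ => ?_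
    ring
  rw [e1] at key
  refine key.congr' ?_
  filter_upwards [self_mem_nhdsWithin, nhdsWithin_le_nhds hnear] with b hb hb'
  have := wSum_dotProduct_wls_sub hs h hb' z
  rw [slope_def_field, this]
  simp only [slope_def_field, dotProduct, mulVec, Pi.sub_apply, Pi.add_apply, Matrix.sub_apply,
    sub_div, Finset.sum_div, Finset.mul_sum]
  have hne : b - a ≠ 0 := sub_ne_zero.2 hb
  congr 1
  · refine Finset.sum_congr rfl fun k _ => ?_
    simp only [β]; ring
  · refine Finset.sum_congr rfl fun k _ => Finset.sum_congr rfl fun l _ => ?_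
    simp only [β]; ring

/-- The part of the score which comes from the estimation of the regression coefficients. -/
noncomputable def scoreProj (x : ℕ → Fin p → ℝ) (D : ℕ → ℝ) (m : ℕ) (z : ℕ → ℝ) (a : ℝ) : ℝ :=
  levSum x D m 2 a / 2 - wSum x D m 2 a z ⬝ᵥ wls x D m a z +
    wls x D m a z ⬝ᵥ (wGram x D m 2 a *ᵥ wls x D m a z) / 2

theorem hasDerivAt_logLik {x : ℕ → Fin p → ℝ} {D : ℕ → ℝ} {m : ℕ} (hs : Spans x m)
    {a : ℝ} (h : ∀ j < m, 0 < a + D j) (z : ℕ → ℝ) :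
    HasDerivAt (logLik x D m z)
      ((∑ j ∈ Finset.range m, (z j ^ 2 / (a + D j) ^ 2 - 1 / (a + D j))) / 2 +
        scoreProj x D m z a) a := by
  have h1 := hasDerivAt_log_det_wGram hs h
  have h2 := hasDerivAt_wSum_dotProduct_wls hs h z
  have h3 : HasDerivAt (fun b => ∑ j ∈ Finset.range m, Real.log (b + D j))
      (∑ j ∈ Finset.range m, 1 / (a + D j)) a :=
    HasDerivAt.fun_sum fun j hj =>
      ((hasDerivAt_id a).add_const (D j)).log (h j (Finset.mem_range.1 hj)).ne'
  have h4 : HasDerivAt (fun b => ∑ j ∈ Finset.range m, z j ^ 2 / (b + D j))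
      (∑ j ∈ Finset.range m, -(z j ^ 2 / (a + D j) ^ 2)) a := by
    refine HasDerivAt.fun_sum fun j hj => ?_
    refine ((((hasDerivAt_id a).add_const (D j)).fun_inv
      (h j (Finset.mem_range.1 hj)).ne').const_mul (z j ^ 2)).congr_deriv ?_
    simp only [id_eq]
    ring
  refine (((h1.neg.div_const 2).sub (h3.div_const 2)).sub
    ((h4.sub h2).div_const 2)).congr_deriv ?_
  rw [scoreProj, Finset.sum_sub_distrib, Finset.sum_neg_distrib]
  ring

theorem continuousOn_resLik {x : ℕ → Fin p → ℝ} {D : ℕ → ℝ} {m : ℕ} (hs : Spans x m)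
    (hD : ∀ j, 0 < D j) (y : Fin m → ℝ) :
    ContinuousOn (fun a => resLik x D m a y) (Set.Ici 0) := by
  intro a ha
  have hp : ∀ b ∈ Set.Ici (0 : ℝ), ∀ j < m, 0 < b + D j := fun b hb j _ =>
    add_pos_of_nonneg_of_pos hb (hD j)
  have h1 : ∀ b ∈ Set.Ici (0 : ℝ), resLik x D m b y =
      Real.exp (logLik x D m (fun j => if hj : j < m then y ⟨j, hj⟩ else 0) b) := fun b hb => by
    have := resLik_eq_exp hs (hp b hb) 0 (fun j => if hj : j < m then y ⟨j, hj⟩ else 0)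
    simp only [dotProduct_zero, zero_add, Fin.is_lt, dite_true, Fin.eta] at this
    exact this
  refine ContinuousWithinAt.congr ?_ h1 (h1 a ha)
  exact (hasDerivAt_logLik hs (hp a ha) _).continuousAt.rexp.continuousWithinAt

end FayHerriot

/-! ### Positivity of the MSE estimator and of the likelihood maximizer -/

namespace FayHerriot

variable {p : ℕ}

theorem dotProduct_inv_wGram_nonneg {x : ℕ → Fin p → ℝ} {D : ℕ → ℝ} {m : ℕ} (hs : Spans x m)
    {a : ℝ} (h : ∀ j < m, 0 < a + D j) (v : Fin p → ℝ) :
    0 ≤ v ⬝ᵥ ((wGram x D m 1 a)⁻¹ *ᵥ v) := by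
  simpa using (posDef_wGram hs 1 h).inv.posSemidef.dotProduct_mulVec_nonneg v

theorem dotProduct_inv_wGram_pos {x : ℕ → Fin p → ℝ} {D : ℕ → ℝ} {m : ℕ} (hs : Spans x m)
    {a : ℝ} (h : ∀ j < m, 0 < a + D j) {v : Fin p → ℝ} (hv : v ≠ 0) :
    0 < v ⬝ᵥ ((wGram x D m 1 a)⁻¹ *ᵥ v) := by
  simpa using (posDef_wGram hs 1 h).inv.dotProduct_mulVec_pos hv

theorem trace_inv_covV_sq {D : ℕ → ℝ} {m : ℕ} {a : ℝ} (h : ∀ j < m, 0 < a + D j) :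
    (((covV D m a)⁻¹) ^ 2).trace = ∑ j ∈ Finset.range m, 1 / (a + D j) ^ 2 := by
  rw [inv_covV D m a h, Matrix.diagonal_pow, Matrix.trace_diagonal,
    ← Fin.sum_univ_eq_sum_range (fun j => 1 / (a + D j) ^ 2)]
  simp

theorem mseEst_pos {x : ℕ → Fin p → ℝ} {D : ℕ → ℝ} {m i : ℕ} (hs : Spans x m) (hi : i < m)
    (hD : ∀ j, 0 < D j) {c : ℝ → ℝ} {a : ℝ} (ha : 0 ≤ a) (hc : 0 ≤ c a) (h : x i ≠ 0 ∨ 0 < a) :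
    0 < mseEst x D m i c a := by
  have hp : ∀ j < m, 0 < a + D j := fun j _ => add_pos_of_nonneg_of_pos ha (hD j)
  have hDi := hD i
  have hai := hp i hi
  have h1 : 0 ≤ g1 D i a := div_nonneg (mul_nonneg ha hDi.le) hai.le
  have h2 : 0 ≤ g2 x D m i a := by
    rw [g2, gram_eq_wGram x D m a hp]
    exact mul_nonneg (by positivity) (dotProduct_inv_wGram_nonneg hs hp _)
  have h3 : 0 ≤ c a * g3 D m i a := by
    refine mul_nonneg hc ?_
    rw [g3, trace_inv_covV_sq hp]
    have : 0 ≤ ∑ j ∈ Finset.range m, 1 / (a + D j) ^ 2 :=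
      Finset.sum_nonneg fun j _ => by positivity
    positivity
  rw [mseEst]
  rcases h with h | h
  · have : 0 < g2 x D m i a := by
      rw [g2, gram_eq_wGram x D m a hp]
      exact mul_pos (by positivity) (dotProduct_inv_wGram_pos hs hp h)
    linarith
  · have : 0 < g1 D i a := div_pos (mul_pos h hDi) hai
    linarith

theorem levSum_two_nonneg {x : ℕ → Fin p → ℝ} {D : ℕ → ℝ} {m : ℕ} (hs : Spans x m)
    {a : ℝ} (h : ∀ j < m, 0 < a + D j) : 0 ≤ levSum x D m 2 a :=
  Finset.sum_nonneg fun _ _ => div_nonneg (dotProduct_inv_wGram_nonneg hs h _) (sq_nonneg _)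

/-- One factor 1/(a + D_j) is bounded by 1/(a + d); the leverages with the other factor sum to p. -/
theorem levSum_two_le {x : ℕ → Fin p → ℝ} {D : ℕ → ℝ} {m : ℕ} (hs : Spans x m)
    {d a : ℝ} (hd : 0 < a + d) (h : ∀ j < m, d ≤ D j) : levSum x D m 2 a ≤ p / (a + d) := by
  have hp : ∀ j < m, 0 < a + D j := fun j hj => by linarith [h j hj]
  rw [← levSum_one hs hp, levSum, levSum, Finset.sum_div]
  refine Finset.sum_le_sum fun j hj => ?_
  have hj' := Finset.mem_range.1 hj
  have h0 := hp j hj'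
  rw [div_div]
  refine div_le_div_of_nonneg_left (dotProduct_inv_wGram_nonneg hs hp _) (by positivity) ?_
  rw [pow_one, sq]
  exact mul_le_mul_of_nonneg_left (by linarith [h j hj']) h0.le

theorem log_det_wGram_antitoneOn {x : ℕ → Fin p → ℝ} {D : ℕ → ℝ} {m : ℕ} (hs : Spans x m)
    (hD : ∀ j, 0 < D j) : AntitoneOn (fun a => Real.log (wGram x D m 1 a).det) (Set.Ici 0) := by
  have hp : ∀ b ∈ Set.Ici (0 : ℝ), ∀ j < m, 0 < b + D j := fun b hb j _ =>
    add_pos_of_nonneg_of_pos hb (hD j)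
  refine antitoneOn_of_deriv_nonpos (convex_Ici 0)
    (fun a ha => (hasDerivAt_log_det_wGram hs (hp a ha)).continuousAt.continuousWithinAt) ?_ ?_
  · intro a ha
    rw [interior_Ici] at ha
    exact (hasDerivAt_log_det_wGram hs
      (hp a (Set.mem_Ici.2 (le_of_lt ha)))).differentiableAt.differentiableWithinAt
  · intro a ha
    rw [interior_Ici] at ha
    have hpa := hp a (Set.mem_Ici.2 (le_of_lt ha))
    rw [(hasDerivAt_log_det_wGram hs hpa).deriv]
    linarith [levSum_two_nonneg hs hpa]

/-- The derivative p/(a + d) - `levSum` is nonnegative by the leverage bound. Hence |X'V⁻¹X| decays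
no faster than (a + d)^(-p), which limits what the determinant can add to the likelihood at large a.
-/
theorem log_det_wGram_add_log_monotoneOn {x : ℕ → Fin p → ℝ} {D : ℕ → ℝ} {m : ℕ} (hs : Spans x m)
    {d : ℝ} (hd : 0 < d) (hD : ∀ j, d ≤ D j) :
    MonotoneOn (fun a => Real.log (wGram x D m 1 a).det + p * Real.log (a + d)) (Set.Ici 0) := by
  have hp : ∀ b ∈ Set.Ici (0 : ℝ), ∀ j < m, 0 < b + D j := fun b hb j _ =>
    add_pos_of_nonneg_of_pos hb (hd.trans_le (hD j))
  have hder : ∀ a ∈ Set.Ici (0 : ℝ), HasDerivAt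
      (fun a => Real.log (wGram x D m 1 a).det + p * Real.log (a + d))
      (-levSum x D m 2 a + p * (1 / (a + d))) a := fun a ha =>
    (hasDerivAt_log_det_wGram hs (hp a ha)).add ((((hasDerivAt_id a).add_const d).log
      (add_pos_of_nonneg_of_pos ha hd).ne').const_mul _)
  refine monotoneOn_of_deriv_nonneg (convex_Ici 0)
    (fun a ha => (hder a ha).continuousAt.continuousWithinAt) ?_ ?_
  · intro a ha
    rw [interior_Ici] at ha
    exact (hder a (Set.mem_Ici.2 (le_of_lt ha))).differentiableAt.differentiableWithinAt
  · intro a ha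
    rw [interior_Ici] at ha
    have ha' : (0 : ℝ) < a := ha
    rw [(hder a (Set.mem_Ici.2 (le_of_lt ha))).deriv]
    have := levSum_two_le hs (d := d) (a := a) (by linarith) (fun j _ => hD j)
    rw [mul_one_div]
    linarith

theorem wSum_dotProduct (x : ℕ → Fin p → ℝ) (D : ℕ → ℝ) (m n : ℕ) (a : ℝ) (z : ℕ → ℝ)
    (v : Fin p → ℝ) :
    wSum x D m n a z ⬝ᵥ v = ∑ j ∈ Finset.range m, (x j ⬝ᵥ v) * z j / (a + D j) ^ n := by
  simp only [dotProduct, wSum, Finset.sum_mul, Finset.sum_div]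
  rw [Finset.sum_comm]
  refine Finset.sum_congr rfl fun j _ => Finset.sum_congr rfl fun k _ => ?_
  ring

/-- The difference of the two sides is the weighted residual sum of squares of the least squares
fit. -/
theorem wSum_dotProduct_wls_le {x : ℕ → Fin p → ℝ} {D : ℕ → ℝ} {m : ℕ} (hs : Spans x m)
    {a : ℝ} (h : ∀ j < m, 0 < a + D j) (z : ℕ → ℝ) :
    wSum x D m 1 a z ⬝ᵥ wls x D m a z ≤ ∑ j ∈ Finset.range m, z j ^ 2 / (a + D j) := by
  set β := wls x D m a z with hβ
  have h1 : 0 ≤ ∑ j ∈ Finset.range m, (z j - x j ⬝ᵥ β) ^ 2 / (a + D j) :=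
    Finset.sum_nonneg fun j hj => div_nonneg (sq_nonneg _) (h j (Finset.mem_range.1 hj)).le
  have h2 := wSum_dotProduct x D m 1 a z β
  have h3 := dotProduct_wGram_mulVec x D m 1 a β β
  rw [wGram_mulVec_wls hs h, dotProduct_comm] at h3
  have h4 : ∑ j ∈ Finset.range m, (z j - x j ⬝ᵥ β) ^ 2 / (a + D j) =
      ∑ j ∈ Finset.range m, z j ^ 2 / (a + D j) -
        2 * ∑ j ∈ Finset.range m, (x j ⬝ᵥ β) * z j / (a + D j) ^ 1 +
        ∑ j ∈ Finset.range m, (x j ⬝ᵥ β) * (x j ⬝ᵥ β) / (a + D j) ^ 1 := by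
    rw [Finset.mul_sum, ← Finset.sum_sub_distrib, ← Finset.sum_add_distrib]
    refine Finset.sum_congr rfl fun j _ => ?_
    ring
  rw [h4, ← h2, ← h3] at h1
  linarith

theorem wSum_dotProduct_wls_nonneg {x : ℕ → Fin p → ℝ} {D : ℕ → ℝ} {m : ℕ} (hs : Spans x m)
    {a : ℝ} (h : ∀ j < m, 0 < a + D j) (z : ℕ → ℝ) :
    0 ≤ wSum x D m 1 a z ⬝ᵥ wls x D m a z :=
  dotProduct_inv_wGram_nonneg hs h _

/-- |V|^(-1/2) contributes a^(-m/2), |X'V⁻¹X|^(-1/2) at most a constant times a^(p/2), and the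
exponential at most 1. The constant K compares the Gram determinant with its value at 0 and uses
log(a + d) ≤ log a + log(1 + d) for a ≥ 1. -/
theorem resLik_isBigO {x : ℕ → Fin p → ℝ} {D : ℕ → ℝ} {m : ℕ} (hs : Spans x m)
    {d : ℝ} (hd : 0 < d) (hD : ∀ j, d ≤ D j) (y : Fin m → ℝ) :
    (fun a => resLik x D m a y) =O[atTop] fun a : ℝ => a ^ (((p : ℝ) - m) / 2) := by
  set z : ℕ → ℝ := fun j => if hj : j < m then y ⟨j, hj⟩ else 0 with hz
  set K := -(Real.log (wGram x D m 1 0).det) / 2 - p * Real.log d / 2 +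
    p * Real.log (1 + d) / 2 with hK
  refine IsBigO.of_bound (Real.exp K) ?_
  filter_upwards [eventually_ge_atTop 1] with a ha
  have ha0 : 0 < a := by linarith
  have hp : ∀ j < m, 0 < a + D j := fun j _ => by linarith [hD j]
  have h1 := resLik_eq_exp hs hp 0 z
  simp only [dotProduct_zero, zero_add, hz, Fin.is_lt, dite_true, Fin.eta] at h1
  rw [h1, Real.norm_of_nonneg (Real.exp_pos _).le, Real.norm_of_nonneg (Real.rpow_nonneg ha0.le _),
    Real.rpow_def_of_pos ha0, ← Real.exp_add, Real.exp_le_exp]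
  have h2 := wSum_dotProduct_wls_le hs hp z
  have h3 := log_det_wGram_add_log_monotoneOn hs hd hD (Set.mem_Ici.2 le_rfl)
    (Set.mem_Ici.2 ha0.le) ha0.le
  have h4 : m * Real.log a ≤ ∑ j ∈ Finset.range m, Real.log (a + D j) := by
    rw [← nsmul_eq_mul, ← Finset.card_range m, ← Finset.sum_const, Finset.card_range]
    exact Finset.sum_le_sum fun j _ => Real.log_le_log ha0 (by linarith [hD j])
  have h5 : (p : ℝ) * Real.log (a + d) ≤ p * Real.log a + p * Real.log (1 + d) := by
    rw [← mul_add, ← Real.log_mul ha0.ne' (by positivity)]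
    refine mul_le_mul_of_nonneg_left (Real.log_le_log (by positivity) ?_) (Nat.cast_nonneg _)
    nlinarith
  simp only [zero_add] at h3
  rw [logLik, hK]
  linarith

theorem exists_pos_argmax {f : ℝ → ℝ} (hf : ContinuousOn f (Set.Ici 0)) (h0 : f 0 = 0)
    (hpos : ∀ a, 0 < a → 0 < f a) (hlim : Tendsto f atTop (𝓝 0)) :
    (∃ a, 0 < a ∧ ∀ b, 0 ≤ b → f b ≤ f a) ∧ ∀ a, 0 ≤ a → (∀ b, 0 ≤ b → f b ≤ f a) → 0 < a := by
  constructor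
  · have h1 : ∀ᶠ a in atTop, f a < f 1 := hlim.eventually (gt_mem_nhds (hpos 1 one_pos))
    obtain ⟨B, hB⟩ := eventually_atTop.1 h1
    have hB1 : 1 ≤ max B 1 := le_max_right _ _
    obtain ⟨a, ha, hmax⟩ := isCompact_Icc.exists_isMaxOn (s := Set.Icc 0 (max B 1))
      ⟨1, by constructor <;> linarith⟩ (hf.mono Set.Icc_subset_Ici_self)
    have h1a : f 1 ≤ f a := hmax (a := 1) ⟨zero_le_one, hB1⟩
    refine ⟨a, ?_, fun b hb => ?_⟩
    · refine ha.1.lt_of_ne fun h => ?_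
      rw [← h, h0] at h1a
      linarith [hpos 1 one_pos]
    · rcases le_total b (max B 1) with h | h
      · exact hmax ⟨hb, h⟩
      · exact (hB b ((le_max_left _ _).trans h)).le.trans h1a
  · intro a ha hmax
    refine ha.lt_of_ne fun h => ?_
    have := hmax 1 zero_le_one
    rw [← h, h0] at this
    linarith [hpos 1 one_pos]

theorem FactorShape.nonneg {L : ℝ → ℝ} (hL : FactorShape L) : 0 ≤ L 0 := by
  have h1 : Tendsto L (𝓝[>] 0) (𝓝 (L 0)) :=
    (hL.continuousOn 0 Set.self_mem_Ici).tendsto.mono_left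
      (nhdsWithin_mono _ Set.Ioi_subset_Ici_self)
  exact ge_of_tendsto h1 (by filter_upwards [self_mem_nhdsWithin] with a ha using (hL.pos a ha).le)

/-- If c ≥ 0, the integrand is at most 2/(s + d), so L = O(a²), and m > p + 4 suffices. In the other
case c ≤ 2 allows (2 - c)/(s + d) ≤ (2 - c)/s beyond s = 1, so L is bounded by a multiple of exp(log
a² - ∫ c/s), which the hypothesis controls; the integral over [0, 1] is a constant. -/
theorem factor_mul_rpow_tendsto_zero {L c : ℝ → ℝ} {d : ℝ} (hd : 0 < d) (hL : ∀ a, 0 < a → 0 < L a)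
    (hc : ContinuousOn c (Set.Ici 0)) (hc2 : ∀ a, 0 ≤ a → c a ≤ 2) {m : ℕ}
    (hbdd : ∃ C : ℝ, ∀ a, 0 < a →
      Real.log (L a) ≤ C + ∫ s in (0 : ℝ)..a, (2 - c s) / (s + d))
    (hcase : (∀ a, 0 ≤ a → 0 ≤ c a) ∧ p + 4 < m ∨
        p < m ∧ (fun a : ℝ => Real.exp (Real.log (a ^ 2) - ∫ s in (1 : ℝ)..a, c s / s))
          =o[atTop] (fun a : ℝ => a ^ (((m : ℝ) - p) / 2))) :
    Tendsto (fun a => L a * a ^ (((p : ℝ) - m) / 2)) atTop (𝓝 0) := by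
  obtain ⟨C, hC⟩ := hbdd
  have hcont : ContinuousOn (fun s => (2 - c s) / (s + d)) (Set.Ici 0) :=
    (continuousOn_const.sub hc).div (by fun_prop) fun s hs =>
      (add_pos_of_nonneg_of_pos (Set.mem_Ici.1 hs) hd).ne'
  have hint : ∀ a b : ℝ, 0 ≤ a → a ≤ b →
      IntervalIntegrable (fun s => (2 - c s) / (s + d)) volume a b := fun a b ha hab => by
    refine (hcont.mono ?_).intervalIntegrable
    rw [Set.uIcc_of_le hab]
    exact fun s hs => ha.trans hs.1
  have hlog : Tendsto (fun a : ℝ => Real.log a) atTop atTop := Real.tendsto_log_atTop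
  rcases hcase with ⟨hc0, hpm⟩ | ⟨-, ho⟩
  · have hpm' : (p : ℝ) + 4 < m := by exact_mod_cast hpm
    have hbound : ∀ a : ℝ, 1 ≤ a → L a * a ^ (((p : ℝ) - m) / 2) ≤
        Real.exp (C + 2 * Real.log (1 + d) - 2 * Real.log d) * a ^ (-(((m : ℝ) - p - 4) / 2)) := by
      intro a ha
      have ha0 : 0 < a := by linarith
      have h1 : ∫ s in (0 : ℝ)..a, (2 - c s) / (s + d) ≤ ∫ s in (0 : ℝ)..a, 2 * (1 / (s + d)) := by
        refine intervalIntegral.integral_mono_on ha0.le (hint 0 a le_rfl ha0.le) ?_ fun s hs => ?_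
        · refine ContinuousOn.intervalIntegrable ?_
          rw [Set.uIcc_of_le ha0.le]
          refine continuousOn_const.mul (continuousOn_const.div (by fun_prop) fun s hs => ?_)
          linarith [hs.1]
        · rw [mul_one_div]
          exact div_le_div_of_nonneg_right (by linarith [hc0 s hs.1]) (by linarith [hs.1])
      have h2 : ∫ s in (0 : ℝ)..a, 2 * (1 / (s + d)) = 2 * (Real.log (a + d) - Real.log d) := by
        rw [intervalIntegral.integral_const_mul,
          intervalIntegral.integral_comp_add_right (fun s => 1 / s), zero_add,
          integral_one_div_of_pos hd (by linarith), Real.log_div (by linarith) hd.ne']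
      have h3 : Real.log (a + d) ≤ Real.log a + Real.log (1 + d) := by
        rw [← Real.log_mul ha0.ne' (by positivity)]
        exact Real.log_le_log (by positivity) (by nlinarith)
      rw [← Real.exp_log (hL a ha0), Real.rpow_def_of_pos ha0, Real.rpow_def_of_pos ha0,
        ← Real.exp_add, ← Real.exp_add, Real.exp_le_exp]
      have := hC a ha0
      linarith
    have hz : Tendsto (fun a : ℝ => Real.exp (C + 2 * Real.log (1 + d) - 2 * Real.log d) *
        a ^ (-(((m : ℝ) - p - 4) / 2))) atTop (𝓝 0) := by
      simpa using (tendsto_rpow_neg_atTop (y := ((m : ℝ) - p - 4) / 2) (by linarith)).const_mul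
        (Real.exp (C + 2 * Real.log (1 + d) - 2 * Real.log d))
    refine squeeze_zero' ?_ ?_ hz
    · filter_upwards [eventually_gt_atTop 0] with a ha
      exact mul_nonneg (hL a ha).le (Real.rpow_nonneg ha.le _)
    · filter_upwards [eventually_ge_atTop 1] with a ha using hbound a ha
  · set K := ∫ s in (0 : ℝ)..1, (2 - c s) / (s + d)
    have hbound : ∀ a : ℝ, 1 ≤ a → L a * a ^ (((p : ℝ) - m) / 2) ≤
        Real.exp (C + K) * (Real.exp (Real.log (a ^ 2) - ∫ s in (1 : ℝ)..a, c s / s) /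
          a ^ (((m : ℝ) - p) / 2)) := by
      intro a ha
      have ha0 : 0 < a := by linarith
      have hcs : IntervalIntegrable (fun s => c s / s) volume 1 a := by
        refine ContinuousOn.intervalIntegrable ?_
        rw [Set.uIcc_of_le ha]
        refine (hc.mono fun s hs => ?_).div continuousOn_id fun s hs => ?_
        · exact Set.mem_Ici.2 (by linarith [hs.1])
        · linarith [hs.1]
      have h2s : IntervalIntegrable (fun s : ℝ => 2 * (1 / s)) volume 1 a := by
        refine ContinuousOn.intervalIntegrable ?_
        rw [Set.uIcc_of_le ha]
        refine continuousOn_const.mul (continuousOn_const.div continuousOn_id fun s hs => ?_)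
        linarith [hs.1]
      have h1 : ∫ s in (1 : ℝ)..a, (2 - c s) / (s + d) ≤
          ∫ s in (1 : ℝ)..a, (2 * (1 / s) - c s / s) := by
        refine intervalIntegral.integral_mono_on ha (hint 1 a zero_le_one ha) (h2s.sub hcs)
          fun s hs => ?_
        have hs0 : 0 < s := by linarith [hs.1]
        rw [mul_one_div, ← sub_div]
        exact div_le_div_of_nonneg_left (by linarith [hc2 s hs0.le]) hs0 (by linarith)
      have h2 : ∫ s in (1 : ℝ)..a, (2 * (1 / s) - c s / s) =
          2 * Real.log a - ∫ s in (1 : ℝ)..a, c s / s := by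
        rw [intervalIntegral.integral_sub h2s hcs, intervalIntegral.integral_const_mul,
          integral_one_div_of_pos one_pos ha0, div_one]
      have h3 := intervalIntegral.integral_add_adjacent_intervals (hint 0 1 le_rfl zero_le_one)
        (hint 1 a zero_le_one ha)
      rw [← Real.exp_log (hL a ha0), Real.rpow_def_of_pos ha0, Real.rpow_def_of_pos ha0,
        ← Real.exp_add, ← Real.exp_sub, ← Real.exp_add, Real.exp_le_exp, Real.log_pow]
      have := hC a ha0
      push_cast
      linarith
    have hz := ho.tendsto_div_nhds_zero.const_mul (Real.exp (C + K))
    rw [mul_zero] at hz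
    refine squeeze_zero' ?_ ?_ hz
    · filter_upwards [eventually_gt_atTop 0] with a ha
      exact mul_nonneg (hL a ha).le (Real.rpow_nonneg ha.le _)
    · filter_upwards [eventually_ge_atTop 1] with a ha using hbound a ha

/-- `G` is the factor whose growth is under control. A bounded additional factor enters only through
the constant `C`, and makes `F` vanish at 0. -/
theorem exists_pos_isAdjArgmax {x : ℕ → Fin p → ℝ} {D : ℕ → ℝ} {m : ℕ} (hs : Spans x m)
    {d : ℝ} (hd : 0 < d) (hD : ∀ j, d ≤ D j) {F G : ℝ → ℝ} (hF : ContinuousOn F (Set.Ici 0))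
    (hF0 : F 0 = 0) (hFpos : ∀ a, 0 < a → 0 < F a) {C : ℝ} (hFG : ∀ a, 0 < a → F a ≤ C * G a)
    (hG : Tendsto (fun a => G a * a ^ (((p : ℝ) - m) / 2)) atTop (𝓝 0)) (y : Fin m → ℝ) :
    (∃ a, 0 < a ∧ IsAdjArgmax x D m F y a) ∧ ∀ a, IsAdjArgmax x D m F y a → 0 < a := by
  have hD0 : ∀ j, 0 < D j := fun j => hd.trans_le (hD j)
  have hpos : ∀ a, 0 ≤ a → 0 < resLik x D m a y := fun a ha =>
    resLik_pos hs (fun j _ => add_pos_of_nonneg_of_pos ha (hD0 j)) y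
  have hlim : Tendsto (fun a => F a * resLik x D m a y) atTop (𝓝 0) := by
    have h1 : (fun a => F a * resLik x D m a y) =O[atTop]
        fun a => G a * a ^ (((p : ℝ) - m) / 2) := by
      refine IsBigO.mul (IsBigO.of_bound |C| ?_) (resLik_isBigO hs hd hD y)
      filter_upwards [eventually_gt_atTop 0] with a ha
      rw [Real.norm_of_nonneg (hFpos a ha).le, Real.norm_eq_abs, ← abs_mul]
      exact (hFG a ha).trans (le_abs_self _)
    exact h1.trans_tendsto hG
  have := exists_pos_argmax (f := fun a => F a * resLik x D m a y)
    (hF.mul (continuousOn_resLik hs hD0 y)) (by simp [hF0])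
    (fun a ha => mul_pos (hFpos a ha) (hpos a ha.le)) hlim
  refine ⟨?_, fun a ha => this.2 a ha.1 ha.2⟩
  obtain ⟨a, ha, hmax⟩ := this.1
  exact ⟨a, ha, ha.le, hmax⟩

end FayHerriot

/-! ### Uniform bounds from the regularity conditions -/

namespace FayHerriot

variable {p : ℕ}

theorem abs_dotProduct_le (v w : Fin p → ℝ) : |v ⬝ᵥ w| ≤ p * (‖v‖ * ‖w‖) := by
  rw [dotProduct]
  refine (Finset.abs_sum_le_sum_abs _ _).trans ?_
  have : ∀ k ∈ Finset.univ, |v k * w k| ≤ ‖v‖ * ‖w‖ := fun k _ => by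
    rw [abs_mul]
    exact mul_le_mul (norm_le_pi_norm v k) (norm_le_pi_norm w k) (abs_nonneg _) (norm_nonneg _)
  refine (Finset.sum_le_card_nsmul _ _ _ this).trans ?_
  simp

/-- Bounds on the covariates and the sampling variances that hold for all large `m`. -/
structure Bounds (x : ℕ → Fin p → ℝ) (D : ℕ → ℝ) (K d₁ d₂ : ℝ) (m : ℕ) : Prop where
  one_le : 1 ≤ K
  d₁_pos : 0 < d₁
  le_D : ∀ j, d₁ ≤ D j
  D_le : ∀ j, D j ≤ d₂
  norm_le : ∀ j, ‖x j‖ ≤ K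
  pos : 0 < m
  spans : Spans x m
  coercive : ∀ v : Fin p → ℝ, m * ‖v‖ ^ 2 ≤ K * ∑ j ∈ Finset.range m, (x j ⬝ᵥ v) ^ 2

/-- With s = (X'X)⁻¹u one has u·v = Σ (x_j·v)(x_j·s) and u·s = Σ (x_j·s)², so this is the
Cauchy–Schwarz inequality over the areas. -/
theorem sq_dotProduct_le {x : ℕ → Fin p → ℝ} {m : ℕ} (hs : Spans x m) (u v : Fin p → ℝ) :
    (u ⬝ᵥ v) ^ 2 ≤ u ⬝ᵥ (((design x m)ᵀ * design x m)⁻¹ *ᵥ u) *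
      ∑ j ∈ Finset.range m, (x j ⬝ᵥ v) ^ 2 := by
  -- The unweighted Gram matrix is the weighted one with exponent 0; the variances 1 only serve to
  -- make the denominators positive.
  have hG : (design x m)ᵀ * design x m = wGram x (fun _ => 1) m 0 0 := by
    ext k l
    rw [Matrix.mul_apply, wGram, Matrix.of_apply,
      ← Fin.sum_univ_eq_sum_range (fun j => x j k * x j l / (0 + 1) ^ 0)]
    simp [design]
  have hp : ∀ j < m, 0 < (0 : ℝ) + (fun _ => 1 : ℕ → ℝ) j := by simp
  rw [hG]
  set G := wGram x (fun _ => 1) m 0 0 with hGdef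
  set s := G⁻¹ *ᵥ u with hsdef
  have h1 : G *ᵥ s = u := by
    rw [hsdef, Matrix.mulVec_mulVec, Matrix.mul_nonsing_inv _ (isUnit_det_wGram hs 0 hp),
      Matrix.one_mulVec]
  have h2 : u ⬝ᵥ v = ∑ j ∈ Finset.range m, (x j ⬝ᵥ v) * (x j ⬝ᵥ s) := by
    have := dotProduct_wGram_mulVec x (fun _ => 1) m 0 0 v s
    rw [← hGdef, h1, dotProduct_comm] at this
    simpa using this
  have h3 : u ⬝ᵥ s = ∑ j ∈ Finset.range m, (x j ⬝ᵥ s) ^ 2 := by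
    have := dotProduct_wGram_mulVec x (fun _ => 1) m 0 0 s s
    rw [← hGdef, h1, dotProduct_comm] at this
    simpa [sq] using this
  rw [h2, h3, mul_comm (∑ j ∈ Finset.range m, (x j ⬝ᵥ s) ^ 2)]
  exact Finset.sum_mul_sq_le_sq_mul_sq _ _ _

theorem Spans.exists_norm_sq_le {x : ℕ → Fin p → ℝ} {m : ℕ} (hs : Spans x m) :
    ∃ K : ℝ, 0 ≤ K ∧ ∀ v : Fin p → ℝ, ‖v‖ ^ 2 ≤ K * ∑ j ∈ Finset.range m, (x j ⬝ᵥ v) ^ 2 := by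
  have hker : (design x m).mulVecLin.ker = ⊥ := by
    rw [LinearMap.ker_eq_bot']
    intro v hv
    refine hs v fun j hj => ?_
    have := congrFun hv ⟨j, hj⟩
    simpa [Matrix.mulVecLin_apply, mulVec, design] using this
  obtain ⟨K, -, hK⟩ := LinearMap.exists_antilipschitzWith (design x m).mulVecLin hker
  refine ⟨K ^ 2, by positivity, fun v => ?_⟩
  have h1 : ‖v‖ ≤ K * ‖(design x m).mulVecLin v‖ := by
    simpa using hK.le_mul_dist v 0
  have h2 : ‖(design x m).mulVecLin v‖ ≤ √(∑ j ∈ Finset.range m, (x j ⬝ᵥ v) ^ 2) := by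
    refine (pi_norm_le_iff_of_nonneg (Real.sqrt_nonneg _)).2 fun j => ?_
    refine Real.le_sqrt_of_sq_le ?_
    rw [Real.norm_eq_abs, sq_abs]
    exact Finset.single_le_sum (f := fun j => (x j ⬝ᵥ v) ^ 2) (fun _ _ => sq_nonneg _)
      (Finset.mem_range.2 j.2)
  have h3 := h1.trans (mul_le_mul_of_nonneg_left h2 K.2)
  calc ‖v‖ ^ 2 ≤ (K * √(∑ j ∈ Finset.range m, (x j ⬝ᵥ v) ^ 2)) ^ 2 :=
        pow_le_pow_left₀ (norm_nonneg _) h3 2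
    _ = _ := by rw [mul_pow, Real.sq_sqrt (Finset.sum_nonneg fun _ _ => sq_nonneg _)]

theorem Spans.mono {x : ℕ → Fin p → ℝ} {m n : ℕ} (hs : Spans x m) (h : m ≤ n) : Spans x n :=
  fun v hv => hs v fun j hj => hv j (hj.trans_le h)

/-- Coercivity at the rate m comes from the leverage condition. Some fixed number m₀ of areas
already spans, so ‖v‖² is bounded by their sum of (x_j·v)². Each of these m₀ squares is at most its
leverage, O(1/m), times the full sum over m areas. -/
theorem Regular.exists_bounds {x : ℕ → Fin p → ℝ} {D : ℕ → ℝ} (h : Regular x D) :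
    ∃ K d₁ d₂ : ℝ, ∀ᶠ m in atTop, Bounds x D K d₁ d₂ m := by
  obtain ⟨C, hC⟩ := h.bounded
  obtain ⟨Cl, hCl⟩ := h.leverage
  obtain ⟨d₁, d₂, hd₁, hD⟩ := h.variance
  obtain ⟨m₀, hm₀⟩ := h.rank_eq.exists
  have hs := spans_of_rank_eq hm₀
  obtain ⟨K₀, hK₀, hK⟩ := hs.exists_norm_sq_le
  refine ⟨max 1 (max |C| (K₀ * (m₀ * Cl))), d₁, d₂, ?_⟩
  filter_upwards [hCl, eventually_ge_atTop m₀, eventually_gt_atTop 0] with m hm hmm₀ hm0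
  have hm0' : (0 : ℝ) < m := by exact_mod_cast hm0
  refine ⟨le_max_left _ _, hd₁, fun j => (hD j).1, fun j => (hD j).2, fun j => ?_, hm0,
    hs.mono hmm₀, fun v => ?_⟩
  · refine (pi_norm_le_iff_of_nonneg (by positivity)).2 fun k => ?_
    exact ((hC j k).trans (le_abs_self C)).trans ((le_max_left _ _).trans (le_max_right _ _))
  · set S := ∑ j ∈ Finset.range m, (x j ⬝ᵥ v) ^ 2 with hS
    have hS0 : 0 ≤ S := Finset.sum_nonneg fun _ _ => sq_nonneg _
    have h1 : ∑ j ∈ Finset.range m₀, (x j ⬝ᵥ v) ^ 2 ≤ m₀ * (Cl / m * S) := by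
      rw [← nsmul_eq_mul]
      nth_rw 2 [← Finset.card_range m₀]
      refine Finset.sum_le_card_nsmul _ _ _ fun j hj => ?_
      exact (sq_dotProduct_le (hs.mono hmm₀) _ _).trans (mul_le_mul_of_nonneg_right
        (hm j ((Finset.mem_range.1 hj).trans_le hmm₀)) hS0)
    calc (m : ℝ) * ‖v‖ ^ 2 ≤ m * (K₀ * (m₀ * (Cl / m * S))) := by
          gcongr
          exact (hK v).trans (mul_le_mul_of_nonneg_left h1 hK₀)
      _ = K₀ * (m₀ * Cl) * S := by field_simp
      _ ≤ _ := mul_le_mul_of_nonneg_right ((le_max_right _ _).trans (le_max_right _ _)) hS0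

namespace Bounds

variable {x : ℕ → Fin p → ℝ} {D : ℕ → ℝ} {K d₁ d₂ : ℝ} {m : ℕ}

theorem add_pos (h : Bounds x D K d₁ d₂ m) {a : ℝ} (ha : 0 ≤ a) (j : ℕ) : 0 < a + D j := by
  linarith [h.d₁_pos, h.le_D j]

theorem d₁_le (h : Bounds x D K d₁ d₂ m) : d₁ ≤ d₂ := (h.le_D 0).trans (h.D_le 0)

theorem K_pos (h : Bounds x D K d₁ d₂ m) : 0 < K := by linarith [h.one_le]

theorem m_pos (h : Bounds x D K d₁ d₂ m) : (0 : ℝ) < m := by exact_mod_cast h.pos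

/-- For u = G⁻¹v, coercivity bounds u·v = u'Gu below by a multiple of m‖u‖²/(a + d₂), while u·v ≤
p‖u‖‖v‖; one factor ‖u‖ cancels. -/
theorem norm_inv_wGram_mulVec_le (h : Bounds x D K d₁ d₂ m) {a : ℝ} (ha : 0 ≤ a)
    (v : Fin p → ℝ) :
    ‖(wGram x D m 1 a)⁻¹ *ᵥ v‖ ≤ p * K * (a + d₂) / m * ‖v‖ := by
  have hpos : ∀ j < m, 0 < a + D j := fun j _ => h.add_pos ha j
  have hm := h.m_pos
  have had : 0 < a + d₂ := by linarith [h.d₁_pos, h.d₁_le]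
  set u := (wGram x D m 1 a)⁻¹ *ᵥ v with hu
  have h1 : wGram x D m 1 a *ᵥ u = v := by
    rw [hu, Matrix.mulVec_mulVec, Matrix.mul_nonsing_inv _ (isUnit_det_wGram h.spans 1 hpos),
      Matrix.one_mulVec]
  have h2 : (∑ j ∈ Finset.range m, (x j ⬝ᵥ u) ^ 2) / (a + d₂) ≤ u ⬝ᵥ v := by
    rw [← h1, dotProduct_wGram_mulVec, Finset.sum_div]
    refine Finset.sum_le_sum fun j _ => ?_
    rw [pow_one, ← sq]
    exact div_le_div_of_nonneg_left (sq_nonneg _) (h.add_pos ha j) (by linarith [h.D_le j])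
  have h3 := abs_dotProduct_le u v
  have h4 := h.coercive u
  have h5 : ‖u‖ * ‖u‖ ≤ ‖u‖ * (p * K * (a + d₂) / m * ‖v‖) := by
    rw [div_le_iff₀ had] at h2
    have h6 : (m : ℝ) * ‖u‖ ^ 2 ≤ K * ((p * (‖u‖ * ‖v‖)) * (a + d₂)) :=
      h4.trans (mul_le_mul_of_nonneg_left (h2.trans (mul_le_mul_of_nonneg_right
        ((le_abs_self _).trans h3) had.le)) h.K_pos.le)
    have h7 : ‖u‖ * (p * K * (a + d₂) / m * ‖v‖) = K * ((p * (‖u‖ * ‖v‖)) * (a + d₂)) / m := by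
      field_simp
    rw [h7, le_div_iff₀ hm]
    linarith
  rcases (norm_nonneg u).eq_or_lt with h0 | h0
  · rw [← h0]
    have := h.K_pos
    positivity
  · exact le_of_mul_le_mul_left h5 h0

end Bounds

end FayHerriot

/-! ### A global quadratic upper bound for the log-likelihood ratio -/

namespace FayHerriot

variable {p : ℕ}

/-- From log r = 2 log √r ≤ 2(√r - 1) the right side is at least (√r - 1)², and (r - 1)² = (√r -
1)²(√r + 1)² with (√r + 1)² ≤ 2(r + 1). -/
theorem sq_sub_one_div_le_sub_log {r : ℝ} (hr : 0 < r) :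
    (r - 1) ^ 2 / (2 * (r + 1)) ≤ r - 1 - Real.log r := by
  set s := √r with hs
  have hs0 : 0 < s := Real.sqrt_pos.2 hr
  have hsr : s ^ 2 = r := Real.sq_sqrt hr.le
  have h1 : Real.log r ≤ 2 * (s - 1) := by
    rw [← hsr, Real.log_pow]
    push_cast
    linarith [Real.log_le_sub_one_of_pos hs0]
  have h2 : (r - 1) ^ 2 / (2 * (r + 1)) ≤ (s - 1) ^ 2 := by
    rw [div_le_iff₀ (by positivity), ← hsr]
    have : (s ^ 2 - 1) ^ 2 = (s - 1) ^ 2 * (s + 1) ^ 2 := by ring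
    rw [this]
    refine mul_le_mul_of_nonneg_left ?_ (sq_nonneg _)
    nlinarith [sq_nonneg (s - 1)]
  nlinarith

/-- With r_j = (A + D_j)/(b + D_j), the deterministic part of twice the log-likelihood ratio is -Σ
(r_j - 1 - log r_j), a Kullback–Leibler term that is quadratic in (b - A)/(b + d₂). The other
summands bound the centred noise, the regression quadratic form at b (the one at A has a favourable
sign), and the change of the Gram determinant, which costs something only for b > A. -/
theorem Bounds.logLik_sub_le {x : ℕ → Fin p → ℝ} {D : ℕ → ℝ} {K d₁ d₂ : ℝ} {m : ℕ}
    (h : Bounds x D K d₁ d₂ m) {A b M : ℝ} (hA : 0 < A) (hb : 0 ≤ b) (z : ℕ → ℝ)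
    (hq : (b + d₂) * |∑ j ∈ Finset.range m, (z j ^ 2 - (A + D j)) / (A + D j) / (b + D j)| ≤ M)
    (hl : (b + d₂) * ‖wSum x D m 1 b z‖ ≤ M) :
    logLik x D m z b - logLik x D m z A ≤
      -(1 / (4 * ((A + d₂) / d₁ + 1)) * (m * (|b - A| / (b + d₂)) ^ 2)) +
        |b - A| / (b + d₂) * M / 2 + p ^ 2 * K * M ^ 2 / (m * d₁) / 2 +
        p / (A + d₁) * max (b - A) 0 / 2 := by
  have hd₁ := h.d₁_pos
  have hd₂ : 0 < d₂ := hd₁.trans_le h.d₁_le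
  have hm := h.m_pos
  have hbd : 0 < b + d₂ := by linarith
  have hM : 0 ≤ M := le_trans (by positivity) hl
  have hpA : ∀ j < m, 0 < A + D j := fun j _ => h.add_pos hA.le j
  have hpb : ∀ j < m, 0 < b + D j := fun j _ => h.add_pos hb j
  -- the quadratic form of the regression part
  have hQA := wSum_dotProduct_wls_nonneg h.spans hpA z
  have hQb : wSum x D m 1 b z ⬝ᵥ wls x D m b z ≤ p ^ 2 * K * M ^ 2 / (m * d₁) := by
    refine (le_abs_self _).trans ((abs_dotProduct_le _ _).trans ?_)
    have h1 := h.norm_inv_wGram_mulVec_le hb (wSum x D m 1 b z)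
    have hK := h.K_pos
    calc (p : ℝ) * (‖wSum x D m 1 b z‖ * ‖wls x D m b z‖)
        ≤ p * (‖wSum x D m 1 b z‖ * (p * K * (b + d₂) / m * ‖wSum x D m 1 b z‖)) := by
          gcongr; exact h1
      _ = p ^ 2 * K * ((b + d₂) * ‖wSum x D m 1 b z‖) ^ 2 / (m * (b + d₂)) := by
          field_simp
      _ ≤ p ^ 2 * K * M ^ 2 / (m * d₁) := by
          gcongr
          linarith [h.d₁_le]
  -- the determinant
  have hdet : Real.log (wGram x D m 1 A).det - Real.log (wGram x D m 1 b).det ≤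
      p / (A + d₁) * max (b - A) 0 := by
    have hAd : 0 < A + d₁ := by linarith
    rcases le_total b A with hbA | hAb
    · have := log_det_wGram_antitoneOn h.spans (fun j => hd₁.trans_le (h.le_D j))
        (Set.mem_Ici.2 hb) (Set.mem_Ici.2 hA.le) hbA
      rw [max_eq_right (by linarith)]
      simp only at this
      linarith
    · have := log_det_wGram_add_log_monotoneOn h.spans hd₁ h.le_D
        (Set.mem_Ici.2 hA.le) (Set.mem_Ici.2 hb) hAb
      simp only at this
      rw [max_eq_left (by linarith)]
      have h1 : Real.log (b + d₁) - Real.log (A + d₁) ≤ (b - A) / (A + d₁) := by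
        rw [← Real.log_div (by linarith) hAd.ne']
        refine (Real.log_le_sub_one_of_pos (by apply div_pos <;> linarith)).trans_eq ?_
        field_simp
        ring
      have h2 := mul_le_mul_of_nonneg_left h1 (Nat.cast_nonneg (α := ℝ) p)
      calc _ ≤ (p : ℝ) * (Real.log (b + d₁) - Real.log (A + d₁)) := by linarith
        _ ≤ _ := h2
        _ = _ := by ring
  -- the main part
  set R := (A + d₂) / d₁ with hR
  have hR0 : 0 < R := div_pos (by linarith) hd₁
  have hterm : ∀ j ∈ Finset.range m,
      1 / (2 * (R + 1)) * (|b - A| / (b + d₂)) ^ 2 ≤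
        Real.log (b + D j) - Real.log (A + D j) + z j ^ 2 / (b + D j) - z j ^ 2 / (A + D j) +
          (b - A) * ((z j ^ 2 - (A + D j)) / (A + D j) / (b + D j)) := by
    intro j hj
    have hj := Finset.mem_range.1 hj
    have ha := hpA j hj
    have hb' := hpb j hj
    have h1 := sq_sub_one_div_le_sub_log (div_pos ha hb')
    rw [Real.log_div ha.ne' hb'.ne'] at h1
    have h2 : (A + D j) / (b + D j) ≤ R := by
      rw [hR]
      apply div_le_div₀ <;> linarith [h.le_D j, h.D_le j]
    have h3 : (|b - A| / (b + d₂)) ^ 2 ≤ ((A + D j) / (b + D j) - 1) ^ 2 := by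
      have : (A + D j) / (b + D j) - 1 = (A - b) / (b + D j) := by field_simp; ring
      rw [this, div_pow, div_pow, sq_abs, ← neg_sub A b, neg_sq]
      refine div_le_div_of_nonneg_left (sq_nonneg _) (by positivity) ?_
      exact pow_le_pow_left₀ hb'.le (by linarith [h.D_le j]) 2
    have h4 : 1 / (2 * (R + 1)) * (|b - A| / (b + d₂)) ^ 2 ≤
        ((A + D j) / (b + D j) - 1) ^ 2 / (2 * ((A + D j) / (b + D j) + 1)) := by
      rw [one_div, inv_mul_eq_div]
      have h0 : 0 < (A + D j) / (b + D j) := div_pos ha hb'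
      apply div_le_div₀ (sq_nonneg _) h3 (by positivity)
      linarith
    have h5 : z j ^ 2 / (b + D j) - z j ^ 2 / (A + D j) +
        (b - A) * ((z j ^ 2 - (A + D j)) / (A + D j) / (b + D j)) =
          (A + D j) / (b + D j) - 1 := by
      field_simp
      ring
    linarith
  have hsum := Finset.sum_le_sum hterm
  rw [Finset.sum_const, Finset.card_range, nsmul_eq_mul, Finset.sum_add_distrib,
    Finset.sum_sub_distrib, Finset.sum_add_distrib, Finset.sum_sub_distrib,
    ← Finset.mul_sum] at hsum
  set S := ∑ j ∈ Finset.range m, (z j ^ 2 - (A + D j)) / (A + D j) / (b + D j)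
  have hS : (b - A) * S ≤ |b - A| / (b + d₂) * M := by
    refine (le_abs_self _).trans ?_
    rw [abs_mul, div_mul_eq_mul_div, mul_div_assoc]
    refine mul_le_mul_of_nonneg_left ?_ (abs_nonneg _)
    rw [le_div_iff₀ hbd]
    linarith
  have h6 : 1 / (4 * (R + 1)) * (m * (|b - A| / (b + d₂)) ^ 2) =
      m * (1 / (2 * (R + 1)) * (|b - A| / (b + d₂)) ^ 2) / 2 := by
    field_simp
    ring
  rw [h6, logLik, logLik]
  linarith

/-- The scale `m^(1/40)` in which all orders of magnitude are expressed. -/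
noncomputable def scale (m : ℕ) : ℝ := (m : ℝ) ^ (1 / 40 : ℝ)

theorem scale_pow (m : ℕ) : scale m ^ 40 = m := by
  rw [scale, ← Real.rpow_natCast, ← Real.rpow_mul (Nat.cast_nonneg m)]
  norm_num

theorem scale_nonneg (m : ℕ) : 0 ≤ scale m := Real.rpow_nonneg (Nat.cast_nonneg m) _

theorem tendsto_scale : Tendsto scale atTop atTop :=
  (tendsto_rpow_atTop (by norm_num)).comp tendsto_natCast_atTop_atTop

/-- Write N = `scale m`, t = |b - A|/(b + d₂) and X = N²⁰t, so that m t² = X². Since t ≥ t₀ min(1,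
|b - A|), a distance of at least N⁻¹⁸ from A gives X ≥ t₀N². Then the noise term C N X and the term
C N² are small against X². The linear term is at most C N² when |b - A| ≤ 1; otherwise X² ≥ t₀² m
beats C C' m^lam because lam < 1. -/
theorem eventually_quadratic_neg {A d₂ c C C' lam : ℝ} (hA : 0 < A) (hd₂ : 0 < d₂) (hc : 0 < c)
    (hC : 0 ≤ C) (hC' : 0 ≤ C') (hlam : lam < 1) :
    ∀ᶠ m : ℕ in atTop, ∀ b, 0 ≤ b → b ≤ C' * (m : ℝ) ^ lam → scale m ^ (-18 : ℤ) ≤ |b - A| →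
      -(c * (m * (|b - A| / (b + d₂)) ^ 2)) + |b - A| / (b + d₂) * (C * scale m ^ 21) +
        C * scale m ^ 2 + C * max (b - A) 0 < 0 := by
  set t₀ := 1 / (A + 1 + d₂) with ht₀
  have ht₀p : 0 < t₀ := by positivity
  have e1 : ∀ᶠ m : ℕ in atTop, C / (c * t₀ / 4) ≤ scale m := tendsto_scale.eventually_ge_atTop _
  have e2 : ∀ᶠ m : ℕ in atTop, 2 * C / (c * t₀ ^ 2 / 4) < scale m ^ 2 :=
    (tendsto_pow_atTop (by norm_num : (2 : ℕ) ≠ 0)).comp tendsto_scale |>.eventually_gt_atTop _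
  have e3 : ∀ᶠ m : ℕ in atTop, C * C' * (m : ℝ) ^ lam ≤ c * t₀ ^ 2 / 4 * m := by
    have h0 : (fun r : ℝ => r ^ lam) =o[atTop] fun r : ℝ => r ^ (1 : ℝ) := by
      refine (isLittleO_iff_tendsto' ?_).2 ?_
      · filter_upwards [eventually_gt_atTop 0] with r hr h
        exact absurd h (Real.rpow_pos_of_pos hr _).ne'
      · refine (tendsto_rpow_neg_atTop (y := 1 - lam) (by linarith)).congr' ?_
        filter_upwards [eventually_gt_atTop 0] with r hr
        rw [← Real.rpow_sub hr, neg_sub]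
    have h1 : (fun m : ℕ => C * C' * (m : ℝ) ^ lam) =o[atTop] fun m : ℕ => (m : ℝ) ^ (1 : ℝ) :=
      (h0.comp_tendsto tendsto_natCast_atTop_atTop).const_mul_left _
    filter_upwards [h1.bound (c := c * t₀ ^ 2 / 4) (by positivity)] with m hm
    rw [Real.rpow_one] at hm
    refine (le_abs_self _).trans (hm.trans_eq ?_)
    simp
  filter_upwards [e1, e2, e3, tendsto_scale.eventually_ge_atTop 1] with m h1 h2 h3 h4 b hb hbm hs
  set N := scale m
  have hN0 : 0 < N := by linarith
  have hN : N ^ 40 = m := scale_pow m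
  set s := |b - A|
  have hbd : 0 < b + d₂ := by linarith
  set t := s / (b + d₂) with ht
  have hs0 : 0 ≤ s := abs_nonneg _
  have htμ : t₀ * min 1 s ≤ t := by
    rw [ht, ht₀, div_mul_eq_mul_div, one_mul, div_le_div_iff₀ (by positivity) hbd]
    have hbs : b ≤ A + s := by linarith [le_abs_self (b - A)]
    have hμ1 : min 1 s ≤ 1 := min_le_left _ _
    have hμs : min 1 s ≤ s := min_le_right _ _
    have hμ0 : 0 ≤ min 1 s := le_min zero_le_one hs0
    nlinarith
  set X := N ^ 20 * t with hX
  have hXsq : m * t ^ 2 = X ^ 2 := by rw [hX, ← hN]; ring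
  have hN18 : N ^ (-18 : ℤ) ≤ 1 := by
    rw [_root_.zpow_neg]
    exact inv_le_one_of_one_le₀ (by exact_mod_cast one_le_pow₀ h4)
  have hX2 : t₀ * N ^ 2 ≤ X := by
    have : t₀ * N ^ (-18 : ℤ) ≤ t :=
      (mul_le_mul_of_nonneg_left (le_min hN18 hs) ht₀p.le).trans htμ
    calc t₀ * N ^ 2 = N ^ 20 * (t₀ * N ^ (-18 : ℤ)) := by
          rw [_root_.zpow_neg]
          have : (N ^ (18 : ℤ)) = N ^ 18 := by norm_cast
          rw [this]
          field_simp
      _ ≤ X := mul_le_mul_of_nonneg_left this (by positivity)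
  have hX0 : 0 < X := lt_of_lt_of_le (by positivity) hX2
  rw [div_le_iff₀ (by positivity)] at h1
  rw [div_lt_iff₀ (by positivity)] at h2
  -- the three error terms
  have b1 : t * (C * N ^ 21) ≤ c / 4 * X ^ 2 := by
    have : t * (C * N ^ 21) = C * N * X := by rw [hX]; ring
    have h5 : C * N ≤ c / 4 * X := by nlinarith
    calc t * (C * N ^ 21) = C * N * X := this
      _ ≤ c / 4 * X * X := mul_le_mul_of_nonneg_right h5 hX0.le
      _ = c / 4 * X ^ 2 := by ring
  have b2 : 2 * C * N ^ 2 < c / 4 * X ^ 2 := by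
    have h5 : (t₀ * N ^ 2) ^ 2 ≤ X ^ 2 := pow_le_pow_left₀ (by positivity) hX2 2
    have h6 : 2 * C * N ^ 2 < N ^ 2 * (c * t₀ ^ 2 / 4) * N ^ 2 :=
      mul_lt_mul_of_pos_right h2 (by positivity)
    nlinarith
  have b3 : C * max (b - A) 0 ≤ C * N ^ 2 + c / 4 * X ^ 2 := by
    rcases le_or_gt s 1 with hs1 | hs1
    · have : max (b - A) 0 ≤ N ^ 2 :=
        max_le ((le_abs_self _).trans (hs1.trans (one_le_pow₀ h4))) (by positivity)
      have := mul_le_mul_of_nonneg_left this hC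
      nlinarith
    · have h5 : max (b - A) 0 ≤ C' * (m : ℝ) ^ lam := max_le (by linarith) (by positivity)
      have h6 := mul_le_mul_of_nonneg_left h5 hC
      rw [min_eq_left hs1.le, mul_one] at htμ
      have h7 : t₀ ^ 2 * m ≤ X ^ 2 := by
        rw [← hXsq, mul_comm]
        exact mul_le_mul_of_nonneg_left (pow_le_pow_left₀ ht₀p.le htμ 2) (Nat.cast_nonneg _)
      have h8 : 0 ≤ C * N ^ 2 := by positivity
      nlinarith
  rw [hXsq]
  nlinarith [mul_pos hc (pow_pos hX0 2)]

end FayHerriot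

/-! ### Calculus of orders of magnitude, and typical paths -/

namespace FayHerriot

variable {p : ℕ} {α : Type*} {E : Type*} [SeminormedAddCommGroup E]

/-- `f` is of order at most `m^(k/40)` along the filter `l`. -/
def Ord (l : Filter α) (m : α → ℕ) (k : ℤ) (f : α → E) : Prop :=
  f =O[l] fun q => scale (m q) ^ k

section Ord

variable {l : Filter α} {m : α → ℕ} {k k' : ℤ}

theorem eventually_one_le_scale (hm : Tendsto m l atTop) : ∀ᶠ q in l, 1 ≤ scale (m q) :=
  (tendsto_scale.comp hm).eventually_ge_atTop 1

theorem Ord.mono {f : α → E} (hm : Tendsto m l atTop) (hf : Ord l m k f) (h : k ≤ k') :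
    Ord l m k' f := by
  refine IsBigO.trans hf (IsBigO.of_bound 1 ?_)
  filter_upwards [eventually_one_le_scale hm] with q hq
  rw [one_mul, norm_zpow, norm_zpow, Real.norm_of_nonneg (scale_nonneg _)]
  exact zpow_le_zpow_right₀ hq h

theorem Ord.of_le {f : α → E} {g : α → ℝ} (hg : Ord l m k g) {C : ℝ}
    (h : ∀ᶠ q in l, ‖f q‖ ≤ C * g q) : Ord l m k f := by
  refine IsBigO.trans (IsBigO.of_bound |C| ?_) hg
  filter_upwards [h] with q hq
  rw [Real.norm_eq_abs, ← abs_mul]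
  exact hq.trans (le_abs_self _)

theorem Ord.of_bound {f : α → E} {C : ℝ} (h : ∀ᶠ q in l, ‖f q‖ ≤ C * scale (m q) ^ k) :
    Ord l m k f := by
  refine IsBigO.of_bound C ?_
  filter_upwards [h] with q hq
  rwa [Real.norm_of_nonneg (zpow_nonneg (scale_nonneg _) _)]

theorem Ord.const (c : E) : Ord l m 0 fun _ => c := by
  refine Ord.of_bound (C := ‖c‖) (Eventually.of_forall fun q => ?_)
  simp

theorem Ord.add {f g : α → E} (hf : Ord l m k f) (hg : Ord l m k g) :
    Ord l m k fun q => f q + g q :=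
  IsBigO.add hf hg

theorem Ord.sub {f g : α → E} (hf : Ord l m k f) (hg : Ord l m k g) :
    Ord l m k fun q => f q - g q :=
  IsBigO.sub hf hg

theorem Ord.neg {f : α → E} (hf : Ord l m k f) : Ord l m k fun q => -f q :=
  IsBigO.neg_left hf

theorem Ord.norm {f : α → E} (hf : Ord l m k f) : Ord l m k fun q => ‖f q‖ :=
  IsBigO.norm_left hf

theorem Ord.mul {f g : α → ℝ} (hm : Tendsto m l atTop) (hf : Ord l m k f) (hg : Ord l m k' g) :
    Ord l m (k + k') fun q => f q * g q := by
  refine (IsBigO.mul hf hg).trans_eventuallyEq ?_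
  filter_upwards [eventually_one_le_scale hm] with q hq
  rw [zpow_add₀ (by linarith)]

theorem Ord.const_mul {f : α → ℝ} (c : ℝ) (hf : Ord l m k f) : Ord l m k fun q => c * f q :=
  IsBigO.const_mul_left hf c

theorem Ord.pow {f : α → ℝ} (hf : Ord l m k f) (n : ℕ) :
    Ord l m (k * n) fun q => f q ^ n := by
  refine (IsBigO.pow hf n).trans_eventuallyEq (Eventually.of_forall fun q => ?_)
  simp only
  rw [_root_.zpow_mul, zpow_natCast]

theorem Ord.congr {f g : α → E} (hf : Ord l m k f) (h : ∀ᶠ q in l, f q = g q) : Ord l m k g :=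
  IsBigO.congr' hf h EventuallyEq.rfl

theorem Ord.dotProduct {v w : α → Fin p → ℝ} (hm : Tendsto m l atTop) (hv : Ord l m k v)
    (hw : Ord l m k' w) : Ord l m (k + k') fun q => v q ⬝ᵥ w q :=
  (hv.norm.mul hm hw.norm).of_le (C := p) (Eventually.of_forall fun q => by
    simpa using abs_dotProduct_le (v q) (w q))

theorem ord_natCast (l : Filter α) (m : α → ℕ) : Ord l m 40 fun q => (m q : ℝ) := by
  refine Ord.of_bound (C := 1) (Eventually.of_forall fun q => ?_)
  have : scale (m q) ^ (40 : ℤ) = m q := by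
    rw [← scale_pow (m q)]
    norm_cast
  rw [this, one_mul, Real.norm_of_nonneg (Nat.cast_nonneg _)]

theorem zpow_neg_forty (m : ℕ) : scale m ^ (-40 : ℤ) = (m : ℝ)⁻¹ := by
  rw [_root_.zpow_neg, ← scale_pow m]
  norm_cast

theorem Ord.isLittleO {f : α → ℝ} (hm : Tendsto m l atTop) (hf : Ord l m k f) (h : k < k') :
    f =o[l] fun q => scale (m q) ^ k' := by
  refine IsBigO.trans_isLittleO hf ?_
  have h1 : Tendsto (fun r : ℝ => r ^ (k - k')) atTop (𝓝 0) :=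
    tendsto_zpow_atTop_zero (by omega)
  refine (isLittleO_iff_tendsto' ?_).2 ((h1.comp (tendsto_scale.comp hm)).congr' ?_)
  · filter_upwards [eventually_one_le_scale hm] with q hq h0
    exact absurd h0 (zpow_pos (by linarith) _).ne'
  · filter_upwards [eventually_one_le_scale hm] with q hq
    have : scale (m q) ≠ 0 := by linarith
    simp only [Function.comp]
    rw [zpow_sub₀ this]

end Ord

/-- Centred quadratic sums `∑ (z_j² - v_j) / v_j^k`, `v_j = A + D_j`. -/
noncomputable def chiSum (D : ℕ → ℝ) (m : ℕ) (A : ℝ) (k : ℕ) (z : ℕ → ℝ) : ℝ :=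
  ∑ j ∈ Finset.range m, (z j ^ 2 - (A + D j)) / (A + D j) ^ k

/-- The sums `∑ 1 / v_j^k`. -/
noncomputable def invSum (D : ℕ → ℝ) (m : ℕ) (A : ℝ) (k : ℕ) : ℝ :=
  ∑ j ∈ Finset.range m, 1 / (A + D j) ^ k

/-- Paths `z` on which all relevant statistics are of their typical order of magnitude. -/
structure GoodPath (x : ℕ → Fin p → ℝ) (D : ℕ → ℝ) (A d₂ C : ℝ) (i m : ℕ) (z : ℕ → ℝ) :
    Prop where
  quad_unif : ∀ b, 0 ≤ b →
    (b + d₂) * |∑ j ∈ Finset.range m, (z j ^ 2 - (A + D j)) / (A + D j) / (b + D j)| ≤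
      C * scale m ^ 21
  lin_unif : ∀ b, 0 ≤ b → (b + d₂) * ‖wSum x D m 1 b z‖ ≤ C * scale m ^ 21
  chi : ∀ k ≤ 4, |chiSum D m A k z| ≤ scale m ^ 21
  lin : ∀ k ≤ 3, ‖wSum x D m k A z‖ ≤ scale m ^ 21
  coord : |z i| ≤ scale m

/-- A family of good paths `z` with values `a` close to `A`. -/
structure NearTruth (l : Filter α) (x : ℕ → Fin p → ℝ) (D : ℕ → ℝ) (A K d₁ d₂ C : ℝ) (i : ℕ)
    (m : α → ℕ) (z : α → ℕ → ℝ) (a : α → ℝ) : Prop where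
  A_pos : 0 < A
  tendsto : Tendsto m l atTop
  bounds : ∀ᶠ q in l, Bounds x D K d₁ d₂ (m q)
  good : ∀ᶠ q in l, GoodPath x D A d₂ C i (m q) (z q)
  near : ∀ᶠ q in l, |a q - A| ≤ scale (m q) ^ (-18 : ℤ)
  nonneg : ∀ᶠ q in l, 0 ≤ a q

namespace NearTruth

variable {l : Filter α} {x : ℕ → Fin p → ℝ} {D : ℕ → ℝ} {A K d₁ d₂ C : ℝ} {i : ℕ}
  {m : α → ℕ} {z : α → ℕ → ℝ} {a : α → ℝ}

theorem ord_diff (h : NearTruth l x D A K d₁ d₂ C i m z a) : Ord l m (-18) fun q => a q - A :=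
  Ord.of_bound (C := 1) (by filter_upwards [h.near] with q hq; simpa using hq)

theorem ord_chi (h : NearTruth l x D A K d₁ d₂ C i m z a) {k : ℕ} (hk : k ≤ 4) :
    Ord l m 21 fun q => chiSum D (m q) A k (z q) :=
  Ord.of_bound (C := 1) (by
    filter_upwards [h.good] with q hq
    rw [one_mul]
    exact_mod_cast hq.chi k hk)

theorem ord_lin (h : NearTruth l x D A K d₁ d₂ C i m z a) {k : ℕ} (hk : k ≤ 3) :
    Ord l m 21 fun q => wSum x D (m q) k A (z q) :=
  Ord.of_bound (C := 1) (by
    filter_upwards [h.good] with q hq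
    rw [one_mul]
    exact_mod_cast hq.lin k hk)

theorem ord_coord (h : NearTruth l x D A K d₁ d₂ C i m z a) : Ord l m 1 fun q => z q i :=
  Ord.of_bound (C := 1) (by
    filter_upwards [h.good] with q hq
    simpa using hq.coord)

theorem ord_sum_of_le (h : NearTruth l x D A K d₁ d₂ C i m z a) {f : α → ℕ → E} {B : ℝ}
    (hf : ∀ᶠ q in l, ∀ j < m q, ‖f q j‖ ≤ B) :
    Ord l m 40 fun q => ∑ j ∈ Finset.range (m q), f q j := by
  have _ := h.A_pos
  refine (ord_natCast l m).of_le (C := B) ?_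
  filter_upwards [hf] with q hq
  refine (norm_sum_le _ _).trans ((Finset.sum_le_card_nsmul _ _ B fun j hj =>
    hq j (Finset.mem_range.1 hj)).trans_eq ?_)
  rw [Finset.card_range, nsmul_eq_mul, mul_comm]

theorem ord_invSum (h : NearTruth l x D A K d₁ d₂ C i m z a) (k : ℕ) :
    Ord l m 40 fun q => invSum D (m q) A k := by
  refine h.ord_sum_of_le (B := 1 / A ^ k) ?_
  filter_upwards [h.bounds] with q hq j _
  have h1 : A ≤ A + D j := by linarith [hq.le_D j, hq.d₁_pos]
  have := h.A_pos
  rw [Real.norm_of_nonneg (by have := hq.add_pos this.le j; positivity)]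
  gcongr

theorem ord_inv_invSum (h : NearTruth l x D A K d₁ d₂ C i m z a) (k : ℕ) :
    Ord l m (-40) fun q => (invSum D (m q) A k)⁻¹ := by
  refine Ord.of_bound (C := (A + d₂) ^ k) ?_
  filter_upwards [h.bounds] with q hq
  have hA := h.A_pos
  have hd₂ : 0 < d₂ := hq.d₁_pos.trans_le hq.d₁_le
  have hm := hq.m_pos
  have h1 : m q * (1 / (A + d₂) ^ k) ≤ invSum D (m q) A k := by
    rw [← nsmul_eq_mul]
    nth_rw 1 [← Finset.card_range (m q)]
    refine Finset.card_nsmul_le_sum _ _ _ fun j _ => ?_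
    have := hq.add_pos hA.le j
    have := hq.D_le j
    gcongr
  rw [zpow_neg_forty, norm_inv, Real.norm_of_nonneg (le_trans (by positivity) h1)]
  calc (invSum D (m q) A k)⁻¹ ≤ (m q * (1 / (A + d₂) ^ k))⁻¹ := by gcongr
    _ = _ := by field_simp

/-- Σ z_j² differs from Σ v_j = O(m) by the centred sum with exponent 0, which is of order 21. All
Taylor remainders below are sums dominated by this one. -/
theorem ord_sum_one_add_sq (h : NearTruth l x D A K d₁ d₂ C i m z a) :
    Ord l m 40 fun q => ∑ j ∈ Finset.range (m q), (1 + z q j ^ 2) := by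
  have h1 : Ord l m 40 fun q => ∑ j ∈ Finset.range (m q), (1 + (A + D j)) := by
    refine h.ord_sum_of_le (B := 1 + (A + d₂)) ?_
    filter_upwards [h.bounds] with q hq j _
    rw [Real.norm_of_nonneg (by linarith [hq.add_pos h.A_pos.le j])]
    linarith [hq.D_le j]
  refine (((h.ord_chi (Nat.zero_le 4)).mono h.tendsto (by norm_num)).add h1).congr
    (Eventually.of_forall fun q => ?_)
  simp only [chiSum, pow_zero, div_one]
  rw [← Finset.sum_add_distrib]
  refine Finset.sum_congr rfl fun j _ => ?_
  ring

theorem ord_sum_of_le_sq (h : NearTruth l x D A K d₁ d₂ C i m z a) {f : α → ℕ → E} {B : ℝ}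
    (hf : ∀ᶠ q in l, ∀ j < m q, ‖f q j‖ ≤ B * (1 + z q j ^ 2)) :
    Ord l m 40 fun q => ∑ j ∈ Finset.range (m q), f q j := by
  refine h.ord_sum_one_add_sq.of_le (C := B) ?_
  filter_upwards [hf] with q hq
  refine (norm_sum_le _ _).trans ?_
  rw [Finset.mul_sum]
  exact Finset.sum_le_sum fun j hj => hq j (Finset.mem_range.1 hj)

end NearTruth

end FayHerriot

/-! ### Perturbation of the regression quantities near the true variance -/

namespace FayHerriot

variable {p : ℕ}

theorem wSum_eq_sum_smul (x : ℕ → Fin p → ℝ) (D : ℕ → ℝ) (m n : ℕ) (a : ℝ) (z : ℕ → ℝ) :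
    wSum x D m n a z = ∑ j ∈ Finset.range m, (z j * (a + D j)⁻¹ ^ n) • x j := by
  ext k
  simp only [wSum, Finset.sum_apply, Pi.smul_apply, smul_eq_mul]
  refine Finset.sum_congr rfl fun j _ => ?_
  rw [inv_pow]
  ring

theorem wGram_mulVec_eq_sum_smul (x : ℕ → Fin p → ℝ) (D : ℕ → ℝ) (m n : ℕ) (a : ℝ)
    (v : Fin p → ℝ) :
    wGram x D m n a *ᵥ v = ∑ j ∈ Finset.range m, (x j ⬝ᵥ v * (a + D j)⁻¹ ^ n) • x j := by
  ext k
  simp only [wGram, mulVec, dotProduct, Matrix.of_apply, Finset.sum_apply, Pi.smul_apply,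
    smul_eq_mul, Finset.sum_mul]
  rw [Finset.sum_comm]
  refine Finset.sum_congr rfl fun j _ => Finset.sum_congr rfl fun l _ => ?_
  rw [inv_pow]
  ring

namespace Bounds

variable {x : ℕ → Fin p → ℝ} {D : ℕ → ℝ} {K d₁ d₂ : ℝ} {m : ℕ}

theorem inv_pos (h : Bounds x D K d₁ d₂ m) {b : ℝ} (hb : 0 ≤ b) (j : ℕ) : 0 < (b + D j)⁻¹ :=
  _root_.inv_pos.2 (h.add_pos hb j)

theorem inv_le (h : Bounds x D K d₁ d₂ m) {b : ℝ} (hb : 0 ≤ b) (j : ℕ) :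
    (b + D j)⁻¹ ≤ d₁⁻¹ := by
  have := h.d₁_pos
  gcongr
  linarith [h.le_D j]

/-- Iterating this identity yields every Taylor expansion in b - a used below, with an exact
remainder. -/
theorem inv_sub_inv (h : Bounds x D K d₁ d₂ m) {a b : ℝ} (ha : 0 ≤ a) (hb : 0 ≤ b) (j : ℕ) :
    (b + D j)⁻¹ = (a + D j)⁻¹ - (b - a) * ((b + D j)⁻¹ * (a + D j)⁻¹) := by
  have := (h.add_pos ha j).ne'
  have := (h.add_pos hb j).ne'
  field_simp
  ring

theorem abs_dotProduct_le (h : Bounds x D K d₁ d₂ m) (j : ℕ) (v : Fin p → ℝ) :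
    |x j ⬝ᵥ v| ≤ p * K * ‖v‖ := by
  refine (FayHerriot.abs_dotProduct_le _ _).trans ?_
  rw [mul_assoc]
  have := h.norm_le j
  gcongr

theorem abs_inv_pow_sub_le (h : Bounds x D K d₁ d₂ m) {a b : ℝ} (ha : 0 ≤ a) (hb : 0 ≤ b) (j : ℕ)
    {n : ℕ} (hn : n = 1 ∨ n = 2) :
    |(b + D j)⁻¹ ^ n - (a + D j)⁻¹ ^ n| ≤ 2 * d₁⁻¹ ^ (n + 1) * |b - a| := by
  have h1 := h.inv_sub_inv ha hb j
  have hu := h.inv_pos hb j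
  have hw := h.inv_pos ha j
  have hu' := h.inv_le hb j
  have hw' := h.inv_le ha j
  have hd := h.d₁_pos
  generalize (b + D j)⁻¹ = u at *
  generalize (a + D j)⁻¹ = w at *
  have hd' : 0 < d₁⁻¹ := _root_.inv_pos.2 hd
  generalize d₁⁻¹ = U at *
  have huw : u * w ≤ U * U := mul_le_mul hu' hw' hw.le hd'.le
  have huw0 : 0 < u * w := mul_pos hu hw
  rcases hn with rfl | rfl
  · have : u ^ 1 - w ^ 1 = -((u * w) * (b - a)) := by rw [pow_one, pow_one]; linarith
    rw [this, abs_neg, abs_mul, abs_of_pos huw0]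
    refine mul_le_mul_of_nonneg_right (huw.trans ?_) (abs_nonneg _)
    linarith [pow_pos hd' (1 + 1), (by ring : U ^ (1 + 1) = U * U)]
  · have : u ^ 2 - w ^ 2 = -((u * w) * (u + w) * (b - a)) := by
      have : u - w = -((b - a) * (u * w)) := by linarith
      calc u ^ 2 - w ^ 2 = (u - w) * (u + w) := by ring
        _ = _ := by rw [this]; ring
    rw [this, abs_neg, abs_mul, abs_of_pos (mul_pos huw0 (by linarith))]
    refine mul_le_mul_of_nonneg_right ?_ (abs_nonneg _)
    calc u * w * (u + w) ≤ U * U * (U + U) := by gcongr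
      _ = _ := by ring

theorem norm_wGram_sub_mulVec_le (h : Bounds x D K d₁ d₂ m) {a b : ℝ} (ha : 0 ≤ a) (hb : 0 ≤ b)
    {n : ℕ} (hn : n = 1 ∨ n = 2) (v : Fin p → ℝ) :
    ‖wGram x D m n b *ᵥ v - wGram x D m n a *ᵥ v‖ ≤
      2 * p * K ^ 2 * d₁⁻¹ ^ (n + 1) * (m * |b - a| * ‖v‖) := by
  rw [wGram_mulVec_eq_sum_smul, wGram_mulVec_eq_sum_smul, ← Finset.sum_sub_distrib]
  refine (norm_sum_le _ _).trans ((Finset.sum_le_card_nsmul _ _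
    (2 * p * K ^ 2 * d₁⁻¹ ^ (n + 1) * (|b - a| * ‖v‖)) fun j _ => ?_).trans_eq ?_)
  · rw [← sub_smul, ← mul_sub, norm_smul, norm_mul, Real.norm_eq_abs, Real.norm_eq_abs]
    have h1 := h.abs_dotProduct_le j v
    have h2 := h.abs_inv_pow_sub_le ha hb j hn
    have h3 := h.norm_le j
    have hK := h.K_pos
    have hd := h.d₁_pos
    calc |x j ⬝ᵥ v| * |(b + D j)⁻¹ ^ n - (a + D j)⁻¹ ^ n| * ‖x j‖
        ≤ (p * K * ‖v‖) * (2 * d₁⁻¹ ^ (n + 1) * |b - a|) * K := by gcongr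
      _ = _ := by ring
  · rw [Finset.card_range, nsmul_eq_mul]
    ring

theorem norm_wGram_mulVec_le (h : Bounds x D K d₁ d₂ m) {b : ℝ} (hb : 0 ≤ b)
    (n : ℕ) (v : Fin p → ℝ) :
    ‖wGram x D m n b *ᵥ v‖ ≤ p * K ^ 2 * d₁⁻¹ ^ n * (m * ‖v‖) := by
  rw [wGram_mulVec_eq_sum_smul]
  refine (norm_sum_le _ _).trans ((Finset.sum_le_card_nsmul _ _
    (p * K ^ 2 * d₁⁻¹ ^ n * ‖v‖) fun j _ => ?_).trans_eq ?_)
  · have hu := h.inv_pos hb j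
    rw [norm_smul, norm_mul, Real.norm_eq_abs, Real.norm_of_nonneg (by positivity)]
    have h1 := h.abs_dotProduct_le j v
    have h2 := h.inv_le hb j
    have h3 := h.norm_le j
    have hK := h.K_pos
    have hd := h.d₁_pos
    calc |x j ⬝ᵥ v| * (b + D j)⁻¹ ^ n * ‖x j‖
        ≤ (p * K * ‖v‖) * d₁⁻¹ ^ n * K := by gcongr
      _ = _ := by ring
  · rw [Finset.card_range, nsmul_eq_mul]
    ring

/-- Resolvent identity: G_b⁻¹v - G_a⁻¹v = -G_b⁻¹(G_b - G_a)G_a⁻¹v, with each inverse of order 1/m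
and the difference of order m|b - a|. -/
theorem norm_inv_sub_le (h : Bounds x D K d₁ d₂ m) {a b B : ℝ} (ha : 0 ≤ a) (hb : 0 ≤ b)
    (haB : a ≤ B) (hbB : b ≤ B) (v : Fin p → ℝ) :
    ‖(wGram x D m 1 b)⁻¹ *ᵥ v - (wGram x D m 1 a)⁻¹ *ᵥ v‖ ≤
      (p * K * (B + d₂)) ^ 2 * (2 * p * K ^ 2 * d₁⁻¹ ^ 2) * (|b - a| / m * ‖v‖) := by
  have hpa : ∀ j < m, 0 < a + D j := fun j _ => h.add_pos ha j
  have hpb : ∀ j < m, 0 < b + D j := fun j _ => h.add_pos hb j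
  have hm := h.m_pos
  have hK := h.K_pos
  have hd₁ := h.d₁_pos
  have hd₂ := hd₁.trans_le h.d₁_le
  set u := (wGram x D m 1 a)⁻¹ *ᵥ v with hu
  have h0 : wGram x D m 1 a *ᵥ u = v := by
    rw [hu, Matrix.mulVec_mulVec, Matrix.mul_nonsing_inv _ (isUnit_det_wGram h.spans 1 hpa),
      Matrix.one_mulVec]
  have h1 : (wGram x D m 1 b)⁻¹ *ᵥ v - u =
      -((wGram x D m 1 b)⁻¹ *ᵥ (wGram x D m 1 b *ᵥ u - wGram x D m 1 a *ᵥ u)) := by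
    rw [h0, Matrix.mulVec_sub, Matrix.mulVec_mulVec,
      Matrix.nonsing_inv_mul _ (isUnit_det_wGram h.spans 1 hpb), Matrix.one_mulVec, neg_sub]
  rw [h1, norm_neg]
  have h2 := h.norm_inv_wGram_mulVec_le hb (wGram x D m 1 b *ᵥ u - wGram x D m 1 a *ᵥ u)
  have h3 : ‖wGram x D m 1 b *ᵥ u - wGram x D m 1 a *ᵥ u‖ ≤
      2 * p * K ^ 2 * d₁⁻¹ ^ 2 * (m * |b - a| * ‖u‖) :=
    h.norm_wGram_sub_mulVec_le ha hb (Or.inl rfl) u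
  have hB : 0 < B + d₂ := by linarith
  have h4 := h.norm_inv_wGram_mulVec_le ha v
  rw [← hu] at h4
  calc _ ≤ p * K * (b + d₂) / m * ‖wGram x D m 1 b *ᵥ u - wGram x D m 1 a *ᵥ u‖ := h2
    _ ≤ p * K * (B + d₂) / m * (2 * p * K ^ 2 * d₁⁻¹ ^ 2 * (m * |b - a| *
        (p * K * (B + d₂) / m * ‖v‖))) := by
      gcongr
      refine h3.trans ?_
      gcongr
      refine h4.trans ?_
      gcongr
    _ = _ := by
      field_simp

end Bounds

variable {α : Type*} {E : Type*} [SeminormedAddCommGroup E]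

namespace NearTruth

variable {l : Filter α} {x : ℕ → Fin p → ℝ} {D : ℕ → ℝ} {A K d₁ d₂ C : ℝ} {i : ℕ}
  {m : α → ℕ} {z : α → ℕ → ℝ} {a : α → ℝ}

theorem self (h : NearTruth l x D A K d₁ d₂ C i m z a) :
    NearTruth l x D A K d₁ d₂ C i m z fun _ => A :=
  ⟨h.A_pos, h.tendsto, h.bounds, h.good, Eventually.of_forall fun q => by
    simpa using pow_nonneg (scale_nonneg (m q)) 18, Eventually.of_forall fun _ => h.A_pos.le⟩

theorem le_add_one (h : NearTruth l x D A K d₁ d₂ C i m z a) : ∀ᶠ q in l, a q ≤ A + 1 := by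
  filter_upwards [h.near, eventually_one_le_scale h.tendsto] with q hq hN
  have : scale (m q) ^ (-18 : ℤ) ≤ 1 := zpow_le_one_of_nonpos₀ hN (by norm_num)
  linarith [le_abs_self (a q - A)]

theorem ord_inv_mulVec (h : NearTruth l x D A K d₁ d₂ C i m z a) {v : α → Fin p → ℝ} {k : ℤ}
    (hv : Ord l m k v) : Ord l m (k - 40) fun q => (wGram x D (m q) 1 (a q))⁻¹ *ᵥ v q := by
  have h1 : Ord l m (-40) fun q => ((m q : ℝ))⁻¹ :=
    Ord.of_bound (C := 1) (Eventually.of_forall fun q => by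
      rw [zpow_neg_forty, one_mul, norm_inv, Real.norm_of_nonneg (Nat.cast_nonneg _)])
  have h2 := h1.mul h.tendsto hv.norm
  rw [show (-40 + k : ℤ) = k - 40 by ring] at h2
  refine h2.of_le (C := p * K * (A + 1 + d₂)) ?_
  filter_upwards [h.bounds, h.le_add_one, h.nonneg] with q hb ha ha0
  refine (hb.norm_inv_wGram_mulVec_le ha0 _).trans ?_
  have hK := hb.K_pos
  have : p * K * (a q + d₂) / m q ≤ p * K * (A + 1 + d₂) / m q := by gcongr
  refine (mul_le_mul_of_nonneg_right this (norm_nonneg _)).trans_eq ?_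
  ring

theorem ord_wGram_mulVec (h : NearTruth l x D A K d₁ d₂ C i m z a) (n : ℕ) {v : α → Fin p → ℝ}
    {k : ℤ} (hv : Ord l m k v) : Ord l m (40 + k) fun q => wGram x D (m q) n (a q) *ᵥ v q := by
  refine ((ord_natCast l m).mul h.tendsto hv.norm).of_le (C := p * K ^ 2 * d₁⁻¹ ^ n) ?_
  filter_upwards [h.bounds, h.nonneg] with q hb ha0 using hb.norm_wGram_mulVec_le ha0 n _

theorem ord_wGram_sub_mulVec (h : NearTruth l x D A K d₁ d₂ C i m z a) {n : ℕ}
    (hn : n = 1 ∨ n = 2) {v : α → Fin p → ℝ} {k : ℤ} (hv : Ord l m k v) :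
    Ord l m (22 + k) fun q => wGram x D (m q) n (a q) *ᵥ v q - wGram x D (m q) n A *ᵥ v q := by
  refine (((ord_natCast l m).mul h.tendsto h.ord_diff.norm).mul h.tendsto hv.norm).of_le
    (C := 2 * p * K ^ 2 * d₁⁻¹ ^ (n + 1)) ?_
  filter_upwards [h.bounds, h.nonneg] with q hb ha0
    using hb.norm_wGram_sub_mulVec_le h.A_pos.le ha0 hn _

theorem ord_inv_sub_mulVec (h : NearTruth l x D A K d₁ d₂ C i m z a) {v : α → Fin p → ℝ} {k : ℤ}
    (hv : Ord l m k v) : Ord l m (k - 58) fun q =>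
      (wGram x D (m q) 1 (a q))⁻¹ *ᵥ v q - (wGram x D (m q) 1 A)⁻¹ *ᵥ v q := by
  have h1 : Ord l m (-40) fun q => ((m q : ℝ))⁻¹ :=
    Ord.of_bound (C := 1) (Eventually.of_forall fun q => by
      rw [zpow_neg_forty, one_mul, norm_inv, Real.norm_of_nonneg (Nat.cast_nonneg _)])
  have h2 := (h.ord_diff.norm.mul h.tendsto h1).mul h.tendsto hv.norm
  rw [show (-18 + -40 + k : ℤ) = k - 58 by ring] at h2
  refine h2.of_le (C := (p * K * (A + 1 + d₂)) ^ 2 * (2 * p * K ^ 2 * d₁⁻¹ ^ 2)) ?_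
  filter_upwards [h.bounds, h.le_add_one, h.nonneg] with q hb ha ha0
  exact hb.norm_inv_sub_le h.A_pos.le ha0 (by linarith) ha _

theorem ord_wls (h : NearTruth l x D A K d₁ d₂ C i m z a) :
    Ord l m (-19) fun q => wls x D (m q) A (z q) :=
  (h.self.ord_inv_mulVec (h.ord_lin (k := 1) (by norm_num))).mono h.tendsto (by norm_num)

/-- A Lipschitz bound would only give order 40 - 18 = 22. One more Taylor step is needed: its linear
term carries a noise sum, of order 21 - 18 = 3, and its remainder has order 40 - 2·18 = 4. -/
theorem ord_wSum_sub (h : NearTruth l x D A K d₁ d₂ C i m z a) {n : ℕ} (hn : n = 1 ∨ n = 2) :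
    Ord l m 4 fun q => wSum x D (m q) n (a q) (z q) - wSum x D (m q) n A (z q) := by
  have h1 : Ord l m 40 fun q => ∑ j ∈ Finset.range (m q),
      (if n = 1 then z q j * ((a q + D j)⁻¹ * (A + D j)⁻¹ ^ 2) else
        z q j * ((a q + D j)⁻¹ * (A + D j)⁻¹ ^ 2 * ((a q + D j)⁻¹ + 2 * (A + D j)⁻¹))) • x j := by
    refine h.ord_sum_of_le_sq (B := (d₁⁻¹ ^ 3 + 3 * d₁⁻¹ ^ 4) * K) ?_
    filter_upwards [h.bounds, h.nonneg] with q hb ha0 j _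
    have hu := hb.inv_pos ha0 j
    have hw := hb.inv_pos h.A_pos.le j
    have hu' := hb.inv_le ha0 j
    have hw' := hb.inv_le h.A_pos.le j
    have hd : 0 < d₁⁻¹ := _root_.inv_pos.2 hb.d₁_pos
    have hx := hb.norm_le j
    generalize (a q + D j)⁻¹ = u at *
    generalize (A + D j)⁻¹ = w at *
    generalize d₁⁻¹ = U at *
    have hz : |z q j| ≤ 1 + z q j ^ 2 := by
      nlinarith [sq_nonneg (|z q j| - 1), sq_abs (z q j), abs_nonneg (z q j)]
    rw [norm_smul]
    have h2 : ‖(if n = 1 then z q j * (u * w ^ 2) else z q j * (u * w ^ 2 * (u + 2 * w)))‖ ≤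
        (1 + z q j ^ 2) * (U ^ 3 + 3 * U ^ 4) := by
      have e1 : u * w ^ 2 ≤ U * U ^ 2 := by gcongr
      split_ifs
      · rw [norm_mul, Real.norm_eq_abs, Real.norm_of_nonneg (by positivity)]
        gcongr
        nlinarith [pow_pos hd 4]
      · rw [norm_mul, Real.norm_eq_abs, Real.norm_of_nonneg (by positivity)]
        gcongr
        calc u * w ^ 2 * (u + 2 * w) ≤ U * U ^ 2 * (U + 2 * U) := by gcongr
          _ ≤ _ := by nlinarith [pow_pos hd 3]
    calc _ ≤ (1 + z q j ^ 2) * (U ^ 3 + 3 * U ^ 4) * K := by gcongr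
      _ = _ := by ring
  have h3 : Ord l m 4 fun q => ((a q - A) ^ 2) • ∑ j ∈ Finset.range (m q),
      (if n = 1 then z q j * ((a q + D j)⁻¹ * (A + D j)⁻¹ ^ 2) else
        z q j * ((a q + D j)⁻¹ * (A + D j)⁻¹ ^ 2 * ((a q + D j)⁻¹ + 2 * (A + D j)⁻¹))) • x j :=
    ((h.ord_diff.pow 2).mul h.tendsto h1.norm).of_le (C := 1)
      (Eventually.of_forall fun q => by
        rw [norm_smul, one_mul, Real.norm_of_nonneg (by positivity)])
  have h4 : Ord l m 4 fun q => -((n : ℝ) * (a q - A)) • wSum x D (m q) (n + 1) A (z q) :=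
    ((h.ord_diff.norm.mul h.tendsto (h.ord_lin (k := n + 1) (by omega)).norm).mono h.tendsto
      (by norm_num : (-18 + 21 : ℤ) ≤ 4)).of_le (C := n) (Eventually.of_forall fun q => by
        rw [norm_smul, norm_neg, norm_mul, mul_assoc, RCLike.norm_natCast])
  refine (h4.add h3).congr ?_
  filter_upwards [h.bounds, h.nonneg] with q hb ha0
  simp only [wSum_eq_sum_smul, Finset.smul_sum, ← Finset.sum_add_distrib,
    ← Finset.sum_sub_distrib, smul_smul, ← add_smul, ← sub_smul]
  refine Finset.sum_congr rfl fun j _ => ?_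
  congr 1
  have h5 := hb.inv_sub_inv h.A_pos.le ha0 j
  rcases hn with rfl | rfl
  · simp only [if_true, Nat.cast_one]
    linear_combination -z q j * (1 - (a q - A) * (A + D j)⁻¹) * h5
  · simp only [OfNat.ofNat_ne_one, if_false, Nat.cast_ofNat]
    linear_combination -z q j * ((a q + D j)⁻¹ + (A + D j)⁻¹ -
      (a q - A) * (A + D j)⁻¹ * ((a q + D j)⁻¹ + 2 * (A + D j)⁻¹)) * h5

/-- The normal equations at a and at A give G_a(β_a - β_A) = (w_a - w_A) - (G_a - G_A)β_A. The right
side has order 4, and G_a⁻¹ lowers it by 40. -/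
theorem ord_wls_sub (h : NearTruth l x D A K d₁ d₂ C i m z a) :
    Ord l m (-36) fun q => wls x D (m q) (a q) (z q) - wls x D (m q) A (z q) := by
  have h1 := (h.ord_wSum_sub (Or.inl rfl)).sub
    ((h.ord_wGram_sub_mulVec (Or.inl rfl) h.ord_wls).mono h.tendsto (by norm_num))
  refine (h.ord_inv_mulVec h1).congr ?_
  filter_upwards [h.bounds, h.nonneg] with q hb ha0
  have hpA : ∀ j < m q, 0 < A + D j := fun j _ => hb.add_pos h.A_pos.le j
  have hpb : ∀ j < m q, 0 < a q + D j := fun j _ => hb.add_pos ha0 j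
  rw [wGram_mulVec_wls hb.spans hpA, Matrix.mulVec_sub, Matrix.mulVec_sub, Matrix.mulVec_sub,
    Matrix.mulVec_mulVec (wls x D (m q) A (z q)),
    Matrix.nonsing_inv_mul _ (isUnit_det_wGram hb.spans 1 hpb), Matrix.one_mulVec]
  simp only [wls]
  abel

/-- Each of the m leverages is O(1/m) and changes by O(|a - A|/m), and the weights change by O(|a -
A|). -/
theorem ord_levSum_sub (h : NearTruth l x D A K d₁ d₂ C i m z a) :
    Ord l m (-18) fun q => levSum x D (m q) 2 (a q) - levSum x D (m q) 2 A := by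
  set J := p * K * (A + 1 + d₂) with hJ
  set B := p * K * (J * K) * (2 * d₁⁻¹ ^ 3) +
    p * K * (J ^ 2 * (2 * p * K ^ 2 * d₁⁻¹ ^ 2) * K) * d₁⁻¹ ^ 2 with hB
  refine h.ord_diff.norm.of_le (C := B) ?_
  filter_upwards [h.bounds, h.nonneg, h.le_add_one] with q hb ha0 ha1
  have hm := hb.m_pos
  have hK := hb.K_pos
  have hd₁ := hb.d₁_pos
  have hd₂ := hd₁.trans_le hb.d₁_le
  have hA := h.A_pos
  rw [levSum, levSum, ← Finset.sum_sub_distrib]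
  refine (norm_sum_le _ _).trans ((Finset.sum_le_card_nsmul _ _
    (B * (|a q - A| / m q)) fun j _ => ?_).trans_eq ?_)
  · set s := (wGram x D (m q) 1 (a q))⁻¹ *ᵥ x j
    set t := (wGram x D (m q) 1 A)⁻¹ *ᵥ x j
    have h1 : ‖s - t‖ ≤ J ^ 2 * (2 * p * K ^ 2 * d₁⁻¹ ^ 2) * (|a q - A| / m q * ‖x j‖) :=
      hb.norm_inv_sub_le hA.le ha0 (by linarith) ha1 (x j)
    have h2 : ‖s‖ ≤ p * K * (a q + d₂) / m q * ‖x j‖ := hb.norm_inv_wGram_mulVec_le ha0 (x j)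
    have h3 := hb.abs_inv_pow_sub_le hA.le ha0 j (n := 2) (Or.inr rfl)
    have h4 := hb.abs_dotProduct_le j s
    have h5 := hb.abs_dotProduct_le j (s - t)
    have h6 := hb.norm_le j
    have hw := hb.inv_pos hA.le j
    have hw' := hb.inv_le hA.le j
    have h7 : x j ⬝ᵥ s / (a q + D j) ^ 2 - x j ⬝ᵥ t / (A + D j) ^ 2 =
        x j ⬝ᵥ s * ((a q + D j)⁻¹ ^ 2 - (A + D j)⁻¹ ^ 2) +
          x j ⬝ᵥ (s - t) * (A + D j)⁻¹ ^ 2 := by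
      rw [dotProduct_sub, inv_pow, inv_pow]
      ring
    have h8 : ‖s‖ ≤ J / m q * K := h2.trans (by rw [hJ]; gcongr)
    have h9 : ‖s - t‖ ≤ J ^ 2 * (2 * p * K ^ 2 * d₁⁻¹ ^ 2) * (|a q - A| / m q * K) :=
      h1.trans (by gcongr)
    rw [h7]
    refine (norm_add_le _ _).trans ?_
    rw [norm_mul, norm_mul, Real.norm_eq_abs, Real.norm_eq_abs, Real.norm_eq_abs,
      Real.norm_of_nonneg (by positivity : 0 ≤ (A + D j)⁻¹ ^ 2)]
    have hJ0 : 0 ≤ J := by positivity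
    calc _ ≤ (p * K * (J / m q * K)) * (2 * d₁⁻¹ ^ (2 + 1) * |a q - A|) +
          (p * K * (J ^ 2 * (2 * p * K ^ 2 * d₁⁻¹ ^ 2) * (|a q - A| / m q * K))) * d₁⁻¹ ^ 2 := by
          gcongr
          · exact h4.trans (by gcongr)
          · exact h5.trans (by gcongr)
      _ = _ := by rw [hB]; ring
  · rw [Finset.card_range, nsmul_eq_mul, Real.norm_eq_abs]
    field_simp

/-- Products are telescoped one factor at a time; the critical pieces have order 4 - 19, 21 - 36 and
-36 + 40 - 19, all equal to -15. -/
theorem ord_scoreProj_sub (h : NearTruth l x D A K d₁ d₂ C i m z a) :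
    Ord l m (-14) fun q => scoreProj x D (m q) (z q) (a q) - scoreProj x D (m q) (z q) A := by
  have hm := h.tendsto
  have hβ := h.ord_wls
  have hdβ := h.ord_wls_sub
  have hw := h.ord_lin (k := 2) (by norm_num)
  have hdw := h.ord_wSum_sub (n := 2) (Or.inr rfl)
  have hβa : Ord l m (-19) fun q => wls x D (m q) (a q) (z q) :=
    (hβ.add (hdβ.mono hm (by norm_num))).congr (Eventually.of_forall fun q => by abel)
  have t1 := (h.ord_levSum_sub.const_mul (1 / 2)).mono hm (by norm_num : (-18 : ℤ) ≤ -14)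
  have t2 := (hdw.dotProduct hm hβa).mono hm (by norm_num : (4 + -19 : ℤ) ≤ -14)
  have t3 := (hw.dotProduct hm hdβ).mono hm (by norm_num : (21 + -36 : ℤ) ≤ -14)
  have t4 := ((hdβ.dotProduct hm (h.ord_wGram_mulVec 2 hβa)).const_mul (1 / 2)).mono hm
    (by norm_num : (-36 + (40 + -19) : ℤ) ≤ -14)
  have t5 := ((hβ.dotProduct hm (h.ord_wGram_mulVec 2 hdβ)).const_mul (1 / 2)).mono hm
    (by norm_num : (-19 + (40 + -36) : ℤ) ≤ -14)
  have t6 := ((hβ.dotProduct hm (h.ord_wGram_sub_mulVec (Or.inr rfl) hβ)).const_mul (1 / 2)).mono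
    hm (by norm_num : (-19 + (22 + -19) : ℤ) ≤ -14)
  refine ((((t1.sub t2).sub t3).add t4).add (t5.add t6)).congr (Eventually.of_forall fun q => ?_)
  simp only [scoreProj, sub_dotProduct, dotProduct_sub, Matrix.mulVec_sub]
  ring

end NearTruth

end FayHerriot

/-! ### Second-order expansion of the estimator, the predictor and the MSE estimator -/

namespace FayHerriot

variable {p : ℕ} {α : Type*}

/-- The score of the model variance without the regression part (times two). -/
noncomputable def scoreDiag (D : ℕ → ℝ) (m : ℕ) (z : ℕ → ℝ) (a : ℝ) : ℝ :=
  ∑ j ∈ Finset.range m, (z j ^ 2 / (a + D j) ^ 2 - 1 / (a + D j))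

/-- The leading terms of `τ₂ (Â - A)`, apart from the adjustment factor. -/
noncomputable def leadingSum (x : ℕ → Fin p → ℝ) (D : ℕ → ℝ) (A : ℝ) (m : ℕ) (z : ℕ → ℝ) : ℝ :=
  chiSum D m A 2 z - 2 * (chiSum D m A 3 z * (chiSum D m A 2 z * (invSum D m A 2)⁻¹)) +
    2 * (invSum D m A 3 * (chiSum D m A 2 z * (invSum D m A 2)⁻¹) ^ 2) +
    2 * scoreProj x D m z A

/-- The shrinkage correction `B_i(a) (z_i - x_i' β̂(a))` of the predictor. -/
noncomputable def correction (x : ℕ → Fin p → ℝ) (D : ℕ → ℝ) (m i : ℕ) (z : ℕ → ℝ) (a : ℝ) : ℝ :=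
  shrink D i a * (z i - x i ⬝ᵥ wls x D m a z)

namespace NearTruth

variable {l : Filter α} {x : ℕ → Fin p → ℝ} {D : ℕ → ℝ} {A K d₁ d₂ C : ℝ} {i : ℕ}
  {m : α → ℕ} {z : α → ℕ → ℝ} {a : α → ℝ}

/-- Taylor expansion to second order in a - A, with z_j² split as (z_j² - v_j) + v_j so that every
coefficient is a noise sum plus a deterministic sum. The remainder is (a - A)³ times a sum of order
m: -54 + 40 = -14. -/
theorem scoreDiag_expansion (h : NearTruth l x D A K d₁ d₂ C i m z a) :
    Ord l m (-14) fun q => scoreDiag D (m q) (z q) (a q) -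
      (chiSum D (m q) A 2 (z q) - (2 * chiSum D (m q) A 3 (z q) + invSum D (m q) A 2) * (a q - A) +
        (3 * chiSum D (m q) A 4 (z q) + 2 * invSum D (m q) A 3) * (a q - A) ^ 2) := by
  have h1 : Ord l m 40 fun q => ∑ j ∈ Finset.range (m q),
      (z q j ^ 2 * ((a q + D j)⁻¹ * ((a q + D j)⁻¹ + 3 * (A + D j)⁻¹) * (A + D j)⁻¹ ^ 3) -
        (a q + D j)⁻¹ * (A + D j)⁻¹ ^ 3) := by
    refine h.ord_sum_of_le_sq (B := 4 * d₁⁻¹ ^ 5 + d₁⁻¹ ^ 4) ?_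
    filter_upwards [h.bounds, h.nonneg] with q hb ha0 j _
    have hu := hb.inv_pos ha0 j
    have hw := hb.inv_pos h.A_pos.le j
    have hu' := hb.inv_le ha0 j
    have hw' := hb.inv_le h.A_pos.le j
    have hd : 0 < d₁⁻¹ := _root_.inv_pos.2 hb.d₁_pos
    generalize (a q + D j)⁻¹ = u at *
    generalize (A + D j)⁻¹ = w at *
    generalize d₁⁻¹ = U at *
    have e1 : u * (u + 3 * w) * w ^ 3 ≤ U * (U + 3 * U) * U ^ 3 := by gcongr
    have e2 : u * w ^ 3 ≤ U * U ^ 3 := by gcongr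
    refine (norm_sub_le _ _).trans ?_
    rw [Real.norm_of_nonneg (by positivity), Real.norm_of_nonneg (by positivity)]
    have e3 := mul_le_mul_of_nonneg_left e1 (sq_nonneg (z q j))
    nlinarith [pow_pos hd 5, pow_pos hd 4, sq_nonneg (z q j),
      mul_nonneg (sq_nonneg (z q j)) (pow_pos hd 4).le]
  have h2 := ((h.ord_diff.pow 3).mul h.tendsto h1).neg
  refine (h2.mono h.tendsto (by norm_num)).congr ?_
  filter_upwards [h.bounds, h.nonneg] with q hb ha0
  simp only [scoreDiag, chiSum, invSum, Finset.mul_sum, Finset.sum_mul, ← Finset.sum_add_distrib,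
    ← Finset.sum_sub_distrib, ← Finset.sum_neg_distrib]
  refine Finset.sum_congr rfl fun j _ => ?_
  have h5 := hb.inv_sub_inv h.A_pos.le ha0 j
  have hw := (hb.add_pos h.A_pos.le j).ne'
  have hvw : (A + D j) * (A + D j)⁻¹ = 1 := mul_inv_cancel₀ hw
  simp only [div_eq_mul_inv, one_mul, ← inv_pow]
  generalize (a q + D j)⁻¹ = u at *
  generalize (A + D j)⁻¹ = w at *
  generalize a q - A = δ at *
  generalize A + D j = v at *
  linear_combination -(z q j ^ 2 * (u + w - δ * w * (u + 2 * w) + δ ^ 2 * w ^ 2 * (u + 3 * w)) -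
    (1 - δ * w + δ ^ 2 * w ^ 2)) * h5 + (- w + 2 * w ^ 2 * δ - 3 * w ^ 3 * δ ^ 2) * hvw

section Score

variable {κ : α → ℝ}

theorem ord_scoreProj (h : NearTruth l x D A K d₁ d₂ C i m z a) :
    Ord l m 2 fun q => scoreProj x D (m q) (z q) A := by
  have hm := h.tendsto
  have hβ := h.ord_wls
  have hw := h.ord_lin (k := 2) (by norm_num)
  have t1 : Ord l m 0 fun q => levSum x D (m q) 2 A := by
    refine Ord.of_bound (C := p / (A + d₁)) ?_
    filter_upwards [h.bounds] with q hb
    have hp : ∀ j < m q, 0 < A + D j := fun j _ => hb.add_pos h.A_pos.le j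
    rw [Real.norm_of_nonneg (levSum_two_nonneg hb.spans hp), zpow_zero, mul_one]
    exact levSum_two_le hb.spans (by linarith [h.A_pos, hb.d₁_pos]) fun j _ => hb.le_D j
  have t2 := (hw.dotProduct hm hβ)
  have t3 := ((hβ.dotProduct hm (h.self.ord_wGram_mulVec 2 hβ)).const_mul (1 / 2)).mono hm
    (by norm_num : (-19 + (40 + -19) : ℤ) ≤ 2)
  refine (((((t1.const_mul (1 / 2)).mono hm (by norm_num)).sub t2).add t3)).congr
    (Eventually.of_forall fun q => ?_)
  simp only [scoreProj]
  ring

/-- First-order solution of the score equation: every term except χ₂ and τ(a - A) has order at most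
4, and division by τ lowers this to -36. -/
theorem ord_diff_sub (h : NearTruth l x D A K d₁ d₂ C i m z a) (hκ : Ord l m 0 κ)
    (hscore : ∀ᶠ q in l, scoreDiag D (m q) (z q) (a q) / 2 + scoreProj x D (m q) (z q) (a q) +
      κ q = 0) :
    Ord l m (-36) fun q => a q - A - chiSum D (m q) A 2 (z q) * (invSum D (m q) A 2)⁻¹ := by
  have hm := h.tendsto
  have hδ := h.ord_diff
  have t0 := h.scoreDiag_expansion.mono hm (by norm_num : (-14 : ℤ) ≤ 4)
  have t1 := (((h.ord_chi (k := 3) (by norm_num)).mul hm hδ).const_mul 2).mono hm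
    (by norm_num : (21 + -18 : ℤ) ≤ 4)
  have t2 := (((h.ord_chi (k := 4) (by norm_num)).mul hm (hδ.pow 2)).const_mul 3).mono hm
    (by norm_num : (21 + -18 * (2 : ℕ) : ℤ) ≤ 4)
  have t3 := (((h.ord_invSum 3).mul hm (hδ.pow 2)).const_mul 2).mono hm
    (by norm_num : (40 + -18 * (2 : ℕ) : ℤ) ≤ 4)
  have t4 := ((h.ord_scoreProj.mono hm (by norm_num : (2 : ℤ) ≤ 4)).add
    (h.ord_scoreProj_sub.mono hm (by norm_num))).const_mul 2
  have t5 := (hκ.const_mul 2).mono hm (by norm_num : (0 : ℤ) ≤ 4)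
  have t6 := (((((t0.sub t1).add t2).add t3).add t4).add t5).mul hm (h.ord_inv_invSum 2)
  refine (t6.mono hm (by norm_num)).congr ?_
  filter_upwards [hscore, h.bounds] with q hq hb
  have hτ : invSum D (m q) A 2 * (invSum D (m q) A 2)⁻¹ = 1 := by
    refine mul_inv_cancel₀ (ne_of_gt ?_)
    refine Finset.sum_pos (fun j _ => ?_) ⟨0, Finset.mem_range.2 hb.pos⟩
    have := hb.add_pos h.A_pos.le j
    positivity
  linear_combination 2 * (invSum D (m q) A 2)⁻¹ * hq + (a q - A) * hτ

/-- The first-order solution χ₂/τ is substituted for a - A in the second-order terms. With an error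
of order -36 this costs 21 - 36 in the χ₃ term and 40 - 36 - 18 = -14 in the quadratic one; the χ₄
term, of order 21 - 36, is dropped. -/
theorem ord_invSum_mul_diff_sub (h : NearTruth l x D A K d₁ d₂ C i m z a) (hκ : Ord l m 0 κ)
    (hscore : ∀ᶠ q in l, scoreDiag D (m q) (z q) (a q) / 2 + scoreProj x D (m q) (z q) (a q) +
      κ q = 0) :
    Ord l m (-14) fun q => invSum D (m q) A 2 * (a q - A) -
      (leadingSum x D A (m q) (z q) + 2 * κ q) := by
  have hm := h.tendsto
  have hδ := h.ord_diff
  have hr := h.ord_diff_sub hκ hscore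
  have hδ₁ : Ord l m (-18) fun q => chiSum D (m q) A 2 (z q) * (invSum D (m q) A 2)⁻¹ :=
    ((h.ord_chi (k := 2) (by norm_num)).mul hm (h.ord_inv_invSum 2)).mono hm (by norm_num)
  have t0 := h.scoreDiag_expansion
  have t1 := (((h.ord_chi (k := 3) (by norm_num)).mul hm hr).const_mul 2).mono hm
    (by norm_num : (21 + -36 : ℤ) ≤ -14)
  have t2 := (((h.ord_chi (k := 4) (by norm_num)).mul hm (hδ.pow 2)).const_mul 3).mono hm
    (by norm_num : (21 + -18 * (2 : ℕ) : ℤ) ≤ -14)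
  have t3 := (((h.ord_invSum 3).mul hm (hr.mul hm (hδ.add hδ₁))).const_mul 2).mono hm
    (by norm_num : (40 + (-36 + -18) : ℤ) ≤ -14)
  have t4 := h.ord_scoreProj_sub.const_mul 2
  refine ((((t0.sub t1).add t2).add t3).add t4).congr ?_
  filter_upwards [hscore] with q hq
  rw [leadingSum]
  linear_combination 2 * hq

theorem ord_recip (h : NearTruth l x D A K d₁ d₂ C i m z a) :
    Ord l m 0 fun q => (a q + D i)⁻¹ := by
  refine Ord.of_bound (C := d₁⁻¹) ?_
  filter_upwards [h.bounds, h.nonneg] with q hb ha0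
  rw [zpow_zero, mul_one, Real.norm_of_nonneg (hb.inv_pos ha0 i).le]
  exact hb.inv_le ha0 i

theorem ord_recip_sub (h : NearTruth l x D A K d₁ d₂ C i m z a) :
    Ord l m (-18) fun q => (a q + D i)⁻¹ - (A + D i)⁻¹ := by
  have h1 := (h.ord_diff.mul h.tendsto (h.ord_recip.mul h.tendsto h.self.ord_recip)).neg
  refine (h1.mono h.tendsto (by norm_num)).congr ?_
  filter_upwards [h.bounds, h.nonneg] with q hb ha0
  linear_combination -hb.inv_sub_inv h.A_pos.le ha0 i

theorem ord_recip_expansion (h : NearTruth l x D A K d₁ d₂ C i m z a) :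
    Ord l m (-54) fun q => (a q + D i)⁻¹ - ((A + D i)⁻¹ - (a q - A) * (A + D i)⁻¹ ^ 2 +
      (a q - A) ^ 2 * (A + D i)⁻¹ ^ 3) := by
  have h1 := ((h.ord_diff.pow 3).mul h.tendsto
    (h.ord_recip.mul h.tendsto (h.self.ord_recip.pow 3))).neg
  refine (h1.mono h.tendsto (by norm_num)).congr ?_
  filter_upwards [h.bounds, h.nonneg] with q hb ha0
  have h5 := hb.inv_sub_inv h.A_pos.le ha0 i
  generalize (a q + D i)⁻¹ = u at *
  generalize (A + D i)⁻¹ = w at *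
  linear_combination -(1 - (a q - A) * w + (a q - A) ^ 2 * w ^ 2) * h5

/-- Only the change of the shrinkage factor acting on z_i matters. The regression part x_i'β̂ is
already of order -19, so that its change and its product with the change of B_i have order at most
-36. -/
theorem ord_correction_sub (h : NearTruth l x D A K d₁ d₂ C i m z a) (hκ : Ord l m 0 κ)
    (hscore : ∀ᶠ q in l, scoreDiag D (m q) (z q) (a q) / 2 + scoreProj x D (m q) (z q) (a q) +
      κ q = 0) :
    Ord l m (-35) fun q => correction x D (m q) i (z q) (a q) - correction x D (m q) i (z q) A +
      D i * (A + D i)⁻¹ ^ 2 * (chiSum D (m q) A 2 (z q) * (invSum D (m q) A 2)⁻¹ * z q i) := by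
  have hm := h.tendsto
  have hx : Ord l m 0 fun _ => x i := Ord.const _
  have hu := h.ord_recip
  have hdu := h.ord_recip_sub
  have t1 := ((hx.dotProduct hm h.ord_wls_sub).mul hm hu).const_mul (D i)
  have t2 := ((hx.dotProduct hm h.ord_wls).mul hm hdu).const_mul (D i)
  have t3 := ((h.ord_diff_sub hκ hscore).mul hm h.ord_coord).const_mul (D i * (A + D i)⁻¹ ^ 2)
  have t4 := (((h.ord_diff.pow 2).mul hm h.ord_coord).mul hm hu).const_mul (D i * (A + D i)⁻¹ ^ 2)
  refine ((((t4.mono hm (by norm_num)).sub (t3.mono hm (by norm_num))).sub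
    (t2.mono hm (by norm_num))).sub (t1.mono hm (by norm_num))).congr ?_
  filter_upwards [h.bounds, h.nonneg] with q hb ha0
  have h5 := hb.inv_sub_inv h.A_pos.le ha0 i
  simp only [correction, shrink, div_eq_mul_inv, dotProduct_sub]
  generalize (a q + D i)⁻¹ = u at *
  generalize (A + D i)⁻¹ = w at *
  linear_combination -(D i * z q i * (1 - (a q - A) * w)) * h5

theorem ord_invSum_sub (h : NearTruth l x D A K d₁ d₂ C i m z a) :
    Ord l m 22 fun q => invSum D (m q) (a q) 2 - invSum D (m q) A 2 := by
  refine ((ord_natCast l m).mul h.tendsto h.ord_diff.norm).of_le (C := 2 * d₁⁻¹ ^ 3) ?_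
  filter_upwards [h.bounds, h.nonneg] with q hb ha0
  rw [invSum, invSum, ← Finset.sum_sub_distrib]
  refine (norm_sum_le _ _).trans ((Finset.sum_le_card_nsmul _ _
    (2 * d₁⁻¹ ^ 3 * |a q - A|) fun j _ => ?_).trans_eq ?_)
  · have := hb.abs_inv_pow_sub_le h.A_pos.le ha0 j (n := 2) (Or.inr rfl)
    rw [Real.norm_eq_abs, one_div, one_div, ← inv_pow, ← inv_pow]
    exact this
  · rw [Finset.card_range, nsmul_eq_mul, Real.norm_eq_abs]
    ring

theorem ord_inv_invSum_near (h : NearTruth l x D A K d₁ d₂ C i m z a) :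
    Ord l m (-40) fun q => (invSum D (m q) (a q) 2)⁻¹ := by
  refine Ord.of_bound (C := (A + 1 + d₂) ^ 2) ?_
  filter_upwards [h.bounds, h.nonneg, h.le_add_one] with q hq ha0 ha1
  have hA := h.A_pos
  have hd₂ : 0 < d₂ := hq.d₁_pos.trans_le hq.d₁_le
  have hm := hq.m_pos
  have h1 : m q * (1 / (A + 1 + d₂) ^ 2) ≤ invSum D (m q) (a q) 2 := by
    rw [← nsmul_eq_mul]
    nth_rw 1 [← Finset.card_range (m q)]
    refine Finset.card_nsmul_le_sum _ _ _ fun j _ => ?_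
    have := hq.add_pos ha0 j
    have := hq.D_le j
    gcongr
  rw [zpow_neg_forty, norm_inv, Real.norm_of_nonneg (le_trans (by positivity) h1)]
  calc (invSum D (m q) (a q) 2)⁻¹ ≤ (m q * (1 / (A + 1 + d₂) ^ 2))⁻¹ := by gcongr
    _ = _ := by field_simp

theorem _root_.FayHerriot.Bounds.g3_eq {n : ℕ} (h : Bounds x D K d₁ d₂ n) {b : ℝ} (hb : 0 ≤ b) :
    g3 D n i b = 2 * D i ^ 2 * ((b + D i)⁻¹ ^ 3 * (invSum D n b 2)⁻¹) := by
  rw [g3, trace_inv_covV_sq fun j _ => h.add_pos hb j, ← invSum, div_eq_mul_inv, mul_inv, inv_pow]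

theorem ord_g3_sub (h : NearTruth l x D A K d₁ d₂ C i m z a) :
    Ord l m (-58) fun q => g3 D (m q) i (a q) - g3 D (m q) i A := by
  have hm := h.tendsto
  have hu := h.ord_recip
  have hw := h.self.ord_recip
  have hdu := h.ord_recip_sub
  have t1 := ((hdu.mul hm (((hu.pow 2).mono hm (by norm_num : _ ≤ (0 : ℤ))).add
    (((hu.mul hm hw).mono hm (by norm_num : _ ≤ (0 : ℤ))).add
    ((hw.pow 2).mono hm (by norm_num : _ ≤ (0 : ℤ)))))).mul hm h.ord_inv_invSum_near).const_mul
    (2 * D i ^ 2)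
  have t2 := ((hw.pow 3).mul hm (h.ord_invSum_sub.mul hm
    (h.ord_inv_invSum_near.mul hm (h.ord_inv_invSum 2)))).const_mul (2 * D i ^ 2)
  refine ((t1.mono hm (by norm_num)).sub (t2.mono hm (by norm_num))).congr ?_
  filter_upwards [h.bounds, h.nonneg] with q hb ha0
  have hpos : ∀ b, 0 ≤ b → invSum D (m q) b 2 * (invSum D (m q) b 2)⁻¹ = 1 := fun b hb0 => by
    refine mul_inv_cancel₀ (ne_of_gt ?_)
    refine Finset.sum_pos (fun j _ => ?_) ⟨0, Finset.mem_range.2 hb.pos⟩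
    have := hb.add_pos hb0 j
    positivity
  have h1 := hpos (a q) ha0
  have h2 := hpos A h.A_pos.le
  rw [hb.g3_eq ha0, hb.g3_eq h.A_pos.le]
  generalize (a q + D i)⁻¹ = u at *
  generalize (A + D i)⁻¹ = w at *
  generalize (invSum D (m q) (a q) 2)⁻¹ = s at *
  generalize (invSum D (m q) A 2)⁻¹ = t at *
  linear_combination -(2 * D i ^ 2 * w ^ 3 * t) * h1 + (2 * D i ^ 2 * w ^ 3 * s) * h2

theorem _root_.FayHerriot.Bounds.g2_eq {n : ℕ} (h : Bounds x D K d₁ d₂ n) {b : ℝ} (hb : 0 ≤ b) :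
    g2 x D n i b = D i ^ 2 * ((b + D i)⁻¹ ^ 2 * (x i ⬝ᵥ ((wGram x D n 1 b)⁻¹ *ᵥ x i))) := by
  rw [g2, gram_eq_wGram x D n b fun j _ => h.add_pos hb j, div_eq_mul_inv, inv_pow, mul_assoc]

theorem ord_g2_sub (h : NearTruth l x D A K d₁ d₂ C i m z a) :
    Ord l m (-58) fun q => g2 x D (m q) i (a q) - g2 x D (m q) i A := by
  have hm := h.tendsto
  have hu := h.ord_recip
  have hw := h.self.ord_recip
  have hdu := h.ord_recip_sub
  have hx : Ord l m 0 fun _ => x i := Ord.const _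
  have t1 := ((hdu.mul hm (hu.add hw)).mul hm
    (hx.dotProduct hm (h.ord_inv_mulVec hx))).const_mul (D i ^ 2)
  have t2 := ((hw.pow 2).mul hm (hx.dotProduct hm (h.ord_inv_sub_mulVec hx))).const_mul (D i ^ 2)
  refine ((t1.mono hm (by norm_num)).add (t2.mono hm (by norm_num))).congr ?_
  filter_upwards [h.bounds, h.nonneg] with q hb ha0
  rw [hb.g2_eq ha0, hb.g2_eq h.A_pos.le, dotProduct_sub]
  ring

theorem ord_g3 (h : NearTruth l x D A K d₁ d₂ C i m z a) :
    Ord l m (-40) fun q => g3 D (m q) i A := by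
  have t := ((h.self.ord_recip.pow 3).mul h.tendsto (h.ord_inv_invSum 2)).const_mul (2 * D i ^ 2)
  refine (t.mono h.tendsto (by norm_num)).congr ?_
  filter_upwards [h.bounds] with q hb
  rw [hb.g3_eq h.A_pos.le]

/-- g₁(a) = D_i - D_i²/(a + D_i), so the expansion of the reciprocal suffices. -/
theorem ord_g1_sub (h : NearTruth l x D A K d₁ d₂ C i m z a) :
    Ord l m (-54) fun q => g1 D i (a q) - (g1 D i A + D i ^ 2 * (A + D i)⁻¹ ^ 2 * (a q - A) -
      D i ^ 2 * (A + D i)⁻¹ ^ 3 * (a q - A) ^ 2) := by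
  refine (h.ord_recip_expansion.const_mul (-D i ^ 2)).congr ?_
  filter_upwards [h.bounds, h.nonneg] with q hb ha0
  have h1 := mul_inv_cancel₀ (hb.add_pos ha0 i).ne'
  have h2 := mul_inv_cancel₀ (hb.add_pos h.A_pos.le i).ne'
  simp only [g1, div_eq_mul_inv]
  generalize (a q + D i)⁻¹ = u at *
  generalize (A + D i)⁻¹ = w at *
  linear_combination -D i * h1 + D i * h2

/-- The leading terms of the MSE estimator at `Â`. -/
noncomputable def mseEstLeading (x : ℕ → Fin p → ℝ) (D : ℕ → ℝ) (A : ℝ) (m i : ℕ) (z : ℕ → ℝ)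
    (κ c : ℝ) : ℝ :=
  g1 D i A + D i ^ 2 * (A + D i)⁻¹ ^ 2 * ((leadingSum x D A m z + 2 * κ) * (invSum D m A 2)⁻¹) -
    D i ^ 2 * (A + D i)⁻¹ ^ 3 * (chiSum D m A 2 z * (invSum D m A 2)⁻¹) ^ 2 +
    g2 x D m i A + c * g3 D m i A

/-- κ and c are multiplied by 1/τ and g₃, both O(1/m), so mere convergence of κ - κ₀ and of c(a) -
c₀ to 0 is enough. The errors of g₁, g₂, g₃ and of Â - A are of strictly smaller order than 1/m. -/
theorem mseEst_sub_isLittleO (h : NearTruth l x D A K d₁ d₂ C i m z a) (hκ : Ord l m 0 κ)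
    (hscore : ∀ᶠ q in l, scoreDiag D (m q) (z q) (a q) / 2 + scoreProj x D (m q) (z q) (a q) +
      κ q = 0) {κ₀ c₀ : α → ℝ} (hκ₀ : Tendsto (fun q => κ q - κ₀ q) l (𝓝 0))
    {c : α → ℝ → ℝ} (hc₀ : Ord l m 0 c₀) (hc : Tendsto (fun q => c q (a q) - c₀ q) l (𝓝 0)) :
    (fun q => mseEst x D (m q) i (c q) (a q) -
      mseEstLeading x D A (m q) i (z q) (κ₀ q) (c₀ q)) =o[l] fun q => scale (m q) ^ (-40 : ℤ) := by
  have hm := h.tendsto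
  have hlt : ∀ {f : α → ℝ} {k : ℤ}, Ord l m k f → k < -40 →
      f =o[l] fun q => scale (m q) ^ (-40 : ℤ) := fun hf hk => hf.isLittleO hm hk
  have hmul : ∀ {f g : α → ℝ}, Tendsto f l (𝓝 0) → Ord l m (-40) g →
      (fun q => f q * g q) =o[l] fun q => scale (m q) ^ (-40 : ℤ) := fun hf hg => by
    simpa using ((isLittleO_one_iff ℝ).2 hf).mul_isBigO hg
  have hr := h.ord_diff_sub hκ hscore
  have hδ₁ : Ord l m (-18) fun q => chiSum D (m q) A 2 (z q) * (invSum D (m q) A 2)⁻¹ :=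
    ((h.ord_chi (k := 2) (by norm_num)).mul hm (h.ord_inv_invSum 2)).mono hm (by norm_num)
  have hca : Ord l m 0 fun q => c q (a q) := by
    have h1 : Ord l m 0 fun q => c q (a q) - c₀ q := by
      have := ((isLittleO_one_iff ℝ).2 hc).isBigO
      refine IsBigO.trans this (IsBigO.of_bound 1 (Eventually.of_forall fun q => by simp))
    exact (h1.add hc₀).congr (Eventually.of_forall fun q => by ring)
  have t1 := hlt h.ord_g1_sub (by norm_num)
  have t2 := hlt (((h.ord_invSum_mul_diff_sub hκ hscore).mul hm (h.ord_inv_invSum 2)).const_mul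
    (D i ^ 2 * (A + D i)⁻¹ ^ 2)) (by norm_num)
  have t3 := (hmul hκ₀ (h.ord_inv_invSum 2)).const_mul_left (2 * (D i ^ 2 * (A + D i)⁻¹ ^ 2))
  have t4 := hlt ((hr.mul hm (h.ord_diff.add hδ₁)).const_mul (D i ^ 2 * (A + D i)⁻¹ ^ 3))
    (by norm_num)
  have t5 := hlt h.ord_g2_sub (by norm_num)
  have t6 := hlt (hca.mul hm h.ord_g3_sub) (by norm_num)
  have t7 := hmul hc h.ord_g3
  refine ((((((t1.add t2).add t3).sub t4).add t5).add t6).add t7).congr' ?_ EventuallyEq.rfl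
  filter_upwards [h.bounds] with q hb
  have hτ : invSum D (m q) A 2 * (invSum D (m q) A 2)⁻¹ = 1 := by
    refine mul_inv_cancel₀ (ne_of_gt ?_)
    refine Finset.sum_pos (fun j _ => ?_) ⟨0, Finset.mem_range.2 hb.pos⟩
    have := hb.add_pos h.A_pos.le j
    positivity
  simp only [mseEst, mseEstLeading]
  linear_combination (D i ^ 2 * (A + D i)⁻¹ ^ 2) * (a q - A) * hτ

end Score

end NearTruth

end FayHerriot

/-! ### Gaussian moments and subexponential tails -/

namespace FayHerriot

open scoped NNReal

/-- Derivatives at 0 of the Gaussian moment generating function, from which the second and fourth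
moments are read off. Each derivative is the exponential times an explicit polynomial. -/
theorem iteratedDeriv_exp_sq_zero (w : ℝ) :
    iteratedDeriv 2 (fun t : ℝ => Real.exp (w * t ^ 2 / 2)) 0 = w ∧
      iteratedDeriv 4 (fun t : ℝ => Real.exp (w * t ^ 2 / 2)) 0 = 3 * w ^ 2 := by
  have h0 : ∀ t : ℝ, HasDerivAt (fun t : ℝ => Real.exp (w * t ^ 2 / 2))
      (Real.exp (w * t ^ 2 / 2) * (w * t)) t := fun t => by
    have : HasDerivAt (fun t : ℝ => w * t ^ 2 / 2) (w * t) t :=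
      (((hasDerivAt_pow 2 t).const_mul w).div_const 2).congr_deriv (by norm_num; ring)
    exact this.exp
  have step : ∀ {q q' : ℝ → ℝ}, (∀ t, HasDerivAt q (q' t) t) →
      deriv (fun t : ℝ => Real.exp (w * t ^ 2 / 2) * q t) =
        fun t => Real.exp (w * t ^ 2 / 2) * (q' t + w * t * q t) := fun {q q'} hq => by
    funext t
    rw [((h0 t).fun_mul (hq t)).deriv]
    ring
  have e1 : deriv (fun t : ℝ => Real.exp (w * t ^ 2 / 2)) =
      fun t => Real.exp (w * t ^ 2 / 2) * (w * t) := funext fun t => (h0 t).deriv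
  have e2 : deriv (fun t : ℝ => Real.exp (w * t ^ 2 / 2) * (w * t)) =
      fun t => Real.exp (w * t ^ 2 / 2) * (w + w ^ 2 * t ^ 2) := by
    rw [step (q' := fun _ => w) fun t => by simpa using (hasDerivAt_id t).const_mul w]
    funext t; ring
  have e3 : deriv (fun t : ℝ => Real.exp (w * t ^ 2 / 2) * (w + w ^ 2 * t ^ 2)) =
      fun t => Real.exp (w * t ^ 2 / 2) * (3 * w ^ 2 * t + w ^ 3 * t ^ 3) := by
    rw [step (q' := fun t => w ^ 2 * (2 * t)) fun t => by
      simpa using ((hasDerivAt_pow 2 t).const_mul (w ^ 2)).const_add w]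
    funext t; ring
  have e4 : deriv (fun t : ℝ => Real.exp (w * t ^ 2 / 2) * (3 * w ^ 2 * t + w ^ 3 * t ^ 3)) =
      fun t => Real.exp (w * t ^ 2 / 2) *
        ((3 * w ^ 2 + w ^ 3 * (3 * t ^ 2)) + w * t * (3 * w ^ 2 * t + w ^ 3 * t ^ 3)) := by
    rw [step (q' := fun t => 3 * w ^ 2 + w ^ 3 * (3 * t ^ 2)) fun t => by
      simpa using ((hasDerivAt_id t).const_mul (3 * w ^ 2)).fun_add
        ((hasDerivAt_pow 3 t).const_mul (w ^ 3))]
  constructor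
  · rw [iteratedDeriv_succ, iteratedDeriv_one, e1, e2]
    simp
  · rw [iteratedDeriv_succ, iteratedDeriv_succ, iteratedDeriv_succ, iteratedDeriv_one, e1, e2, e3,
      e4]
    simp

theorem integral_sq_gaussianReal (w : ℝ≥0) : ∫ x, x ^ 2 ∂gaussianReal 0 w = w := by
  have h := iteratedDeriv_mgf_zero (X := id) (μ := gaussianReal 0 w) (by
    rw [integrableExpSet_id_gaussianReal]; simp) 2
  have e : mgf id (gaussianReal 0 w) = fun t : ℝ => Real.exp (w * t ^ 2 / 2) := by
    rw [mgf_id_gaussianReal]; simp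
  rw [e, (iteratedDeriv_exp_sq_zero w).1] at h
  exact h.symm

theorem integral_pow_four_gaussianReal (w : ℝ≥0) :
    ∫ x, x ^ 4 ∂gaussianReal 0 w = 3 * (w : ℝ) ^ 2 := by
  have h := iteratedDeriv_mgf_zero (X := id) (μ := gaussianReal 0 w) (by
    rw [integrableExpSet_id_gaussianReal]; simp) 4
  have e : mgf id (gaussianReal 0 w) = fun t : ℝ => Real.exp (w * t ^ 2 / 2) := by
    rw [mgf_id_gaussianReal]; simp
  rw [e, (iteratedDeriv_exp_sq_zero w).2] at h
  exact h.symm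

/-- Equivalently -log(1 - s) ≤ s + s². For s ≥ 0 the quadratic lower bound of exp is used, for s ≤ 0
the linear one. -/
theorem one_le_one_sub_mul_exp {s : ℝ} (h1 : s ≤ 1 / 2) :
    1 ≤ (1 - s) * Real.exp (s + s ^ 2) := by
  rcases le_total 0 s with h0 | h0
  · have h := Real.quadratic_le_exp_of_nonneg (x := s + s ^ 2) (by positivity)
    have h2 : (1 - s) * (1 + (s + s ^ 2) + (s + s ^ 2) ^ 2 / 2) ≤
        (1 - s) * Real.exp (s + s ^ 2) := mul_le_mul_of_nonneg_left h (by linarith)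
    refine le_trans ?_ h2
    have h3 : s ≤ (1 - s) * (1 + s) ^ 2 / 2 := by nlinarith [mul_nonneg h0 (by linarith : 0 ≤ 1 / 2 - s)]
    nlinarith [mul_le_mul_of_nonneg_left h3 (sq_nonneg s)]
  · have h := Real.add_one_le_exp (s + s ^ 2)
    have h2 : (1 - s) * (s + s ^ 2 + 1) ≤ (1 - s) * Real.exp (s + s ^ 2) :=
      mul_le_mul_of_nonneg_left h (by linarith)
    refine le_trans ?_ h2
    nlinarith [mul_nonneg (sq_nonneg s) (by linarith : 0 ≤ -s)]

theorem integral_exp_mul_sq_gaussianReal {w : ℝ≥0} (hw : w ≠ 0) {t : ℝ} (ht : 2 * t * w < 1) :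
    ∫ x, Real.exp (t * x ^ 2) ∂gaussianReal 0 w = (√(1 - 2 * t * w))⁻¹ := by
  have hw' : (0 : ℝ) < w := by exact_mod_cast hw.bot_lt
  rw [integral_gaussianReal_eq_integral_smul hw]
  have h1 : ∀ x : ℝ, gaussianPDFReal 0 w x • Real.exp (t * x ^ 2) =
      (√(2 * Real.pi * w))⁻¹ * Real.exp (-(1 / (2 * w) - t) * x ^ 2) := fun x => by
    rw [gaussianPDFReal, smul_eq_mul, mul_assoc, ← Real.exp_add]
    congr 2
    field_simp
    ring
  simp_rw [h1]
  rw [integral_const_mul, integral_gaussian, ← Real.sqrt_inv, ← Real.sqrt_inv,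
    ← Real.sqrt_mul (by positivity)]
  congr 1
  have : (1 : ℝ) - 2 * t * w ≠ 0 := by linarith
  have h2 : 1 / (2 * (w : ℝ)) - t = (1 - 2 * t * w) / (2 * w) := by field_simp
  rw [h2]
  field_simp

/-- The centred square of a normal variable is subexponential. -/
theorem integral_exp_mul_sq_sub_gaussianReal_le {w : ℝ≥0} (hw : w ≠ 0) {t : ℝ}
    (ht : |t| * w ≤ 1 / 4) :
    ∫ x, Real.exp (t * (x ^ 2 - w)) ∂gaussianReal 0 w ≤ Real.exp (2 * w ^ 2 * t ^ 2) := by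
  have hw' : (0 : ℝ) < w := by exact_mod_cast hw.bot_lt
  have hs : 2 * t * w ≤ 1 / 2 := by
    have := mul_le_mul_of_nonneg_right (le_abs_self t) hw'.le
    linarith
  have h1 : ∀ x : ℝ, Real.exp (t * (x ^ 2 - w)) = Real.exp (-(t * w)) * Real.exp (t * x ^ 2) :=
    fun x => by rw [← Real.exp_add]; ring_nf
  simp_rw [h1]
  rw [integral_const_mul, integral_exp_mul_sq_gaussianReal hw (by linarith)]
  have h2 := one_le_one_sub_mul_exp hs
  have h3 : 0 < 1 - 2 * t * w := by linarith
  rw [← div_eq_mul_inv, div_le_iff₀ (Real.sqrt_pos.2 h3)]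
  -- Squaring removes the root; the claim becomes the previous inequality with s = 2tw, where s² =
  -- 4t²w² matches twice the exponent on the right.
  refine le_of_sq_le_sq ?_ (by positivity)
  rw [mul_pow, Real.sq_sqrt h3.le, ← Real.exp_nat_mul, ← Real.exp_nat_mul]
  have h4 : Real.exp ((2 : ℕ) * -(t * w)) * 1 ≤ Real.exp ((2 : ℕ) * -(t * w)) *
      ((1 - 2 * t * w) * Real.exp (2 * t * w + (2 * t * w) ^ 2)) :=
    mul_le_mul_of_nonneg_left h2 (Real.exp_pos _).le
  have h5 : Real.exp ((2 : ℕ) * (2 * (w : ℝ) ^ 2 * t ^ 2)) =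
      Real.exp ((2 : ℕ) * -(t * w)) * Real.exp (2 * t * w + (2 * t * w) ^ 2) := by
    rw [← Real.exp_add]
    congr 1
    push_cast
    ring
  rw [h5]
  linarith

variable {Ω : Type*} [MeasurableSpace Ω] {P : Measure Ω}

/-- Independent real variables with a common Gaussian bound on the moment generating function
near zero. -/
structure SubExpFamily (P : Measure Ω) (η : ℕ → Ω → ℝ) (κ t₀ : ℝ) : Prop where
  indep : iIndepFun η P
  aemeasurable : ∀ j, AEMeasurable (η j) P
  pos : 0 < t₀
  mgf_pos : ∀ j t, |t| ≤ t₀ → 0 < mgf (η j) P t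
  mgf_le : ∀ j t, |t| ≤ t₀ → mgf (η j) P t ≤ Real.exp (κ * t ^ 2)

/-- Chernoff's bound with parameter ±1/√m: the arguments a_j/√m stay within t₀, and the product of
the m generating functions is at most exp(κB²). -/
theorem SubExpFamily.tail [IsProbabilityMeasure P] {η : ℕ → Ω → ℝ} {κ t₀ : ℝ}
    (h : SubExpFamily P η κ t₀) (hκ : 0 ≤ κ) {m : ℕ} (hm : 0 < m) {a : ℕ → ℝ} {B : ℝ}
    (ha : ∀ j < m, |a j| ≤ B) (hB : B ≤ t₀ * √m) (r : ℝ) :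
    P.real {ω | r * √m ≤ |∑ j ∈ Finset.range m, a j * η j ω|} ≤
      2 * Real.exp (κ * B ^ 2) * Real.exp (-r) := by
  have hm' : (0 : ℝ) < √m := Real.sqrt_pos.2 (by exact_mod_cast hm)
  have hmgf : ∀ s : ℝ, |s| = 1 →
      0 < mgf (∑ j ∈ Finset.range m, fun ω => a j * η j ω) P (s / √m) ∧
      mgf (∑ j ∈ Finset.range m, fun ω => a j * η j ω) P (s / √m) ≤ Real.exp (κ * B ^ 2) := by
    intro s hs
    have hind : iIndepFun (fun j ω => a j * η j ω) P :=
      h.indep.comp (fun j y => a j * y) fun j => measurable_const_mul _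
    rw [hind.mgf_sum₀ fun j => (h.aemeasurable j).const_mul _]
    have hbd : ∀ j ∈ Finset.range m, |a j * (s / √m)| ≤ B / √m := fun j hj => by
      rw [abs_mul, abs_div, hs, abs_of_pos hm', mul_one_div]
      exact div_le_div_of_nonneg_right (ha j (Finset.mem_range.1 hj)) hm'.le
    have hbt : ∀ j ∈ Finset.range m, |a j * (s / √m)| ≤ t₀ := fun j hj =>
      (hbd j hj).trans ((div_le_iff₀ hm').2 hB)
    have hmul : ∀ j, mgf (fun ω => a j * η j ω) P (s / √m) = mgf (η j) P (a j * (s / √m)) :=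
      fun j => mgf_const_mul _
    simp_rw [hmul]
    refine ⟨Finset.prod_pos fun j hj => h.mgf_pos j _ (hbt j hj), ?_⟩
    calc ∏ j ∈ Finset.range m, mgf (η j) P (a j * (s / √m))
        ≤ ∏ _j ∈ Finset.range m, Real.exp (κ * (B / √m) ^ 2) := by
          refine Finset.prod_le_prod (fun _ _ => mgf_nonneg) fun j hj => ?_
          refine (h.mgf_le j _ (hbt j hj)).trans (Real.exp_le_exp.2 ?_)
          refine mul_le_mul_of_nonneg_left ?_ hκ
          rw [← sq_abs]
          exact pow_le_pow_left₀ (abs_nonneg _) (hbd j hj) 2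
      _ = Real.exp (κ * B ^ 2) := by
          rw [Finset.prod_const, Finset.card_range, ← Real.exp_nat_mul, div_pow,
            Real.sq_sqrt (Nat.cast_nonneg m)]
          congr 1
          field_simp
  have hint : ∀ s : ℝ, |s| = 1 → Integrable (fun ω => Real.exp (s / √m *
      (∑ j ∈ Finset.range m, fun ω => a j * η j ω) ω)) P := fun s hs => by
    -- `mgf` of a nonintegrable exponential is 0 by convention, so positivity of the generating
    -- function encodes integrability.
    by_contra hn
    exact (hmgf s hs).1.ne' (mgf_undef hn)
  have h1 := measure_ge_le_exp_mul_mgf (μ := P)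
    (X := ∑ j ∈ Finset.range m, fun ω => a j * η j ω) (r * √m) (by positivity) (hint 1 (by simp))
  have h2 := measure_le_le_exp_mul_mgf (μ := P)
    (X := ∑ j ∈ Finset.range m, fun ω => a j * η j ω) (-(r * √m))
    (by rw [neg_div]; exact neg_nonpos.2 (by positivity)) (hint (-1) (by simp))
  have e1 : -(1 / √m) * (r * √m) = -r := by field_simp
  have e2 : -(-1 / √m) * -(r * √m) = -r := by field_simp
  rw [e1] at h1
  rw [e2] at h2
  simp only [Finset.sum_apply] at h1 h2
  have hsub : {ω | r * √m ≤ |∑ j ∈ Finset.range m, a j * η j ω|} ⊆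
      {ω | r * √m ≤ ∑ j ∈ Finset.range m, a j * η j ω} ∪
        {ω | ∑ j ∈ Finset.range m, a j * η j ω ≤ -(r * √m)} := fun ω hω => by
    rcases le_abs.1 (Set.mem_ofPred_eq ▸ hω : r * √m ≤ _) with h | h
    · exact Or.inl h
    · exact Or.inr (by simp only [Set.mem_ofPred_eq]; linarith)
  refine (measureReal_mono hsub).trans ((measureReal_union_le _ _).trans ?_)
  have h3 := mul_le_mul_of_nonneg_left (hmgf 1 (by simp)).2 (Real.exp_pos (-r)).le
  have h4 := mul_le_mul_of_nonneg_left (hmgf (-1) (by simp)).2 (Real.exp_pos (-r)).le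
  linarith

/-- Independent centred normal variables with variances `v j`. -/
structure GaussianNoise (P : Measure Ω) (v : ℕ → ℝ) (Z : ℕ → Ω → ℝ) : Prop where
  indep : iIndepFun Z P
  law : ∀ j, HasLaw (Z j) (gaussianReal 0 (v j).toNNReal) P
  pos : ∀ j, 0 < v j

namespace GaussianNoise

variable {v : ℕ → ℝ} {Z : ℕ → Ω → ℝ}

theorem aemeasurable (h : GaussianNoise P v Z) (j : ℕ) : AEMeasurable (Z j) P :=
  (h.law j).aemeasurable

theorem subExp (h : GaussianNoise P v Z) {B : ℝ} (hv : ∀ j, v j ≤ B) :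
    SubExpFamily P Z (B / 2) 1 := by
  have hm : ∀ j t, mgf (Z j) P t = Real.exp (v j * t ^ 2 / 2) := fun j t => by
    rw [mgf_gaussianReal (h.law j).map_eq, Real.coe_toNNReal _ (h.pos j).le]
    simp
  refine ⟨h.indep, h.aemeasurable, one_pos, fun j t _ => ?_, fun j t _ => ?_⟩
  · rw [hm]; exact Real.exp_pos _
  · rw [hm, Real.exp_le_exp]
    have := mul_le_mul_of_nonneg_right (hv j) (sq_nonneg t)
    linarith

theorem subExp_sq (h : GaussianNoise P v Z) {B : ℝ} (hB : 0 < B) (hv : ∀ j, v j ≤ B) :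
    SubExpFamily P (fun j ω => Z j ω ^ 2 - v j) (2 * B ^ 2) (1 / (4 * B)) := by
  have hmgf : ∀ j t, mgf (fun ω => Z j ω ^ 2 - v j) P t =
      ∫ x, Real.exp (t * (x ^ 2 - (v j).toNNReal)) ∂gaussianReal 0 (v j).toNNReal := fun j t => by
    rw [← (h.law j).integral_comp (by fun_prop), mgf, Real.coe_toNNReal _ (h.pos j).le]
    rfl
  have hne : ∀ j, (v j).toNNReal ≠ 0 := fun j => (Real.toNNReal_pos.2 (h.pos j)).ne'
  have ht : ∀ j t, |t| ≤ 1 / (4 * B) → |t| * ((v j).toNNReal : ℝ) ≤ 1 / 4 := fun j t ht => by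
    rw [Real.coe_toNNReal _ (h.pos j).le]
    calc |t| * v j ≤ 1 / (4 * B) * B :=
          mul_le_mul ht (hv j) (h.pos j).le (by positivity)
      _ = 1 / 4 := by field_simp
  refine ⟨h.indep.comp (fun j y => y ^ 2 - v j) fun j => by fun_prop,
    fun j => ((h.aemeasurable j).pow_const 2).sub_const _, by positivity, fun j t htt => ?_,
    fun j t htt => ?_⟩
  · rw [hmgf]
    have h1 : ∀ x : ℝ, Real.exp (t * (x ^ 2 - (v j).toNNReal)) =
        Real.exp (-(t * (v j).toNNReal)) * Real.exp (t * x ^ 2) := fun x => by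
      rw [← Real.exp_add]; ring_nf
    simp_rw [h1]
    have h2 : 2 * t * ((v j).toNNReal : ℝ) < 1 := by
      have := ht j t htt
      have := mul_le_mul_of_nonneg_right (le_abs_self t) (v j).toNNReal.2
      simp only [NNReal.val_eq_coe] at this
      linarith
    rw [integral_const_mul, integral_exp_mul_sq_gaussianReal (hne j) h2]
    have : 0 < √(1 - 2 * t * ((v j).toNNReal : ℝ)) := Real.sqrt_pos.2 (by linarith)
    positivity
  · rw [hmgf]
    refine (integral_exp_mul_sq_sub_gaussianReal_le (hne j) (ht j t htt)).trans
      (Real.exp_le_exp.2 ?_)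
    rw [Real.coe_toNNReal _ (h.pos j).le]
    have := pow_le_pow_left₀ (h.pos j).le (hv j) 2
    have := mul_le_mul_of_nonneg_right this (sq_nonneg t)
    linarith

theorem integrable_comp (h : GaussianNoise P v Z) (j : ℕ) {f : ℝ → ℝ}
    (hf : Integrable f (gaussianReal 0 (v j).toNNReal)) : Integrable (fun ω => f (Z j ω)) P := by
  rw [← (h.law j).map_eq] at hf
  exact hf.comp_aemeasurable (h.aemeasurable j)

theorem integral_comp (h : GaussianNoise P v Z) (j : ℕ) {f : ℝ → ℝ} (hf : Continuous f) :
    ∫ ω, f (Z j ω) ∂P = ∫ x, f x ∂gaussianReal 0 (v j).toNNReal :=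
  (h.law j).integral_comp hf.aestronglyMeasurable

theorem integrable_pow (h : GaussianNoise P v Z) (j k : ℕ) :
    Integrable (fun ω => Z j ω ^ k) P := by
  refine h.integrable_comp j (f := fun x => x ^ k) ?_
  refine integrable_pow_of_mem_interior_integrableExpSet (X := id) ?_ k
  rw [integrableExpSet_id_gaussianReal]
  simp

theorem integral_eq_zero (h : GaussianNoise P v Z) (j : ℕ) : ∫ ω, Z j ω ∂P = 0 := by
  rw [h.integral_comp j continuous_id']
  exact integral_id_gaussianReal

theorem integral_sq (h : GaussianNoise P v Z) (j : ℕ) : ∫ ω, Z j ω ^ 2 ∂P = v j := by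
  rw [h.integral_comp j (continuous_pow 2), integral_sq_gaussianReal,
    Real.coe_toNNReal _ (h.pos j).le]

theorem integral_pow_four (h : GaussianNoise P v Z) (j : ℕ) :
    ∫ ω, Z j ω ^ 4 ∂P = 3 * v j ^ 2 := by
  rw [h.integral_comp j (continuous_pow 4), integral_pow_four_gaussianReal,
    Real.coe_toNNReal _ (h.pos j).le]

end GaussianNoise

end FayHerriot

/-! ### Exact moments of the leading terms -/

namespace FayHerriot

variable {Ω : Type*} [MeasurableSpace Ω] {P : Measure Ω} {p : ℕ}

/-- Statistics with finite absolute moments of all orders. -/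
structure AllMoments (P : Measure Ω) (f : Ω → ℝ) : Prop where
  aestronglyMeasurable : AEStronglyMeasurable f P
  integrable_abs_pow : ∀ k : ℕ, Integrable (fun ω => |f ω| ^ k) P

namespace AllMoments

variable {f g : Ω → ℝ}

theorem integrable (hf : AllMoments P f) : Integrable f P := by
  have h := hf.integrable_abs_pow 1
  simp only [pow_one] at h
  exact h.mono' hf.aestronglyMeasurable (Eventually.of_forall fun ω => le_rfl)

theorem const [IsFiniteMeasure P] (c : ℝ) : AllMoments P fun _ => c :=
  ⟨aestronglyMeasurable_const, fun _ => integrable_const _⟩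

theorem of_abs_le (hf : AllMoments P f) (hg : AEStronglyMeasurable g P)
    (h : ∀ ω, |g ω| ≤ |f ω|) : AllMoments P g := by
  refine ⟨hg, fun k => (hf.integrable_abs_pow k).mono'
    ((continuous_abs.pow k).comp_aestronglyMeasurable hg) (Eventually.of_forall fun ω => ?_)⟩
  rw [Real.norm_of_nonneg (by positivity)]
  exact pow_le_pow_left₀ (abs_nonneg _) (h ω) k

theorem add (hf : AllMoments P f) (hg : AllMoments P g) : AllMoments P fun ω => f ω + g ω := by
  have hm := hf.aestronglyMeasurable.add hg.aestronglyMeasurable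
  refine ⟨hm, fun k => (((hf.integrable_abs_pow k).add (hg.integrable_abs_pow k)).const_mul
    (2 ^ (k - 1))).mono' ((continuous_abs.pow k).comp_aestronglyMeasurable hm)
    (Eventually.of_forall fun ω => ?_)⟩
  rw [Real.norm_of_nonneg (by positivity)]
  exact (pow_le_pow_left₀ (abs_nonneg _) (abs_add_le _ _) k).trans
    (add_pow_le (abs_nonneg _) (abs_nonneg _) k)

theorem mul (hf : AllMoments P f) (hg : AllMoments P g) : AllMoments P fun ω => f ω * g ω := by
  have hm := hf.aestronglyMeasurable.mul hg.aestronglyMeasurable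
  refine ⟨hm, fun k => ((hf.integrable_abs_pow (2 * k)).add
    (hg.integrable_abs_pow (2 * k))).mono' ((continuous_abs.pow k).comp_aestronglyMeasurable hm)
    (Eventually.of_forall fun ω => ?_)⟩
  rw [Real.norm_of_nonneg (by positivity), Pi.add_apply, abs_mul, mul_pow, pow_mul', pow_mul']
  nlinarith [sq_nonneg (|f ω| ^ k - |g ω| ^ k), sq_nonneg (|f ω| ^ k), sq_nonneg (|g ω| ^ k)]

theorem const_mul [IsFiniteMeasure P] (c : ℝ) (hf : AllMoments P f) :
    AllMoments P fun ω => c * f ω :=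
  (const c).mul hf

theorem mul_const [IsFiniteMeasure P] (hf : AllMoments P f) (c : ℝ) :
    AllMoments P fun ω => f ω * c :=
  hf.mul (const c)

theorem div_const [IsFiniteMeasure P] (hf : AllMoments P f) (c : ℝ) :
    AllMoments P fun ω => f ω / c := by
  simp_rw [div_eq_mul_inv]
  exact hf.mul_const _

theorem sub [IsFiniteMeasure P] (hf : AllMoments P f) (hg : AllMoments P g) :
    AllMoments P fun ω => f ω - g ω := by
  simpa [sub_eq_add_neg] using hf.add (hg.const_mul (-1))

theorem pow [IsFiniteMeasure P] (hf : AllMoments P f) (n : ℕ) :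
    AllMoments P fun ω => f ω ^ n := by
  induction n with
  | zero => simpa using const (P := P) 1
  | succ n ih => simpa [pow_succ] using ih.mul hf

theorem sum [IsFiniteMeasure P] {ι : Type*} {s : Finset ι} {f : ι → Ω → ℝ}
    (hf : ∀ j ∈ s, AllMoments P (f j)) : AllMoments P fun ω => ∑ j ∈ s, f j ω := by
  classical
  induction s using Finset.induction_on with
  | empty => simpa using const (P := P) 0
  | insert a s ha ih =>
    simp_rw [Finset.sum_insert ha]
    exact (hf a (Finset.mem_insert_self a s)).add
      (ih fun j hj => hf j (Finset.mem_insert_of_mem hj))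

theorem integral_add (hf : AllMoments P f) (hg : AllMoments P g) :
    ∫ ω, (f ω + g ω) ∂P = ∫ ω, f ω ∂P + ∫ ω, g ω ∂P :=
  MeasureTheory.integral_add hf.integrable hg.integrable

theorem integral_sub (hf : AllMoments P f) (hg : AllMoments P g) :
    ∫ ω, (f ω - g ω) ∂P = ∫ ω, f ω ∂P - ∫ ω, g ω ∂P :=
  MeasureTheory.integral_sub hf.integrable hg.integrable

end AllMoments

/-- Pairwise uncorrelated centred variables with variances `σ j`. -/
structure Uncorrelated (P : Measure Ω) (η : ℕ → Ω → ℝ) (σ : ℕ → ℝ) : Prop where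
  moments : ∀ j, AllMoments P (η j)
  integral_eq_zero : ∀ j, ∫ ω, η j ω ∂P = 0
  integral_sq : ∀ j, ∫ ω, η j ω ^ 2 ∂P = σ j
  integral_mul : ∀ j k, j ≠ k → ∫ ω, η j ω * η k ω ∂P = 0

namespace Uncorrelated

variable {η : ℕ → Ω → ℝ} {σ : ℕ → ℝ} [IsFiniteMeasure P]

theorem moments_sum (h : Uncorrelated P η σ) (s : Finset ℕ) (a : ℕ → ℝ) :
    AllMoments P fun ω => ∑ j ∈ s, a j * η j ω :=
  AllMoments.sum fun j _ => (h.moments j).const_mul (a j)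

theorem integral_sum_eq_zero (h : Uncorrelated P η σ) (s : Finset ℕ) (a : ℕ → ℝ) :
    ∫ ω, ∑ j ∈ s, a j * η j ω ∂P = 0 := by
  rw [integral_finsetSum _ fun j _ => ((h.moments j).const_mul (a j)).integrable]
  refine Finset.sum_eq_zero fun j _ => ?_
  rw [integral_const_mul, h.integral_eq_zero, mul_zero]

theorem integral_sum_mul (h : Uncorrelated P η σ) {s : Finset ℕ} (a : ℕ → ℝ) {k : ℕ}
    (hk : k ∈ s) : ∫ ω, (∑ j ∈ s, a j * η j ω) * η k ω ∂P = a k * σ k := by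
  simp_rw [Finset.sum_mul]
  rw [integral_finsetSum _ fun j _ =>
    (((h.moments j).const_mul (a j)).mul (h.moments k)).integrable]
  simp_rw [mul_assoc, integral_const_mul]
  rw [Finset.sum_eq_single k (fun j _ hj => by rw [h.integral_mul j k hj, mul_zero])
    fun hn => absurd hk hn]
  simp_rw [← sq, h.integral_sq]

theorem integral_sum_mul_sum (h : Uncorrelated P η σ) (s : Finset ℕ) (a b : ℕ → ℝ) :
    ∫ ω, (∑ j ∈ s, a j * η j ω) * (∑ j ∈ s, b j * η j ω) ∂P = ∑ j ∈ s, a j * b j * σ j := by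
  simp_rw [Finset.mul_sum (s := s) (f := fun j => b j * η j _)]
  rw [integral_finsetSum _ fun j _ =>
    ((h.moments_sum s a).mul ((h.moments j).const_mul (b j))).integrable]
  refine Finset.sum_congr rfl fun k hk => ?_
  simp_rw [mul_left_comm _ (b k), integral_const_mul]
  rw [h.integral_sum_mul a hk]
  ring

end Uncorrelated

namespace GaussianNoise

variable {v : ℕ → ℝ} {Z : ℕ → Ω → ℝ}

theorem moments (h : GaussianNoise P v Z) (j : ℕ) : AllMoments P (Z j) := by
  refine ⟨(h.aemeasurable j).aestronglyMeasurable, fun k => ?_⟩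
  simp_rw [← abs_pow]
  exact (h.integrable_pow j k).abs

variable [IsProbabilityMeasure P]

/-- A function of one coordinate and a function of other coordinates factorize. -/
theorem integral_mul_eq (h : GaussianNoise P v Z) {i : ℕ} {S : Finset ℕ} (hi : i ∉ S)
    {φ : ℝ → ℝ} (hφ : Measurable φ) {ψ : (S → ℝ) → ℝ} (hψ : Measurable ψ) :
    ∫ ω, φ (Z i ω) * ψ (fun j => Z j ω) ∂P =
      (∫ ω, φ (Z i ω) ∂P) * ∫ ω, ψ (fun j => Z j ω) ∂P := by
  have h1 := h.indep.indepFun_finset₀ {i} S (Finset.disjoint_singleton_left.2 hi) h.aemeasurable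
  have hφ' : Measurable fun y : ({i} : Finset ℕ) → ℝ => φ (y ⟨i, Finset.mem_singleton_self i⟩) :=
    hφ.comp (measurable_pi_apply _)
  have h2 := h1.comp hφ' hψ
  refine h2.integral_mul_eq_mul_integral ?_ ?_
  · exact (hφ.comp_aemeasurable (h.aemeasurable i)).aestronglyMeasurable
  · exact (hψ.comp_aemeasurable
      (aemeasurable_pi_lambda _ fun j => h.aemeasurable j)).aestronglyMeasurable

theorem integral_mul_comp_eq (h : GaussianNoise P v Z) {i j : ℕ} (hij : i ≠ j)
    {φ ψ : ℝ → ℝ} (hφ : Measurable φ) (hψ : Measurable ψ) :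
    ∫ ω, φ (Z i ω) * ψ (Z j ω) ∂P = (∫ ω, φ (Z i ω) ∂P) * ∫ ω, ψ (Z j ω) ∂P :=
  h.integral_mul_eq (S := {j}) (by simpa using hij) hφ
    (ψ := fun y => ψ (y ⟨j, Finset.mem_singleton_self j⟩)) (hψ.comp (measurable_pi_apply (⟨j, Finset.mem_singleton_self j⟩ : ({j} : Finset ℕ))))

theorem uncorrelated (h : GaussianNoise P v Z) : Uncorrelated P Z v :=
  ⟨h.moments, h.integral_eq_zero, h.integral_sq, fun j k hjk => by
    rw [h.integral_mul_comp_eq hjk (φ := fun y => y) (ψ := fun y => y) measurable_id measurable_id,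
      h.integral_eq_zero, zero_mul]⟩

theorem uncorrelated_sq (h : GaussianNoise P v Z) :
    Uncorrelated P (fun j ω => Z j ω ^ 2 - v j) fun j => 2 * v j ^ 2 := by
  have h0 : ∀ j, ∫ ω, (Z j ω ^ 2 - v j) ∂P = 0 := fun j => by
    rw [integral_sub (h.integrable_pow j 2) (integrable_const _), h.integral_sq]
    simp
  refine ⟨fun j => ((h.moments j).pow 2).sub (AllMoments.const _), h0, fun j => ?_,
    fun j k hjk => ?_⟩
  · have e : ∀ ω, (Z j ω ^ 2 - v j) ^ 2 = Z j ω ^ 4 - 2 * v j * Z j ω ^ 2 + v j ^ 2 := fun ω => by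
      ring
    simp_rw [e]
    have i4 := (h.moments j).pow 4
    have i2 := ((h.moments j).pow 2).const_mul (2 * v j)
    rw [(i4.sub i2).integral_add (AllMoments.const _), i4.integral_sub i2, integral_const_mul,
      h.integral_pow_four, h.integral_sq]
    simp
    ring
  · rw [h.integral_mul_comp_eq hjk (φ := fun y => y ^ 2 - v j) (ψ := fun y => y ^ 2 - v k)
      (by fun_prop) (by fun_prop), h0, zero_mul]

end GaussianNoise

section Model

variable {x : ℕ → Fin p → ℝ} {D : ℕ → ℝ} {A : ℝ} {Z : ℕ → Ω → ℝ} {m : ℕ}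

theorem chiSum_eq (D : ℕ → ℝ) (m : ℕ) (A : ℝ) (k : ℕ) (z : ℕ → ℝ) :
    chiSum D m A k z = ∑ j ∈ Finset.range m, (1 / (A + D j) ^ k) * (z j ^ 2 - (A + D j)) :=
  Finset.sum_congr rfl fun j _ => by ring

theorem dotProduct_wls_eq (x : ℕ → Fin p → ℝ) (D : ℕ → ℝ) (m : ℕ) (a : ℝ) (z : ℕ → ℝ)
    (v : Fin p → ℝ) :
    v ⬝ᵥ wls x D m a z =
      ∑ j ∈ Finset.range m, (v ⬝ᵥ ((wGram x D m 1 a)⁻¹ *ᵥ x j) / (a + D j)) * z j := by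
  rw [wls, wSum_eq_sum_smul, Matrix.mulVec_sum, dotProduct_sum]
  refine Finset.sum_congr rfl fun j _ => ?_
  rw [Matrix.mulVec_smul, dotProduct_smul, smul_eq_mul]
  ring

/-- The left side is the variance of v'β̂; the identity is G⁻¹GG⁻¹ = G⁻¹. -/
theorem sum_sq_dotProduct_inv (hs : Spans x m) (h : ∀ j < m, 0 < A + D j) (v : Fin p → ℝ) :
    ∑ j ∈ Finset.range m, (v ⬝ᵥ ((wGram x D m 1 A)⁻¹ *ᵥ x j) / (A + D j)) *
      (v ⬝ᵥ ((wGram x D m 1 A)⁻¹ *ᵥ x j) / (A + D j)) * (A + D j) =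
      v ⬝ᵥ ((wGram x D m 1 A)⁻¹ *ᵥ v) := by
  have h1 := dotProduct_wGram_mulVec x D m 1 A ((wGram x D m 1 A)⁻¹ *ᵥ v)
    ((wGram x D m 1 A)⁻¹ *ᵥ v)
  rw [Matrix.mulVec_mulVec, Matrix.mul_nonsing_inv _ (isUnit_det_wGram hs 1 h),
    Matrix.one_mulVec, dotProduct_comm] at h1
  rw [h1]
  refine Finset.sum_congr rfl fun j hj => ?_
  have := (h j (Finset.mem_range.1 hj)).ne'
  rw [dotProduct_inv_comm x D m 1 A v (x j)]
  field_simp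

theorem moments_chiSum [IsProbabilityMeasure P] (h : GaussianNoise P (fun j => A + D j) Z)
    (m k : ℕ) : AllMoments P fun ω => chiSum D m A k fun j => Z j ω := by
  simp_rw [chiSum_eq]
  exact h.uncorrelated_sq.moments_sum _ _

theorem moments_dotProduct_wls [IsProbabilityMeasure P]
    (h : GaussianNoise P (fun j => A + D j) Z) (v : Fin p → ℝ) (a : ℝ) :
    AllMoments P fun ω => v ⬝ᵥ wls x D m a fun j => Z j ω := by
  simp_rw [dotProduct_wls_eq]
  exact h.uncorrelated.moments_sum _ _

theorem integral_sq_dotProduct_wls [IsProbabilityMeasure P]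
    (h : GaussianNoise P (fun j => A + D j) Z) (hs : Spans x m) (v : Fin p → ℝ) :
    ∫ ω, (v ⬝ᵥ wls x D m A fun j => Z j ω) ^ 2 ∂P = v ⬝ᵥ ((wGram x D m 1 A)⁻¹ *ᵥ v) := by
  simp_rw [dotProduct_wls_eq, sq]
  rw [h.uncorrelated.integral_sum_mul_sum, sum_sq_dotProduct_inv hs fun j _ => h.pos j]

theorem scoreProj_eq (x : ℕ → Fin p → ℝ) (D : ℕ → ℝ) (m : ℕ) (a : ℝ) (z : ℕ → ℝ) :
    scoreProj x D m z a = levSum x D m 2 a / 2 -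
      ∑ j ∈ Finset.range m, (x j ⬝ᵥ wls x D m a z) * z j / (a + D j) ^ 2 +
      (∑ j ∈ Finset.range m, (x j ⬝ᵥ wls x D m a z) ^ 2 / (a + D j) ^ 2) / 2 := by
  rw [scoreProj, wSum_dotProduct, dotProduct_wGram_mulVec]
  simp_rw [← sq]

theorem moments_scoreProj [IsProbabilityMeasure P] (h : GaussianNoise P (fun j => A + D j) Z) :
    AllMoments P fun ω => scoreProj x D m (fun j => Z j ω) A := by
  simp_rw [scoreProj_eq]
  exact ((AllMoments.const _).sub (AllMoments.sum fun j _ =>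
    ((moments_dotProduct_wls h _ _).mul (h.moments j)).div_const _)).add
    ((AllMoments.sum fun j _ => ((moments_dotProduct_wls h _ _).pow 2).div_const _).div_const _)

/-- Both (x_j'β̂)z_j and (x_j'β̂)² have mean x_j'G⁻¹x_j, so the three terms contribute 1/2 - 1 + 1/2
times the leverage sum. This is the unbiasedness of the REML score. -/
theorem integral_scoreProj [IsProbabilityMeasure P] (h : GaussianNoise P (fun j => A + D j) Z)
    (hs : Spans x m) : ∫ ω, scoreProj x D m (fun j => Z j ω) A ∂P = 0 := by
  simp_rw [scoreProj_eq]
  have m1 : ∀ j ∈ Finset.range m, AllMoments P fun ω =>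
      (x j ⬝ᵥ wls x D m A fun j => Z j ω) * Z j ω / (A + D j) ^ 2 := fun j _ =>
    ((moments_dotProduct_wls h _ _).mul (h.moments j)).div_const _
  have m2 : ∀ j ∈ Finset.range m, AllMoments P fun ω =>
      (x j ⬝ᵥ wls x D m A fun j => Z j ω) ^ 2 / (A + D j) ^ 2 := fun j _ =>
    ((moments_dotProduct_wls h _ _).pow 2).div_const _
  rw [((AllMoments.const _).sub (AllMoments.sum m1)).integral_add
    ((AllMoments.sum m2).div_const 2),
    (AllMoments.const _).integral_sub (AllMoments.sum m1), integral_div (2 : ℝ) fun ω =>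
      ∑ j ∈ Finset.range m, (x j ⬝ᵥ wls x D m A fun j => Z j ω) ^ 2 / (A + D j) ^ 2,
    integral_finsetSum _ fun j hj => (m1 j hj).integrable,
    integral_finsetSum _ fun j hj => (m2 j hj).integrable]
  have e1 : ∀ j ∈ Finset.range m,
      ∫ ω, (x j ⬝ᵥ wls x D m A fun j => Z j ω) * Z j ω / (A + D j) ^ 2 ∂P =
        x j ⬝ᵥ ((wGram x D m 1 A)⁻¹ *ᵥ x j) / (A + D j) ^ 2 := fun j hj => by
    have := (h.pos j).ne'
    rw [integral_div]
    simp_rw [dotProduct_wls_eq]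
    rw [h.uncorrelated.integral_sum_mul _ hj, div_mul_cancel₀ _ this]
  have e2 : ∀ j ∈ Finset.range m,
      ∫ ω, (x j ⬝ᵥ wls x D m A fun j => Z j ω) ^ 2 / (A + D j) ^ 2 ∂P =
        x j ⬝ᵥ ((wGram x D m 1 A)⁻¹ *ᵥ x j) / (A + D j) ^ 2 := fun j hj => by
    rw [integral_div, integral_sq_dotProduct_wls h hs]
  rw [Finset.sum_congr rfl e1, Finset.sum_congr rfl e2, levSum]
  simp
  ring

/-- The variance 2v_j² of z_j² - v_j cancels one power of v_j from each of the two weights, hence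
the shift of both exponents. -/
theorem integral_chiSum_mul_chiSum [IsProbabilityMeasure P]
    (h : GaussianNoise P (fun j => A + D j) Z) (k l : ℕ) :
    ∫ ω, chiSum D m A (k + 1) (fun j => Z j ω) * chiSum D m A (l + 1) (fun j => Z j ω) ∂P =
      2 * invSum D m A (k + l) := by
  simp_rw [chiSum_eq]
  rw [h.uncorrelated_sq.integral_sum_mul_sum, invSum, Finset.mul_sum]
  refine Finset.sum_congr rfl fun j _ => ?_
  have : A + D j ≠ 0 := (h.pos j).ne'
  field_simp
  ring

theorem invSum_pos (h : ∀ j, 0 < A + D j) (hm : 0 < m) (k : ℕ) : 0 < invSum D m A k :=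
  Finset.sum_pos (fun j _ => by have := h j; positivity) (Finset.nonempty_range_iff.2 hm.ne')

theorem moments_leadingSum [IsProbabilityMeasure P] (h : GaussianNoise P (fun j => A + D j) Z) :
    AllMoments P fun ω => leadingSum x D A m fun j => Z j ω := by
  have c2 := moments_chiSum h m 2
  exact ((c2.sub (((moments_chiSum h m 3).mul (c2.mul_const _)).const_mul 2)).add
    ((((c2.mul_const _).pow 2).const_mul _).const_mul 2)).add ((moments_scoreProj h).const_mul 2)

/-- The two second-order terms have means -4 Σv_j⁻³/τ and +4 Σv_j⁻³/τ and cancel; χ₂ and the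
regression part of the score are centred. Thus REML has no bias of order 1/m. -/
theorem integral_leadingSum [IsProbabilityMeasure P] (h : GaussianNoise P (fun j => A + D j) Z)
    (hs : Spans x m) (hm : 0 < m) : ∫ ω, leadingSum x D A m (fun j => Z j ω) ∂P = 0 := by
  have c2 := moments_chiSum h m 2
  have c3 := moments_chiSum h m 3
  have hτ := (invSum_pos h.pos hm 2).ne'
  have e2 : ∀ ω, leadingSum x D A m (fun j => Z j ω) =
      chiSum D m A 2 (fun j => Z j ω) -
        2 * (invSum D m A 2)⁻¹ * (chiSum D m A 3 (fun j => Z j ω) *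
          chiSum D m A 2 (fun j => Z j ω)) +
        2 * invSum D m A 3 * (invSum D m A 2)⁻¹ ^ 2 * (chiSum D m A 2 (fun j => Z j ω) *
          chiSum D m A 2 (fun j => Z j ω)) + 2 * scoreProj x D m (fun j => Z j ω) A := fun ω => by
    rw [leadingSum]; ring
  simp_rw [e2]
  have i2 := (c3.mul c2).const_mul (2 * (invSum D m A 2)⁻¹)
  have i3 := (c2.mul c2).const_mul (2 * invSum D m A 3 * (invSum D m A 2)⁻¹ ^ 2)
  have i4 := (moments_scoreProj (x := x) (m := m) h).const_mul 2
  rw [((c2.sub i2).add i3).integral_add i4, (c2.sub i2).integral_add i3, c2.integral_sub i2,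
    integral_const_mul, integral_const_mul, integral_const_mul,
    integral_chiSum_mul_chiSum h 2 1, integral_chiSum_mul_chiSum h 1 1, integral_scoreProj h hs]
  simp_rw [chiSum_eq]
  rw [h.uncorrelated_sq.integral_sum_eq_zero]
  field_simp
  ring

/-- The leading term of the prediction error, apart from the error of the best predictor. -/
noncomputable def errorLeading (x : ℕ → Fin p → ℝ) (D : ℕ → ℝ) (A : ℝ) (m i : ℕ) (z : ℕ → ℝ) : ℝ :=
  shrink D i A * (x i ⬝ᵥ wls x D m A z) + D i * (A + D i)⁻¹ ^ 2 * (invSum D m A 2)⁻¹ *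
    ((∑ j ∈ (Finset.range m).erase i, 1 / (A + D j) ^ 2 * (z j ^ 2 - (A + D j))) * z i)

/-- Without its i-th summand the quadratic sum W is independent of z_i. Splitting x_i'β̂ = r_i z_i +
T with T free of z_i, the cross term vanishes because W and z_i are centred. The square of W z_i has
mean 2v_i(τ - v_i⁻²), which gives g₃ and the correction of order m⁻²; the variance of x_i'β̂ gives
g₂. -/
theorem integral_sq_errorLeading [IsProbabilityMeasure P]
    (h : GaussianNoise P (fun j => A + D j) Z) (hs : Spans x m) {i : ℕ} (hi : i < m) :
    ∫ ω, errorLeading x D A m i (fun j => Z j ω) ^ 2 ∂P =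
      g2 x D m i A + g3 D m i A -
        2 * D i ^ 2 * (A + D i)⁻¹ ^ 5 * (invSum D m A 2)⁻¹ ^ 2 := by
  set S := (Finset.range m).erase i with hS
  have hiS : i ∉ S := Finset.notMem_erase i _
  have hτ := invSum_pos h.pos (Nat.zero_lt_of_lt hi) 2
  set τ := invSum D m A 2 with hτdef
  have hvi : 0 < A + D i := h.pos i
  set r : ℕ → ℝ := fun j => x i ⬝ᵥ ((wGram x D m 1 A)⁻¹ *ᵥ x j) / (A + D j) with hr
  set W : Ω → ℝ := fun ω => ∑ j ∈ S, 1 / (A + D j) ^ 2 * (Z j ω ^ 2 - (A + D j)) with hW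
  set R : Ω → ℝ := fun ω => x i ⬝ᵥ wls x D m A fun j => Z j ω with hR
  set T : Ω → ℝ := fun ω => ∑ j ∈ S, r j * Z j ω with hT
  have mW : AllMoments P W := h.uncorrelated_sq.moments_sum _ _
  have mT : AllMoments P T := h.uncorrelated.moments_sum _ _
  have mR : AllMoments P R := moments_dotProduct_wls h _ _
  have mz := h.moments i
  have hRT : ∀ ω, R ω = r i * Z i ω + T ω := fun ω => by
    rw [hR]
    simp only
    rw [dotProduct_wls_eq, hT, hS, ← Finset.add_sum_erase (Finset.range m) (fun j => r j * Z j ω) (Finset.mem_range.2 hi)]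
  have q1 : ∫ ω, R ω ^ 2 ∂P = x i ⬝ᵥ ((wGram x D m 1 A)⁻¹ *ᵥ x i) :=
    integral_sq_dotProduct_wls h hs _
  have hψ1 : Measurable fun y : S → ℝ => ∑ j : S, 1 / (A + D j) ^ 2 * (y j ^ 2 - (A + D j)) := by
    fun_prop
  have hψ2 : Measurable fun y : S → ℝ => ∑ j : S, r j * y j := by fun_prop
  have hWψ : ∀ ω, W ω = (fun y : S → ℝ => ∑ j : S, 1 / (A + D j) ^ 2 * (y j ^ 2 - (A + D j)))
      fun j => Z j ω := fun ω =>
    (Finset.sum_coe_sort S fun j => 1 / (A + D j) ^ 2 * (Z j ω ^ 2 - (A + D j))).symm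
  have hTψ : ∀ ω, T ω = (fun y : S → ℝ => ∑ j : S, r j * y j) fun j => Z j ω := fun ω =>
    (Finset.sum_coe_sort S fun j => r j * Z j ω).symm
  have q2 : ∫ ω, R ω * (W ω * Z i ω) ∂P = 0 := by
    have e : ∀ ω, R ω * (W ω * Z i ω) = r i * (Z i ω ^ 2 * W ω) + Z i ω * (T ω * W ω) := fun ω => by
      rw [hRT]; ring
    simp_rw [e]
    rw [(((mz.pow 2).mul mW).const_mul _).integral_add (mz.mul (mT.mul mW)), integral_const_mul]
    have e1 : ∫ ω, Z i ω ^ 2 * W ω ∂P = (∫ ω, Z i ω ^ 2 ∂P) * ∫ ω, W ω ∂P := by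
      simp_rw [hWψ]
      exact h.integral_mul_eq hiS (φ := fun y => y ^ 2) (by fun_prop) hψ1
    have e2 : ∫ ω, Z i ω * (T ω * W ω) ∂P = (∫ ω, Z i ω ∂P) * ∫ ω, T ω * W ω ∂P := by
      simp_rw [hWψ, hTψ]
      exact h.integral_mul_eq hiS (φ := fun y => y) measurable_id (hψ2.mul hψ1)
    rw [e1, e2, h.integral_eq_zero, h.uncorrelated_sq.integral_sum_eq_zero]
    ring
  have q3 : ∫ ω, (W ω * Z i ω) ^ 2 ∂P = (A + D i) * (2 * (τ - 1 / (A + D i) ^ 2)) := by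
    have e : ∀ ω, (W ω * Z i ω) ^ 2 = Z i ω ^ 2 * W ω ^ 2 := fun ω => by ring
    simp_rw [e]
    have e1 : ∫ ω, Z i ω ^ 2 * W ω ^ 2 ∂P = (∫ ω, Z i ω ^ 2 ∂P) * ∫ ω, W ω ^ 2 ∂P := by
      simp_rw [hWψ]
      exact h.integral_mul_eq hiS (φ := fun y => y ^ 2) (by fun_prop) (hψ1.pow_const 2)
    rw [e1, h.integral_sq]
    simp_rw [sq (W _)]
    rw [h.uncorrelated_sq.integral_sum_mul_sum, hτdef, invSum,
      ← Finset.add_sum_erase (Finset.range m) (fun j => 1 / (A + D j) ^ 2)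
        (Finset.mem_range.2 hi), add_sub_cancel_left]
    congr 1
    rw [Finset.mul_sum]
    refine Finset.sum_congr rfl fun j _ => ?_
    have : A + D j ≠ 0 := (h.pos j).ne'
    field_simp
  set B := shrink D i A with hB
  set b := D i * (A + D i)⁻¹ ^ 2 * τ⁻¹ with hb
  have e : ∀ ω, errorLeading x D A m i (fun j => Z j ω) ^ 2 =
      B ^ 2 * R ω ^ 2 + 2 * B * b * (R ω * (W ω * Z i ω)) + b ^ 2 * (W ω * Z i ω) ^ 2 := fun ω => by
    rw [errorLeading]
    change (B * R ω + b * (W ω * Z i ω)) ^ 2 = _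
    ring
  simp_rw [e]
  rw [(((mR.pow 2).const_mul _).add ((mR.mul (mW.mul mz)).const_mul _)).integral_add
    (((mW.mul mz).pow 2).const_mul _),
    ((mR.pow 2).const_mul _).integral_add ((mR.mul (mW.mul mz)).const_mul _),
    integral_const_mul, integral_const_mul, integral_const_mul, q1, q2, q3, g2, g3,
    gram_eq_wGram x D m A fun j _ => h.pos j, trace_inv_covV_sq fun j _ => h.pos j, ← invSum,
    ← hτdef, hB, hb, shrink]
  field_simp
  ring

end Model

end FayHerriot

/-! ### Typical paths have overwhelming probability -/

namespace FayHerriot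

variable {Ω : Type*} [MeasurableSpace Ω] {P : Measure Ω} {p : ℕ}

/-- Events whose probability decreases faster than every power of `m`. -/
def Negligible (P : Measure Ω) (S : ℕ → Set Ω) : Prop :=
  ∀ q : ℕ, (fun m => P.real (S m)) =O[atTop] fun m : ℕ => ((m : ℝ) ^ q)⁻¹

theorem sqrt_natCast_eq_scale_pow (m : ℕ) : √(m : ℝ) = scale m ^ 20 := by
  rw [← scale_pow m, show scale m ^ 40 = (scale m ^ 20) ^ 2 by ring,
    Real.sqrt_sq (pow_nonneg (scale_nonneg m) _)]

theorem isBigO_exp_neg_scale (q : ℕ) :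
    (fun m => Real.exp (-scale m)) =O[atTop] fun m : ℕ => ((m : ℝ) ^ q)⁻¹ := by
  have h1 := (Real.tendsto_pow_mul_exp_neg_atTop_nhds_zero (40 * q)).comp tendsto_scale
  refine IsBigO.of_bound 1 ?_
  filter_upwards [h1.eventually_le_const one_pos, eventually_gt_atTop 0] with m hm hm0
  have hm0' : (0 : ℝ) < m := by exact_mod_cast hm0
  simp only [Function.comp] at hm
  rw [pow_mul, scale_pow] at hm
  rw [Real.norm_of_nonneg (Real.exp_pos _).le, Real.norm_of_nonneg (by positivity), one_mul]
  rwa [← one_div, le_div_iff₀ (by positivity), mul_comm]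

namespace Negligible

variable {S T : ℕ → Set Ω}

theorem of_le_exp {C : ℝ} (h : ∀ᶠ m in atTop, P.real (S m) ≤ C * Real.exp (-scale m)) :
    Negligible P S := fun q => by
  refine IsBigO.trans (IsBigO.of_bound C ?_) (isBigO_exp_neg_scale q)
  filter_upwards [h] with m hm
  rwa [Real.norm_of_nonneg measureReal_nonneg, Real.norm_of_nonneg (Real.exp_pos _).le]

variable [IsFiniteMeasure P]

theorem mono (hT : Negligible P T) (h : ∀ᶠ m in atTop, S m ⊆ T m) : Negligible P S := fun q => by
  refine IsBigO.trans (IsBigO.of_bound 1 ?_) (hT q)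
  filter_upwards [h] with m hm
  rw [one_mul, Real.norm_of_nonneg measureReal_nonneg, Real.norm_of_nonneg measureReal_nonneg]
  exact measureReal_mono hm

theorem union (hS : Negligible P S) (hT : Negligible P T) :
    Negligible P fun m => S m ∪ T m := fun q => by
  refine IsBigO.trans (IsBigO.of_bound 1 (Eventually.of_forall fun m => ?_)) ((hS q).add (hT q))
  rw [one_mul, Real.norm_of_nonneg measureReal_nonneg]
  exact (measureReal_union_le _ _).trans (le_abs_self _)

theorem biUnion {ι : Type*} (s : Finset ι) {S : ι → ℕ → Set Ω} (h : ∀ j ∈ s, Negligible P (S j)) :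
    Negligible P fun m => ⋃ j ∈ s, S j m := fun q => by
  refine IsBigO.trans (IsBigO.of_bound 1 (Eventually.of_forall fun m => ?_))
    (IsBigO.sum fun j hj => h j hj q)
  rw [one_mul, Real.norm_of_nonneg measureReal_nonneg]
  simp only [Finset.sum_apply]
  exact (measureReal_biUnion_finset_le _ _).trans (le_abs_self _)

end Negligible

/-- The constant `∑ (k + 1) ρ^k`. -/
noncomputable def geomWeight (ρ : ℝ) : ℝ := ρ / (1 - ρ) ^ 2 + (1 - ρ)⁻¹

theorem hasSum_geomWeight {ρ : ℝ} (h0 : 0 < ρ) (h1 : ρ < 1) :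
    HasSum (fun k : ℕ => ((k : ℝ) + 1) * ρ ^ k) (geomWeight ρ) := by
  have h2 := (hasSum_coe_mul_geometric_of_norm_lt_one (r := ρ)
    (by rwa [Real.norm_of_nonneg h0.le])).add (hasSum_geometric_of_lt_one h0.le h1)
  have e : (fun k : ℕ => ((k : ℝ) + 1) * ρ ^ k) = fun k : ℕ => (k : ℝ) * ρ ^ k + ρ ^ k :=
    funext fun k => by ring
  rw [e]
  exact h2

/-- A bound on `∑ w_j / (b + D_j)` that is uniform in `b ≥ 0`, from bounds on the coefficients of
its expansion in powers of `d₂ / (b + d₂)`. -/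
theorem mul_abs_sum_div_le {D w : ℕ → ℝ} {d₁ d₂ ρ M : ℝ} {m : ℕ} (hd₁ : 0 < d₁)
    (hD : ∀ j, d₁ ≤ D j ∧ D j ≤ d₂) (hρ0 : 0 < ρ) (hρ1 : ρ < 1)
    (hw : ∀ k : ℕ, |∑ j ∈ Finset.range m, w j * ((d₂ - D j) / d₂) ^ k| ≤ (k + 1) * ρ ^ k * M)
    {b : ℝ} (hb : 0 ≤ b) :
    (b + d₂) * |∑ j ∈ Finset.range m, w j / (b + D j)| ≤ geomWeight ρ * M := by
  have hd₂ : 0 < d₂ := hd₁.trans_le ((hD 0).1.trans (hD 0).2)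
  have hbd : 0 < b + d₂ := by linarith
  -- Since (b + D_j)/(b + d₂) = 1 - t(d₂ - D_j)/d₂, the sum is a geometric-type power series in t.
  -- The parameter b enters only through t ∈ [0, 1], so bounds on countably many sums free of b
  -- control all b ≥ 0 at once.
  set t := d₂ / (b + d₂) with ht
  have ht0 : 0 ≤ t := by positivity
  have ht1 : t ≤ 1 := by rw [ht, div_le_one hbd]; linarith
  have hs : ∀ j ∈ Finset.range m, HasSum (fun k : ℕ => t ^ k * (w j * ((d₂ - D j) / d₂) ^ k))
      ((b + d₂) * (w j / (b + D j))) := fun j _ => by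
    have hj := hD j
    have h1 : 0 ≤ t * ((d₂ - D j) / d₂) :=
      mul_nonneg ht0 (div_nonneg (by linarith) hd₂.le)
    have h2 : t * ((d₂ - D j) / d₂) < 1 := by
      rw [ht, div_mul_div_comm, div_lt_one (by positivity)]
      nlinarith
    have h3 := (hasSum_geometric_of_lt_one h1 h2).mul_left (w j)
    have h4 : w j * (1 - t * ((d₂ - D j) / d₂))⁻¹ = (b + d₂) * (w j / (b + D j)) := by
      have h5 : 1 - t * ((d₂ - D j) / d₂) = (b + D j) / (b + d₂) := by
        rw [ht]; field_simp; ring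
      rw [h5, inv_div]
      ring
    rw [h4] at h3
    have e : (fun k : ℕ => t ^ k * (w j * ((d₂ - D j) / d₂) ^ k)) =
        fun k : ℕ => w j * (t * ((d₂ - D j) / d₂)) ^ k := funext fun k => by rw [mul_pow]; ring
    rw [e]
    exact h3
  have h1 := hasSum_sum hs
  rw [← Finset.mul_sum] at h1
  have h2 := tsum_of_norm_bounded ((hasSum_geomWeight hρ0 hρ1).mul_right M)
    (f := fun k : ℕ => ∑ j ∈ Finset.range m, t ^ k * (w j * ((d₂ - D j) / d₂) ^ k)) fun k => by
      rw [← Finset.mul_sum, norm_mul, Real.norm_of_nonneg (pow_nonneg ht0 k), Real.norm_eq_abs]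
      exact (mul_le_of_le_one_left (abs_nonneg _) (pow_le_one₀ ht0 ht1)).trans (hw k)
  rw [h1.tsum_eq, Real.norm_eq_abs, abs_mul, abs_of_pos hbd] at h2
  exact h2

/-- Weighted sums of independent subexponential variables, with geometrically decreasing weights,
are simultaneously of order at most `m^(21/40)`. -/
theorem SubExpFamily.negligible_geometric [IsProbabilityMeasure P] {η : ℕ → Ω → ℝ} {κ t₀ : ℝ}
    (h : SubExpFamily P η κ t₀) (hκ : 0 ≤ κ) {a r : ℕ → ℝ} {B ρ : ℝ} (ha : ∀ j, |a j| ≤ B)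
    (hρ : 0 < ρ) (hr : ∀ j, 0 ≤ r j ∧ r j ≤ ρ) :
    Negligible P fun m => {ω | ∃ k : ℕ, (k + 1) * ρ ^ k * scale m ^ 21 ≤
      |∑ j ∈ Finset.range m, a j * η j ω * r j ^ k|} := by
  refine Negligible.of_le_exp (C := 4 * Real.exp (κ * B ^ 2)) ?_
  have hev : ∀ᶠ m : ℕ in atTop, B ≤ t₀ * √(m : ℝ) :=
    ((Real.tendsto_sqrt_atTop.comp tendsto_natCast_atTop_atTop).const_mul_atTop
      h.pos).eventually_ge_atTop B
  filter_upwards [hev, eventually_gt_atTop 0, tendsto_scale.eventually_ge_atTop 1] with m hB hm hN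
  -- The factor k + 1 in the thresholds makes the tail probabilities decay geometrically in k, so
  -- the union over all k costs only a constant.
  set E : ℕ → Set Ω := fun k => {ω | (((k + 1 : ℕ) : ℝ) * scale m) * √(m : ℝ) ≤
    |∑ j ∈ Finset.range m, a j * (r j / ρ) ^ k * η j ω|} with hE
  have hsub : {ω | ∃ k : ℕ, (k + 1) * ρ ^ k * scale m ^ 21 ≤
      |∑ j ∈ Finset.range m, a j * η j ω * r j ^ k|} ⊆ ⋃ k, E k := by
    rintro ω ⟨k, hk⟩
    refine Set.mem_iUnion.2 ⟨k, ?_⟩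
    have e : ∑ j ∈ Finset.range m, a j * η j ω * r j ^ k =
        ρ ^ k * ∑ j ∈ Finset.range m, a j * (r j / ρ) ^ k * η j ω := by
      rw [Finset.mul_sum]
      refine Finset.sum_congr rfl fun j _ => ?_
      rw [div_pow]
      field_simp
    rw [e, abs_mul, abs_of_pos (pow_pos hρ k)] at hk
    refine le_of_mul_le_mul_left ?_ (pow_pos hρ k)
    refine le_trans (le_of_eq ?_) hk
    rw [sqrt_natCast_eq_scale_pow]
    push_cast
    ring
  have hEk : ∀ k, P.real (E k) ≤
      2 * Real.exp (κ * B ^ 2) * Real.exp (-scale m) * Real.exp (-1) ^ k := fun k => by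
    refine (h.tail hκ hm (a := fun j => a j * (r j / ρ) ^ k) (fun j _ => ?_) hB _).trans ?_
    · have h1 : 0 ≤ r j / ρ := div_nonneg (hr j).1 hρ.le
      have h2 : r j / ρ ≤ 1 := (div_le_one hρ).2 (hr j).2
      rw [abs_mul, abs_of_nonneg (pow_nonneg h1 k)]
      exact (mul_le_of_le_one_right (abs_nonneg _) (pow_le_one₀ h1 h2)).trans (ha j)
    · rw [← Real.exp_nat_mul, mul_assoc _ (Real.exp (-scale m)), ← Real.exp_add]
      refine mul_le_mul_of_nonneg_left (Real.exp_le_exp.2 ?_) (by positivity)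
      push_cast
      nlinarith [(Nat.cast_nonneg k : (0 : ℝ) ≤ k)]
  have he : Real.exp (-1) ≤ 1 / 2 := by
    rw [Real.exp_neg, one_div]
    refine inv_anti₀ two_pos ?_
    have := Real.add_one_le_exp (1 : ℝ)
    linarith
  have hsum := (hasSum_geometric_of_lt_one (Real.exp_pos (-1)).le
    (by linarith : Real.exp (-1) < 1)).mul_left
      (2 * Real.exp (κ * B ^ 2) * Real.exp (-scale m))
  have h1 : P (⋃ k, E k) ≤ ENNReal.ofReal (2 * Real.exp (κ * B ^ 2) * Real.exp (-scale m) *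
      (1 - Real.exp (-1))⁻¹) := by
    refine (measure_iUnion_le E).trans ?_
    rw [← hsum.tsum_eq, ENNReal.ofReal_tsum_of_nonneg (fun k => by positivity) hsum.summable]
    refine ENNReal.tsum_le_tsum fun k => ?_
    rw [← ofReal_measureReal]
    exact ENNReal.ofReal_le_ofReal (hEk k)
  have h0 : 0 ≤ 2 * Real.exp (κ * B ^ 2) * Real.exp (-scale m) := by positivity
  have h2 : (1 - Real.exp (-1))⁻¹ ≤ 2 := by
    rw [inv_le_comm₀ (by linarith) two_pos]
    linarith
  have h3 : 0 ≤ (1 - Real.exp (-1))⁻¹ := inv_nonneg.2 (by linarith)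
  calc P.real _ ≤ P.real (⋃ k, E k) := measureReal_mono hsub
    _ ≤ 2 * Real.exp (κ * B ^ 2) * Real.exp (-scale m) * (1 - Real.exp (-1))⁻¹ :=
      ENNReal.toReal_le_of_le_ofReal (mul_nonneg h0 h3) h1
    _ ≤ 2 * Real.exp (κ * B ^ 2) * Real.exp (-scale m) * 2 := mul_le_mul_of_nonneg_left h2 h0
    _ = _ := by ring

theorem SubExpFamily.negligible_sum [IsProbabilityMeasure P] {η : ℕ → Ω → ℝ} {κ t₀ : ℝ}
    (h : SubExpFamily P η κ t₀) (hκ : 0 ≤ κ) {a : ℕ → ℝ} {B : ℝ} (ha : ∀ j, |a j| ≤ B) :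
    Negligible P fun m => {ω | scale m ^ 21 ≤ |∑ j ∈ Finset.range m, a j * η j ω|} := by
  -- With all ratios equal to 0 the weight for k = 0 is 0⁰ = 1, which leaves the plain sum.
  refine (h.negligible_geometric hκ ha one_pos (r := fun _ => 0) fun _ => by simp).mono
    (Eventually.of_forall fun m ω hω => ⟨0, ?_⟩)
  simpa using hω

theorem SubExpFamily.negligible_coord [IsProbabilityMeasure P] {η : ℕ → Ω → ℝ} {κ : ℝ}
    (h : SubExpFamily P η κ 1) (hκ : 0 ≤ κ) (i : ℕ) :
    Negligible P fun m => {ω | scale m ≤ |η i ω|} := by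
  -- After shifting the index by i, a single coordinate is a sum of length one.
  have h' : SubExpFamily P (fun j => η (i + j)) κ 1 :=
    ⟨h.indep.precomp (g := fun j => i + j) (add_right_injective i), fun j => h.aemeasurable _,
      h.pos, fun j => h.mgf_pos _, fun j => h.mgf_le _⟩
  refine Negligible.of_le_exp (C := 2 * Real.exp (κ * 1 ^ 2)) (Eventually.of_forall fun m => ?_)
  have := h'.tail hκ one_pos (a := fun _ => 1) (B := 1) (by simp) (by simp) (scale m)
  simpa using this

/-- A union bound over the finitely many requirements on a good path. Those that are uniform in b
are reduced to the geometric families by `mul_abs_sum_div_le`, whose constant `geomWeight ρ` becomes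
C. -/
theorem negligible_not_goodPath [IsProbabilityMeasure P] {x : ℕ → Fin p → ℝ} {D : ℕ → ℝ}
    {A K d₁ d₂ : ℝ} {Z : ℕ → Ω → ℝ} {n : ℕ} (h : GaussianNoise P (fun j => A + D j) Z)
    (hA : 0 < A) (hb : Bounds x D K d₁ d₂ n) (i : ℕ) :
    ∃ C, 0 ≤ C ∧ Negligible P fun m => {ω | ¬ GoodPath x D A d₂ C i m fun j => Z j ω} := by
  have hd₁ := hb.d₁_pos
  have hd₂ : 0 < d₂ := hd₁.trans_le hb.d₁_le
  have hD : ∀ j, d₁ ≤ D j ∧ D j ≤ d₂ := fun j => ⟨hb.le_D j, hb.D_le j⟩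
  -- The ratios (d₂ - D_j)/d₂ are at most 1 - d₁/d₂; halving the margin keeps ρ positive even when
  -- d₁ = d₂.
  set ρ := 1 - d₁ / (2 * d₂) with hρ
  have hq : d₁ / (2 * d₂) ≤ 1 / 2 := by
    rw [div_le_div_iff₀ (by positivity) two_pos]
    linarith [hb.d₁_le]
  have hq0 : 0 < d₁ / (2 * d₂) := by positivity
  have hρ0 : 0 < ρ := by linarith
  have hρ1 : ρ < 1 := by linarith
  have hr : ∀ j, 0 ≤ (d₂ - D j) / d₂ ∧ (d₂ - D j) / d₂ ≤ ρ := fun j => by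
    refine ⟨div_nonneg (by linarith [hD j]) hd₂.le, ?_⟩
    have : d₁ / (2 * d₂) ≤ D j / d₂ := by
      rw [div_le_div_iff₀ (by positivity) hd₂]
      nlinarith [hD j]
    rw [sub_div, div_self hd₂.ne']
    linarith
  have hvB : ∀ j, A + D j ≤ A + d₂ := fun j => by linarith [hD j]
  have hv : ∀ j, A ≤ A + D j := fun j => by linarith [hD j]
  have hB : 0 < A + d₂ := by linarith
  have s1 := h.subExp hvB
  have s2 := h.subExp_sq hB hvB
  have k1 : 0 ≤ (A + d₂) / 2 := by positivity
  have k2 : 0 ≤ 2 * (A + d₂) ^ 2 := by positivity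
  have hinv : ∀ k j, |1 / (A + D j) ^ k| ≤ 1 / A ^ k := fun k j => by
    have := hv j
    rw [abs_of_nonneg (by have := h.pos j; positivity)]
    gcongr
  have hx : ∀ l j, |x j l| ≤ K := fun l j => (norm_le_pi_norm (x j) l).trans (hb.norm_le j)
  have n1 : Negligible P fun m => {ω | ∃ k : ℕ, (k + 1) * ρ ^ k * scale m ^ 21 ≤
      |∑ j ∈ Finset.range m, 1 / (A + D j) ^ 1 * (Z j ω ^ 2 - (A + D j)) *
        ((d₂ - D j) / d₂) ^ k|} :=
    s2.negligible_geometric k2 (hinv 1) hρ0 hr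
  have n2 : Negligible P fun m => ⋃ l ∈ (Finset.univ : Finset (Fin p)),
      {ω | ∃ k : ℕ, (k + 1) * ρ ^ k * scale m ^ 21 ≤
        |∑ j ∈ Finset.range m, x j l * Z j ω * ((d₂ - D j) / d₂) ^ k|} :=
    Negligible.biUnion _ fun l _ => s1.negligible_geometric k1 (hx l) hρ0 hr
  have n3 : Negligible P fun m => ⋃ k ∈ Finset.range 5,
      {ω | scale m ^ 21 ≤ |∑ j ∈ Finset.range m, 1 / (A + D j) ^ k * (Z j ω ^ 2 - (A + D j))|} :=
    Negligible.biUnion _ fun k _ => s2.negligible_sum k2 (hinv k)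
  have n4 : Negligible P fun m => ⋃ kl ∈ Finset.range 4 ×ˢ (Finset.univ : Finset (Fin p)),
      {ω | scale m ^ 21 ≤ |∑ j ∈ Finset.range m, x j kl.2 * (1 / (A + D j) ^ kl.1) * Z j ω|} :=
    Negligible.biUnion _ fun kl _ => s1.negligible_sum k1 (B := K * (1 / A ^ kl.1)) fun j => by
      rw [abs_mul]
      exact mul_le_mul (hx _ j) (hinv _ j) (abs_nonneg _) hb.K_pos.le
  have n5 := s1.negligible_coord k1 i
  have hC : 0 ≤ geomWeight ρ := by
    have : 0 < 1 - ρ := by linarith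
    rw [geomWeight]
    positivity
  refine ⟨geomWeight ρ, hC,
    ((((n1.union n2).union n3).union n4).union n5).mono (Eventually.of_forall fun m ω hω => ?_)⟩
  by_contra hn
  simp only [Set.mem_union, Set.mem_iUnion, Set.mem_ofPred_eq, not_or, not_exists, not_le,
    Finset.mem_univ, Finset.mem_range, Finset.mem_product, true_and, and_true, Prod.forall,
    exists_prop, not_and] at hn hω
  obtain ⟨⟨⟨⟨e1, e2⟩, e3⟩, e4⟩, e5⟩ := hn
  have hN : 0 ≤ scale m := scale_nonneg m
  refine hω ⟨fun b hb0 => ?_, fun b hb0 => ?_, fun k hk => ?_, fun k hk => ?_, e5.le⟩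
  · refine mul_abs_sum_div_le (w := fun j => (Z j ω ^ 2 - (A + D j)) / (A + D j)) hd₁ hD hρ0 hρ1
      (fun k => ?_) hb0
    refine le_trans (le_of_eq ?_) (e1 k).le
    congr 1
    refine Finset.sum_congr rfl fun j _ => ?_
    ring
  · have hbd : 0 < b + d₂ := by linarith
    rw [mul_comm, ← le_div_iff₀ hbd]
    refine (pi_norm_le_iff_of_nonneg (by positivity)).2 fun l => ?_
    rw [le_div_iff₀ hbd, mul_comm, Real.norm_eq_abs]
    have := mul_abs_sum_div_le (w := fun j => x j l * Z j ω) hd₁ hD hρ0 hρ1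
      (fun k => (e2 l k).le) hb0
    simpa [wSum] using this
  · rw [chiSum_eq]
    exact (e3 k (by omega)).le
  · refine (pi_norm_le_iff_of_nonneg (by positivity)).2 fun l => ?_
    rw [Real.norm_eq_abs, wSum]
    refine le_trans (le_of_eq ?_) (e4 k l (by omega)).le
    congr 1
    refine Finset.sum_congr rfl fun j _ => ?_
    ring

end FayHerriot

/-! ### From pathwise estimates to expectations -/

namespace FayHerriot

variable {Ω : Type*} [MeasurableSpace Ω] {P : Measure Ω} {p : ℕ}

/-- Sequences of statistics whose absolute moments grow at most polynomially in `m`. -/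
structure PolyMoments (P : Measure Ω) (f : ℕ → Ω → ℝ) : Prop where
  moments : ∀ᶠ m in atTop, AllMoments P (f m)
  bound : ∀ k : ℕ, ∃ r : ℕ, (fun m => ∫ ω, |f m ω| ^ k ∂P) =O[atTop] fun m : ℕ => (m : ℝ) ^ r

theorem isBigO_natCast_pow {r s : ℕ} (h : r ≤ s) :
    (fun m : ℕ => (m : ℝ) ^ r) =O[atTop] fun m : ℕ => (m : ℝ) ^ s := by
  refine IsBigO.of_bound 1 ?_
  filter_upwards [eventually_ge_atTop 1] with m hm
  have : (1 : ℝ) ≤ m := by exact_mod_cast hm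
  rw [one_mul, Real.norm_of_nonneg (by positivity), Real.norm_of_nonneg (by positivity)]
  exact pow_le_pow_right₀ this h

namespace PolyMoments

variable {f g : ℕ → Ω → ℝ}

theorem of_abs_le (hf : PolyMoments P f) (hg : ∀ᶠ m in atTop, AEStronglyMeasurable (g m) P)
    (h : ∀ᶠ m in atTop, ∀ ω, |g m ω| ≤ |f m ω|) : PolyMoments P g := by
  refine ⟨?_, fun k => ?_⟩
  · filter_upwards [hf.moments, hg, h] with m h1 h2 h3
    exact h1.of_abs_le h2 h3
  · obtain ⟨r, hr⟩ := hf.bound k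
    refine ⟨r, IsBigO.trans (IsBigO.of_bound 1 ?_) hr⟩
    filter_upwards [hf.moments, hg, h] with m h1 h2 h3
    rw [one_mul, Real.norm_of_nonneg (integral_nonneg fun ω => by positivity),
      Real.norm_of_nonneg (integral_nonneg fun ω => by positivity)]
    exact integral_mono ((h1.of_abs_le h2 h3).integrable_abs_pow k) (h1.integrable_abs_pow k)
      fun ω => pow_le_pow_left₀ (abs_nonneg _) (h3 ω) k

theorem congr (hf : PolyMoments P f) (h : ∀ᶠ m in atTop, ∀ ω, f m ω = g m ω) :
    PolyMoments P g := by
  have h' : ∀ᶠ m in atTop, f m = g m := h.mono fun m hm => funext hm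
  refine hf.of_abs_le ?_ (h.mono fun m hm ω => by rw [hm])
  filter_upwards [hf.moments, h'] with m h1 h2
  rw [← h2]
  exact h1.aestronglyMeasurable

theorem add (hf : PolyMoments P f) (hg : PolyMoments P g) :
    PolyMoments P fun m ω => f m ω + g m ω := by
  refine ⟨?_, fun k => ?_⟩
  · filter_upwards [hf.moments, hg.moments] with m h1 h2
    exact h1.add h2
  · obtain ⟨r, hr⟩ := hf.bound k
    obtain ⟨s, hs⟩ := hg.bound k
    refine ⟨max r s, IsBigO.trans (IsBigO.of_bound (2 ^ (k - 1)) ?_)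
      ((hr.trans (isBigO_natCast_pow (le_max_left r s))).add
        (hs.trans (isBigO_natCast_pow (le_max_right r s))))⟩
    filter_upwards [hf.moments, hg.moments] with m h1 h2
    rw [Real.norm_of_nonneg (integral_nonneg fun ω => by positivity),
      ← integral_add (h1.integrable_abs_pow k) (h2.integrable_abs_pow k),
      Real.norm_of_nonneg (integral_nonneg fun ω => by positivity), ← integral_const_mul]
    refine integral_mono ((h1.add h2).integrable_abs_pow k)
      (((h1.integrable_abs_pow k).add (h2.integrable_abs_pow k)).const_mul _) fun ω => ?_
    exact (pow_le_pow_left₀ (abs_nonneg _) (abs_add_le _ _) k).trans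
      (add_pow_le (abs_nonneg _) (abs_nonneg _) k)

theorem mul (hf : PolyMoments P f) (hg : PolyMoments P g) :
    PolyMoments P fun m ω => f m ω * g m ω := by
  refine ⟨?_, fun k => ?_⟩
  · filter_upwards [hf.moments, hg.moments] with m h1 h2
    exact h1.mul h2
  · obtain ⟨r, hr⟩ := hf.bound (2 * k)
    obtain ⟨s, hs⟩ := hg.bound (2 * k)
    refine ⟨max r s, IsBigO.trans (IsBigO.of_bound 1 ?_)
      ((hr.trans (isBigO_natCast_pow (le_max_left r s))).add
        (hs.trans (isBigO_natCast_pow (le_max_right r s))))⟩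
    filter_upwards [hf.moments, hg.moments] with m h1 h2
    rw [Real.norm_of_nonneg (integral_nonneg fun ω => by positivity),
      ← integral_add (h1.integrable_abs_pow _) (h2.integrable_abs_pow _),
      Real.norm_of_nonneg (integral_nonneg fun ω => by positivity), one_mul]
    refine integral_mono ((h1.mul h2).integrable_abs_pow k)
      ((h1.integrable_abs_pow _).add (h2.integrable_abs_pow _)) fun ω => ?_
    simp only
    rw [abs_mul, mul_pow, pow_mul', pow_mul']
    nlinarith [sq_nonneg (|f m ω| ^ k - |g m ω| ^ k), sq_nonneg (|f m ω| ^ k),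
      sq_nonneg (|g m ω| ^ k)]

theorem of_allMoments {f : Ω → ℝ} (hf : AllMoments P f) : PolyMoments P fun _ => f :=
  ⟨Eventually.of_forall fun _ => hf, fun k => ⟨0, by
    simpa using isBigO_const_const (∫ ω, |f ω| ^ k ∂P) (one_ne_zero (α := ℝ)) atTop⟩⟩

variable [IsProbabilityMeasure P]

theorem of_isBigO {a : ℕ → ℝ} {r : ℕ} (ha : a =O[atTop] fun m : ℕ => (m : ℝ) ^ r) :
    PolyMoments P fun m _ => a m := by
  refine ⟨Eventually.of_forall fun m => AllMoments.const _, fun k => ⟨r * k, ?_⟩⟩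
  simp_rw [pow_mul]
  simpa using ha.norm_left.pow k

theorem of_bounded {a : ℕ → ℝ} {C : ℝ} (ha : ∀ᶠ m in atTop, |a m| ≤ C) :
    PolyMoments P fun m _ => a m :=
  of_isBigO (r := 0) (IsBigO.of_bound C (by simpa using ha))

theorem const (c : ℝ) : PolyMoments P fun _ _ => c :=
  of_bounded (Eventually.of_forall fun _ => le_rfl)

theorem const_mul (c : ℝ) (hf : PolyMoments P f) : PolyMoments P fun m ω => c * f m ω :=
  (const c).mul hf

theorem sub (hf : PolyMoments P f) (hg : PolyMoments P g) :
    PolyMoments P fun m ω => f m ω - g m ω := by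
  simpa [sub_eq_add_neg] using hf.add (hg.const_mul (-1))

theorem pow (hf : PolyMoments P f) (n : ℕ) : PolyMoments P fun m ω => f m ω ^ n := by
  induction n with
  | zero => simpa using const (P := P) 1
  | succ n ih => simpa [pow_succ] using ih.mul hf

theorem sum_range {η : ℕ → Ω → ℝ} (hη : ∀ j, AllMoments P (η j))
    (hb : ∀ k : ℕ, ∃ C, ∀ j, ∫ ω, |η j ω| ^ k ∂P ≤ C) :
    PolyMoments P fun m ω => ∑ j ∈ Finset.range m, |η j ω| := by
  have habs : ∀ j, AllMoments P fun ω => |η j ω| := fun j =>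
    (hη j).of_abs_le (continuous_abs.comp_aestronglyMeasurable (hη j).aestronglyMeasurable)
      fun ω => by simp
  have hm : ∀ m, AllMoments P fun ω => ∑ j ∈ Finset.range m, |η j ω| := fun m =>
    AllMoments.sum fun j _ => habs j
  refine ⟨Eventually.of_forall hm, fun k => ?_⟩
  rcases k with _ | k
  · exact ⟨0, by simpa using isBigO_const_const (1 : ℝ) (one_ne_zero (α := ℝ)) atTop⟩
  obtain ⟨C, hC⟩ := hb (k + 1)
  refine ⟨k + 1, IsBigO.of_bound C ?_⟩
  filter_upwards [eventually_gt_atTop 0] with m hm0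
  have hm0' : (0 : ℝ) < m := by exact_mod_cast hm0
  rw [Real.norm_of_nonneg (integral_nonneg fun ω => by positivity),
    Real.norm_of_nonneg (by positivity)]
  calc ∫ ω, |(∑ j ∈ Finset.range m, |η j ω|)| ^ (k + 1) ∂P
      ≤ ∫ ω, (m : ℝ) ^ k * (∑ j ∈ Finset.range m, |η j ω| ^ (k + 1)) ∂P := by
        refine integral_mono ((hm m).integrable_abs_pow _) ((integrable_finsetSum _ fun j _ =>
          (hη j).integrable_abs_pow (k + 1)).const_mul _) fun ω => ?_
        have h1 := pow_sum_div_card_le_sum_pow (s := Finset.range m) (f := fun j => |η j ω|)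
          (fun j _ => abs_nonneg _) k
        rw [Finset.card_range, div_le_iff₀ (by positivity)] at h1
        simp only
        rw [abs_of_nonneg (Finset.sum_nonneg fun j _ => abs_nonneg _)]
        linarith
    _ = (m : ℝ) ^ k * ∑ j ∈ Finset.range m, ∫ ω, |η j ω| ^ (k + 1) ∂P := by
        rw [integral_const_mul, integral_finsetSum _ fun j _ => (hη j).integrable_abs_pow (k + 1)]
    _ ≤ (m : ℝ) ^ k * ∑ _j ∈ Finset.range m, C := by
        gcongr with j
        exact hC j
    _ = C * (m : ℝ) ^ (k + 1) := by
        rw [Finset.sum_const, Finset.card_range, nsmul_eq_mul]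
        ring

/-- Statistics with polynomially growing moments that are `o(1/m)` outside negligible events have
expectation `o(1/m)`. -/
theorem integral_isLittleO (hf : PolyMoments P f) {S : ℕ → Set Ω} (hS : Negligible P S)
    (h : (fun q : ℕ × Ω => f q.1 q.2) =o[comap Prod.fst atTop ⊓ 𝓟 {q | q.2 ∉ S q.1}]
      fun q => (q.1 : ℝ)⁻¹) :
    (fun m => ∫ ω, f m ω ∂P) =o[atTop] fun m : ℕ => (m : ℝ)⁻¹ := by
  obtain ⟨r, hr⟩ := hf.bound 2
  obtain ⟨C₁, hC₁⟩ := hr.bound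
  obtain ⟨C₂, hC₂⟩ := (hS (r + 4)).bound
  refine isLittleO_iff.2 fun ε hε => ?_
  have h1 := isLittleO_iff.1 h (half_pos hε)
  rw [eventually_inf_principal, eventually_comap] at h1
  have h2 : ∀ᶠ m : ℕ in atTop, 2 * (C₁ + C₂) / ε ≤ m :=
    tendsto_natCast_atTop_atTop.eventually_ge_atTop _
  filter_upwards [h1, h2, hC₁, hC₂, hf.moments, eventually_gt_atTop 0] with m h1 h2 hC₁ hC₂ hm hm0
  have hm0' : (0 : ℝ) < m := by exact_mod_cast hm0
  have hA : ∫ ω, |f m ω| ^ 2 ∂P ≤ C₁ * (m : ℝ) ^ r := by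
    rwa [Real.norm_of_nonneg (integral_nonneg fun ω => by positivity),
      Real.norm_of_nonneg (by positivity)] at hC₁
  have hB : P.real (S m) ≤ C₂ * ((m : ℝ) ^ (r + 4))⁻¹ := by
    rwa [Real.norm_of_nonneg measureReal_nonneg, Real.norm_of_nonneg (by positivity)] at hC₂
  -- The exceptional sets need not be measurable; a measurable hull has the same probability.
  set T := toMeasurable P (S m) with hT
  have hTm : MeasurableSet T := measurableSet_toMeasurable _ _
  have hTr : P.real T = P.real (S m) := by rw [measureReal_def, hT, measure_toMeasurable]; rfl
  -- On the exceptional set |f| ≤ f²/M + M with M = m^(r+2). The mean of the first term is O(m⁻²) by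
  -- the second moment bound m^r, and that of the second because the set has probability
  -- O(m^(-r-4)).
  have hpt : ∀ ω, |f m ω| ≤ ε / 2 * (m : ℝ)⁻¹ + ((m : ℝ) ^ (r + 2))⁻¹ * |f m ω| ^ 2 +
      T.indicator (fun _ => (m : ℝ) ^ (r + 2)) ω := fun ω => by
    have hp : (0 : ℝ) < (m : ℝ) ^ (r + 2) := by positivity
    by_cases hω : ω ∈ T
    · rw [Set.indicator_of_mem hω]
      have h4 : |f m ω| ≤ ((m : ℝ) ^ (r + 2))⁻¹ * |f m ω| ^ 2 + (m : ℝ) ^ (r + 2) := by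
        rw [inv_mul_eq_div, ← sub_le_iff_le_add, le_div_iff₀ hp]
        nlinarith [sq_nonneg (|f m ω| - (m : ℝ) ^ (r + 2)), abs_nonneg (f m ω)]
      have : 0 ≤ ε / 2 * (m : ℝ)⁻¹ := by positivity
      linarith
    · rw [Set.indicator_of_notMem hω, add_zero]
      have h4 := h1 (m, ω) rfl fun hn => hω (subset_toMeasurable P (S m) hn)
      simp only at h4
      rw [Real.norm_eq_abs, Real.norm_of_nonneg (by positivity)] at h4
      have : 0 ≤ ((m : ℝ) ^ (r + 2))⁻¹ * |f m ω| ^ 2 := by positivity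
      linarith
  have i2 := (hm.integrable_abs_pow 2).const_mul ((m : ℝ) ^ (r + 2))⁻¹
  have i3 : Integrable (T.indicator fun _ => (m : ℝ) ^ (r + 2)) P :=
    (integrable_const _).indicator hTm
  have i1 : Integrable (fun _ : Ω => ε / 2 * (m : ℝ)⁻¹) P := integrable_const _
  have h3 : |∫ ω, f m ω ∂P| ≤ ε / 2 * (m : ℝ)⁻¹ +
      ((m : ℝ) ^ (r + 2))⁻¹ * ∫ ω, |f m ω| ^ 2 ∂P + P.real (S m) * (m : ℝ) ^ (r + 2) := by
    refine (abs_integral_le_integral_abs).trans ?_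
    refine (integral_mono hm.integrable.abs ((i1.add i2).add i3) hpt).trans_eq ?_
    rw [integral_add' (i1.add i2) i3, integral_add' i1 i2, integral_const,
      integral_const_mul, integral_indicator_const _ hTm, hTr, probReal_univ, one_smul, smul_eq_mul]
  rw [Real.norm_eq_abs, Real.norm_of_nonneg (by positivity)]
  refine h3.trans ?_
  have h5 : ((m : ℝ) ^ (r + 2))⁻¹ * ∫ ω, |f m ω| ^ 2 ∂P ≤ C₁ / (m : ℝ) ^ 2 := by
    calc _ ≤ ((m : ℝ) ^ (r + 2))⁻¹ * (C₁ * (m : ℝ) ^ r) := by gcongr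
      _ = _ := by rw [pow_add]; field_simp
  have h6 : P.real (S m) * (m : ℝ) ^ (r + 2) ≤ C₂ / (m : ℝ) ^ 2 := by
    calc _ ≤ C₂ * ((m : ℝ) ^ (r + 4))⁻¹ * (m : ℝ) ^ (r + 2) := by gcongr
      _ = _ := by rw [pow_add, pow_add]; field_simp
  have h7 : C₁ / (m : ℝ) ^ 2 + C₂ / (m : ℝ) ^ 2 ≤ ε / 2 * (m : ℝ)⁻¹ := by
    rw [div_le_iff₀ hε] at h2
    rw [← add_div, div_le_iff₀ (by positivity)]
    have : ε / 2 * (m : ℝ)⁻¹ * (m : ℝ) ^ 2 = ε / 2 * m := by field_simp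
    rw [this]
    linarith
  linarith

end PolyMoments

namespace GaussianNoise

variable {v : ℕ → ℝ} {Z : ℕ → Ω → ℝ} [IsProbabilityMeasure P]

/-- |z|^k ≤ k! e^|z| ≤ k!(e^z + e^(-z)), and the generating functions at ±1 are bounded uniformly in
j. -/
theorem exists_integral_abs_pow_le (h : GaussianNoise P v Z) {B : ℝ} (hv : ∀ j, v j ≤ B) (k : ℕ) :
    ∃ C, ∀ j, ∫ ω, |Z j ω| ^ k ∂P ≤ C := by
  have s := h.subExp hv
  refine ⟨k.factorial * (Real.exp (B / 2) + Real.exp (B / 2)), fun j => ?_⟩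
  have hm : ∀ t : ℝ, |t| = 1 → Integrable (fun ω => Real.exp (t * Z j ω)) P ∧
      mgf (Z j) P t ≤ Real.exp (B / 2) := fun t ht => by
    refine ⟨?_, ?_⟩
    · by_contra hn
      exact (s.mgf_pos j t ht.le).ne' (mgf_undef hn)
    · have := s.mgf_le j t ht.le
      rwa [← sq_abs, ht, one_pow, mul_one] at this
  obtain ⟨i1, b1⟩ := hm 1 (by simp)
  obtain ⟨i2, b2⟩ := hm (-1) (by simp)
  calc ∫ ω, |Z j ω| ^ k ∂P
      ≤ ∫ ω, (k.factorial : ℝ) * (Real.exp (1 * Z j ω) + Real.exp (-1 * Z j ω)) ∂P := by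
        refine integral_mono ((h.moments j).integrable_abs_pow k) ((i1.add i2).const_mul _)
          fun ω => ?_
        have h1 := Real.pow_div_factorial_le_exp _ (abs_nonneg (Z j ω)) k
        rw [div_le_iff₀ (by positivity)] at h1
        have h2 := Real.exp_abs_le (Z j ω)
        have h3 := mul_le_mul_of_nonneg_left h2 (Nat.cast_nonneg k.factorial : (0 : ℝ) ≤ _)
        simp only [one_mul, neg_one_mul]
        linarith
    _ = k.factorial * (mgf (Z j) P 1 + mgf (Z j) P (-1)) := by
        rw [integral_const_mul, integral_add i1 i2]
        rfl
    _ ≤ _ := by gcongr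

theorem polyMoments_sum_abs (h : GaussianNoise P v Z) {B : ℝ} (hv : ∀ j, v j ≤ B) :
    PolyMoments P fun m ω => ∑ j ∈ Finset.range m, |Z j ω| :=
  PolyMoments.sum_range h.moments (h.exists_integral_abs_pow_le hv)

end GaussianNoise

end FayHerriot

/-! ### Crude bounds valid for all values of the estimator, and measurability -/

namespace FayHerriot

variable {p : ℕ}

/-- The sum `∑ |z_j|`. -/
noncomputable def absSum (m : ℕ) (z : ℕ → ℝ) : ℝ := ∑ j ∈ Finset.range m, |z j|

theorem absSum_nonneg (m : ℕ) (z : ℕ → ℝ) : 0 ≤ absSum m z :=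
  Finset.sum_nonneg fun _ _ => abs_nonneg _

namespace Bounds

variable {x : ℕ → Fin p → ℝ} {D : ℕ → ℝ} {K d₁ d₂ : ℝ} {m : ℕ}

theorem one_le_natCast (h : Bounds x D K d₁ d₂ m) : (1 : ℝ) ≤ m := by exact_mod_cast h.pos

theorem add_div_add_le (h : Bounds x D K d₁ d₂ m) {a : ℝ} (ha : 0 ≤ a) (j : ℕ) :
    (a + d₂) * (a + D j)⁻¹ ≤ d₂ / d₁ := by
  have h1 := h.d₁_pos
  have h2 := h.le_D j
  have h3 := h.D_le j
  rw [← div_eq_mul_inv, div_le_div_iff₀ (h.add_pos ha j) h1]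
  nlinarith [h.d₁_le]

theorem norm_wSum_le (h : Bounds x D K d₁ d₂ m) (n : ℕ) {a : ℝ} (ha : 0 ≤ a) (z : ℕ → ℝ) :
    ‖wSum x D m n a z‖ ≤ K * d₁⁻¹ ^ n * absSum m z := by
  have hK := h.K_pos
  have hd := h.d₁_pos
  rw [wSum_eq_sum_smul, absSum, Finset.mul_sum]
  refine (norm_sum_le _ _).trans (Finset.sum_le_sum fun j _ => ?_)
  have hu := h.inv_pos ha j
  rw [norm_smul, norm_mul, Real.norm_eq_abs, Real.norm_of_nonneg (by positivity)]
  have h2 := h.inv_le ha j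
  have h3 := h.norm_le j
  calc |z j| * (a + D j)⁻¹ ^ n * ‖x j‖ ≤ |z j| * d₁⁻¹ ^ n * K := by gcongr
    _ = _ := by ring

/-- The bound is uniform in a ≥ 0: the growth a + d₂ of the inverse Gram matrix is compensated by
the weights 1/(a + D_j) in the moment vector. -/
theorem norm_wls_le (h : Bounds x D K d₁ d₂ m) {a : ℝ} (ha : 0 ≤ a) (z : ℕ → ℝ) :
    ‖wls x D m a z‖ ≤ p * K ^ 2 * (d₂ / d₁) * absSum m z := by
  have hK := h.K_pos
  have hd := h.d₁_pos
  have hd₂ : 0 < d₂ := hd.trans_le h.d₁_le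
  have hm := h.one_le_natCast
  have hS := absSum_nonneg m z
  have h1 : (a + d₂) * ‖wSum x D m 1 a z‖ ≤ K * (d₂ / d₁) * absSum m z := by
    rw [wSum_eq_sum_smul, absSum, Finset.mul_sum]
    calc (a + d₂) * ‖∑ j ∈ Finset.range m, (z j * (a + D j)⁻¹ ^ 1) • x j‖
        ≤ (a + d₂) * ∑ j ∈ Finset.range m, ‖(z j * (a + D j)⁻¹ ^ 1) • x j‖ := by
          gcongr
          exact norm_sum_le _ _
      _ ≤ ∑ j ∈ Finset.range m, K * (d₂ / d₁) * |z j| := by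
          rw [Finset.mul_sum]
          refine Finset.sum_le_sum fun j _ => ?_
          have hu := h.inv_pos ha j
          have h2 := h.add_div_add_le ha j
          have h3 := h.norm_le j
          rw [norm_smul, norm_mul, Real.norm_eq_abs, pow_one, Real.norm_of_nonneg hu.le]
          calc (a + d₂) * (|z j| * (a + D j)⁻¹ * ‖x j‖)
              = |z j| * ((a + d₂) * (a + D j)⁻¹) * ‖x j‖ := by ring
            _ ≤ |z j| * (d₂ / d₁) * K := by gcongr
            _ = _ := by ring
  refine (h.norm_inv_wGram_mulVec_le ha _).trans ?_
  calc p * K * (a + d₂) / m * ‖wSum x D m 1 a z‖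
      = p * K * ((a + d₂) * ‖wSum x D m 1 a z‖) / m := by ring
    _ ≤ p * K * ((a + d₂) * ‖wSum x D m 1 a z‖) :=
        div_le_self (by positivity) hm
    _ ≤ p * K * (K * (d₂ / d₁) * absSum m z) := by gcongr
    _ = _ := by ring

theorem shrink_mem (h : Bounds x D K d₁ d₂ m) {a : ℝ} (ha : 0 ≤ a) (i : ℕ) :
    0 ≤ shrink D i a ∧ shrink D i a ≤ 1 := by
  have h1 := h.add_pos ha i
  have h2 := h.d₁_pos.trans_le (h.le_D i)
  refine ⟨by rw [shrink]; positivity, ?_⟩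
  rw [shrink, div_le_one h1]
  linarith

theorem abs_correction_le (h : Bounds x D K d₁ d₂ m) {a : ℝ} (ha : 0 ≤ a) (i : ℕ) (z : ℕ → ℝ) :
    |correction x D m i z a| ≤ |z i| + p * K * (p * K ^ 2 * (d₂ / d₁)) * absSum m z := by
  have hs := h.shrink_mem ha i
  have hK := h.K_pos
  rw [correction, abs_mul, abs_of_nonneg hs.1]
  refine (mul_le_of_le_one_left (abs_nonneg _) hs.2).trans ((abs_sub _ _).trans ?_)
  refine add_le_add_right ?_ _
  refine (h.abs_dotProduct_le i _).trans ?_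
  rw [mul_assoc (p * K)]
  gcongr
  exact h.norm_wls_le ha z

theorem abs_scoreProj_le (h : Bounds x D K d₁ d₂ m) {a : ℝ} (ha : 0 ≤ a) (z : ℕ → ℝ) :
    |scoreProj x D m z a| ≤ p / d₁ + p * (K * d₁⁻¹ ^ 2) * (p * K ^ 2 * (d₂ / d₁)) * absSum m z ^ 2 +
      p * (p * K ^ 2 * d₁⁻¹ ^ 2) * (p * K ^ 2 * (d₂ / d₁)) ^ 2 * (m * absSum m z ^ 2) := by
  have hK := h.K_pos
  have hd := h.d₁_pos
  have hp : ∀ j < m, 0 < a + D j := fun j _ => h.add_pos ha j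
  have hS := absSum_nonneg m z
  have hw := h.norm_wls_le ha z
  have t1 : |levSum x D m 2 a / 2| ≤ p / d₁ := by
    rw [abs_of_nonneg (div_nonneg (levSum_two_nonneg h.spans hp) two_pos.le)]
    have h1 := levSum_two_le h.spans (a := a) (by linarith) fun j _ => h.le_D j
    have h2 := levSum_two_nonneg h.spans hp
    have h3 : p / (a + d₁) ≤ p / d₁ := by gcongr; linarith
    linarith
  have t2 : |wSum x D m 2 a z ⬝ᵥ wls x D m a z| ≤
      p * (K * d₁⁻¹ ^ 2) * (p * K ^ 2 * (d₂ / d₁)) * absSum m z ^ 2 := by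
    refine (FayHerriot.abs_dotProduct_le _ _).trans ?_
    calc p * (‖wSum x D m 2 a z‖ * ‖wls x D m a z‖)
        ≤ p * ((K * d₁⁻¹ ^ 2 * absSum m z) * (p * K ^ 2 * (d₂ / d₁) * absSum m z)) := by
          gcongr
          exact h.norm_wSum_le 2 ha z
      _ = _ := by ring
  have t3 : |wls x D m a z ⬝ᵥ (wGram x D m 2 a *ᵥ wls x D m a z) / 2| ≤
      p * (p * K ^ 2 * d₁⁻¹ ^ 2) * (p * K ^ 2 * (d₂ / d₁)) ^ 2 * (m * absSum m z ^ 2) := by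
    rw [abs_div, abs_two]
    refine (div_le_self (abs_nonneg _) one_le_two).trans
      ((FayHerriot.abs_dotProduct_le _ _).trans ?_)
    calc p * (‖wls x D m a z‖ * ‖wGram x D m 2 a *ᵥ wls x D m a z‖)
        ≤ p * (‖wls x D m a z‖ * (p * K ^ 2 * d₁⁻¹ ^ 2 * (m * ‖wls x D m a z‖))) := by
          gcongr
          exact h.norm_wGram_mulVec_le ha 2 _
      _ = p * (p * K ^ 2 * d₁⁻¹ ^ 2) * (m * ‖wls x D m a z‖ ^ 2) := by ring
      _ ≤ p * (p * K ^ 2 * d₁⁻¹ ^ 2) * (m * (p * K ^ 2 * (d₂ / d₁) * absSum m z) ^ 2) := by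
          gcongr
      _ = _ := by ring
  rw [scoreProj]
  refine (abs_add_le _ _).trans (add_le_add ((abs_sub _ _).trans (add_le_add t1 t2)) t3)

theorem abs_chiSum_le (h : Bounds x D K d₁ d₂ m) {a : ℝ} (ha : 0 ≤ a) (k : ℕ) (z : ℕ → ℝ) :
    |chiSum D m a k z| ≤ d₁⁻¹ ^ k * (absSum m z ^ 2 + m * (a + d₂)) := by
  have hd := h.d₁_pos
  have h1 : ∑ j ∈ Finset.range m, z j ^ 2 ≤ absSum m z ^ 2 := by
    simpa [absSum] using
      Finset.sum_sq_le_sq_sum_of_nonneg (s := Finset.range m) (f := fun j => |z j|)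
        fun j _ => abs_nonneg _
  have h2 : ∑ _j ∈ Finset.range m, (a + d₂) = m * (a + d₂) := by
    rw [Finset.sum_const, Finset.card_range, nsmul_eq_mul]
  calc |chiSum D m a k z| ≤ ∑ j ∈ Finset.range m, d₁⁻¹ ^ k * (z j ^ 2 + (a + d₂)) := by
        refine (Finset.abs_sum_le_sum_abs _ _).trans (Finset.sum_le_sum fun j _ => ?_)
        have hu := h.inv_pos ha j
        have hv := h.inv_le ha j
        have hw := h.add_pos ha j
        have hD := h.D_le j
        rw [div_eq_mul_inv, ← inv_pow, abs_mul, abs_of_nonneg (pow_nonneg hu.le k), mul_comm]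
        have : |z j ^ 2 - (a + D j)| ≤ z j ^ 2 + (a + d₂) := by
          rw [abs_le]
          constructor <;> nlinarith [sq_nonneg (z j)]
        gcongr
    _ = d₁⁻¹ ^ k * (∑ j ∈ Finset.range m, z j ^ 2 + m * (a + d₂)) := by
        rw [← Finset.mul_sum, Finset.sum_add_distrib, h2]
    _ ≤ _ := by gcongr

theorem le_invSum (h : Bounds x D K d₁ d₂ m) {a : ℝ} (ha : 0 ≤ a) :
    ((a + d₂) ^ 2)⁻¹ ≤ invSum D m a 2 := by
  have hd₂ : 0 < d₂ := h.d₁_pos.trans_le h.d₁_le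
  refine le_trans ?_ (Finset.single_le_sum (f := fun j => 1 / (a + D j) ^ 2)
    (fun j _ => by have := h.add_pos ha j; positivity) (Finset.mem_range.2 h.pos))
  have := h.add_pos ha 0
  have := h.D_le 0
  rw [← one_div]
  gcongr

theorem abs_g2_le (h : Bounds x D K d₁ d₂ m) {a : ℝ} (ha : 0 ≤ a) (i : ℕ) :
    |g2 x D m i a| ≤ d₂ * (p * K * (p * K * (d₂ / d₁) * K)) := by
  have hK := h.K_pos
  have hd := h.d₁_pos
  have hd₂ : 0 < d₂ := hd.trans_le h.d₁_le
  have hm := h.one_le_natCast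
  have hu := h.inv_pos ha i
  have hDi : 0 < D i := hd.trans_le (h.le_D i)
  have h1 : D i * (a + D i)⁻¹ ≤ 1 := by
    simpa [shrink, div_eq_mul_inv] using (h.shrink_mem ha i).2
  have h2 := h.add_div_add_le ha i
  have h3 := h.norm_inv_wGram_mulVec_le ha (x i)
  have h4 := h.norm_le i
  have h5 : 0 < a + d₂ := by linarith
  rw [h.g2_eq ha, abs_mul, abs_mul, abs_of_nonneg (sq_nonneg _), abs_of_nonneg (by positivity)]
  calc D i ^ 2 * ((a + D i)⁻¹ ^ 2 * |x i ⬝ᵥ ((wGram x D m 1 a)⁻¹ *ᵥ x i)|)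
      ≤ D i ^ 2 * ((a + D i)⁻¹ ^ 2 * (p * K * (p * K * (a + d₂) / m * K))) := by
        gcongr
        refine (h.abs_dotProduct_le i _).trans ?_
        gcongr
        exact h3.trans (by gcongr)
    _ ≤ D i ^ 2 * ((a + D i)⁻¹ ^ 2 * (p * K * (p * K * (a + d₂) / 1 * K))) := by gcongr
    _ = D i * (D i * (a + D i)⁻¹) * (p * K * (p * K * ((a + d₂) * (a + D i)⁻¹) * K)) := by ring
    _ ≤ d₂ * 1 * (p * K * (p * K * (d₂ / d₁) * K)) := by
        gcongr
        exact h.D_le i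
    _ = _ := by ring

/-- The decay (a + D_i)⁻¹ is kept because it has to absorb the linear growth of c in the product c
g₃. -/
theorem abs_g3_le (h : Bounds x D K d₁ d₂ m) {a : ℝ} (ha : 0 ≤ a) (i : ℕ) :
    |g3 D m i a| ≤ 2 * d₂ ^ 2 * (d₂ / d₁) ^ 2 * (a + D i)⁻¹ := by
  have hd := h.d₁_pos
  have hd₂ : 0 < d₂ := hd.trans_le h.d₁_le
  have hu := h.inv_pos ha i
  have hDi : 0 < D i := hd.trans_le (h.le_D i)
  have h2 := h.add_div_add_le ha i
  have h5 : 0 < a + d₂ := by linarith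
  have h3 : (invSum D m a 2)⁻¹ ≤ (a + d₂) ^ 2 := inv_le_of_inv_le₀ (by positivity) (h.le_invSum ha)
  have h4 : 0 < invSum D m a 2 := lt_of_lt_of_le (by positivity) (h.le_invSum ha)
  rw [h.g3_eq ha, abs_of_nonneg (by positivity)]
  calc 2 * D i ^ 2 * ((a + D i)⁻¹ ^ 3 * (invSum D m a 2)⁻¹)
      ≤ 2 * d₂ ^ 2 * ((a + D i)⁻¹ ^ 3 * (a + d₂) ^ 2) := by
        gcongr
        exact h.D_le i
    _ = 2 * d₂ ^ 2 * ((a + d₂) * (a + D i)⁻¹) ^ 2 * (a + D i)⁻¹ := by ring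
    _ ≤ _ := by gcongr

end Bounds

/-- The differential inequality says that (2 - c(a))/(a + d) is nonincreasing, so it is at most its
value at 0. Together with c ≤ 2 this limits |c| to linear growth. -/
theorem two_sub_le_of_deriv_nonneg {c : ℝ → ℝ} {d : ℝ} (hd : 0 < d)
    (hcont : ContinuousOn c (Set.Ici 0)) (hdiff : DifferentiableOn ℝ c (Set.Ioi 0))
    (h : ∀ a, 0 < a → 0 ≤ deriv c a * (a + d) - c a + 2) {a : ℝ} (ha : 0 ≤ a) :
    2 - c a ≤ (a + d) * ((2 - c 0) / d) := by
  have hanti : AntitoneOn (fun a => (2 - c a) / (a + d)) (Set.Ici 0) := by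
    refine antitoneOn_of_deriv_nonpos (convex_Ici 0) ?_ ?_ ?_
    · exact (continuousOn_const.sub hcont).div (by fun_prop) fun a (ha : 0 ≤ a) => by positivity
    · rw [interior_Ici]
      exact ((differentiableOn_const 2).sub hdiff).div (by fun_prop)
        fun a (ha : 0 < a) => by positivity
    · rw [interior_Ici]
      intro a (ha : 0 < a)
      have hc : HasDerivAt c (deriv c a) a := (hdiff.differentiableAt (Ioi_mem_nhds ha)).hasDerivAt
      have h1 : HasDerivAt (fun a => (2 - c a) / (a + d))
          ((-deriv c a * (a + d) - (2 - c a) * 1) / (a + d) ^ 2) a :=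
        (hc.const_sub 2).div ((hasDerivAt_id a).add_const d) (by positivity)
      rw [h1.deriv]
      refine div_nonpos_of_nonpos_of_nonneg ?_ (by positivity)
      linarith [h a ha]
  have h1 := hanti Set.self_mem_Ici (Set.mem_Ici.2 ha) ha
  simp only [zero_add] at h1
  rw [div_le_iff₀ (by linarith)] at h1
  linarith

theorem Coupled.exists_abs_le {D : ℕ → ℝ} {i : ℕ} {L c : ℕ → ℝ → ℝ} (h : Coupled D i L c)
    (hD : 0 < D i) : ∃ M, 0 ≤ M ∧ ∀ᶠ m in atTop, ∀ a, 0 ≤ a → |c m a| ≤ 2 + (a + D i) * M := by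
  obtain ⟨C, hC⟩ := (h.bigO 0 le_rfl).bound
  refine ⟨(2 + |C|) / D i, by positivity, ?_⟩
  filter_upwards [hC, eventually_gt_atTop i] with m hm him a ha
  have h1 := two_sub_le_of_deriv_nonneg hD (h.continuousOn m him) (h.differentiableOn m him)
    (h.deriv_nonneg m him) ha
  have h2 := h.le_two m him a ha
  have h3 : (a + D i) * ((2 - c m 0) / D i) ≤ (a + D i) * ((2 + |C|) / D i) := by
    gcongr
    rw [Real.norm_eq_abs, norm_one, mul_one] at hm
    linarith [neg_abs_le (c m 0), le_abs_self C]
  rw [abs_le]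
  constructor <;> nlinarith [mul_nonneg (by linarith : 0 ≤ a + D i)
    (by positivity : 0 ≤ (2 + |C|) / D i)]

theorem Bounds.abs_mseEst_le {x : ℕ → Fin p → ℝ} {D : ℕ → ℝ} {K d₁ d₂ M : ℝ} {m : ℕ}
    (h : Bounds x D K d₁ d₂ m) (hM : 0 ≤ M) {c : ℝ → ℝ} {a : ℝ} (ha : 0 ≤ a) (i : ℕ)
    (hc : |c a| ≤ 2 + (a + D i) * M) :
    |mseEst x D m i c a| ≤ d₂ + d₂ * (p * K * (p * K * (d₂ / d₁) * K)) +
      (2 * d₁⁻¹ + M) * (2 * d₂ ^ 2 * (d₂ / d₁) ^ 2) := by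
  have hd := h.d₁_pos
  have hd₂ : 0 < d₂ := hd.trans_le h.d₁_le
  have hu := h.inv_pos ha i
  have hv := h.add_pos ha i
  have hDi : 0 < D i := hd.trans_le (h.le_D i)
  have t1 : |g1 D i a| ≤ d₂ := by
    rw [g1, abs_of_nonneg (by positivity), div_le_iff₀ hv]
    nlinarith [h.D_le i]
  have t3 : |c a * g3 D m i a| ≤ (2 * d₁⁻¹ + M) * (2 * d₂ ^ 2 * (d₂ / d₁) ^ 2) := by
    rw [abs_mul]
    calc |c a| * |g3 D m i a|
        ≤ (2 + (a + D i) * M) * (2 * d₂ ^ 2 * (d₂ / d₁) ^ 2 * (a + D i)⁻¹) := by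
          gcongr
          exact h.abs_g3_le ha i
      _ = (2 * (a + D i)⁻¹ + (a + D i) * (a + D i)⁻¹ * M) * (2 * d₂ ^ 2 * (d₂ / d₁) ^ 2) := by ring
      _ ≤ _ := by
          rw [mul_inv_cancel₀ hv.ne', one_mul]
          gcongr
          linarith [h.le_D i]
  rw [mseEst]
  exact (abs_add_le _ _).trans (add_le_add ((abs_add_le _ _).trans
    (add_le_add t1 (h.abs_g2_le ha i))) t3)

section Measurability

variable {Ω : Type*} [MeasurableSpace Ω] {x : ℕ → Fin p → ℝ} {D : ℕ → ℝ} {m : ℕ}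

theorem measurable_comp_of_continuousOn {g : ℝ → ℝ} (hg : ContinuousOn g (Set.Ici 0)) {a : Ω → ℝ}
    (ha : Measurable a) (h0 : ∀ ω, 0 ≤ a ω) : Measurable fun ω => g (a ω) := by
  have h1 : Continuous fun b => g (max b 0) :=
    hg.comp_continuous (by fun_prop) fun b => le_max_right b 0
  have h2 : (fun ω => g (a ω)) = fun ω => g (max (a ω) 0) :=
    funext fun ω => by rw [max_eq_left (h0 ω)]
  rw [h2]
  exact h1.measurable.comp ha

theorem continuousOn_dotProduct_inv_wGram (hs : Spans x m) (hD : ∀ j, 0 < D j)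
    (v w : Fin p → ℝ) :
    ContinuousOn (fun a => v ⬝ᵥ ((wGram x D m 1 a)⁻¹ *ᵥ w)) (Set.Ici 0) := by
  intro a (ha : 0 ≤ a)
  have h1 := continuousAt_inv_wGram hs 1 (a := a) (x := x) (D := D) fun j _ => by
    linarith [hD j]
  have h2 : Continuous fun M : Matrix (Fin p) (Fin p) ℝ => v ⬝ᵥ (M *ᵥ w) := by fun_prop
  exact (ContinuousAt.comp (f := fun b => (wGram x D m 1 b)⁻¹) h2.continuousAt
    h1).continuousWithinAt

theorem continuousOn_inv_add (hD : ∀ j, 0 < D j) (j : ℕ) :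
    ContinuousOn (fun a : ℝ => (a + D j)⁻¹) (Set.Ici 0) :=
  ContinuousOn.inv₀ (by fun_prop) fun a (ha : 0 ≤ a) => by have := hD j; positivity

theorem measurable_correction (hs : Spans x m) (hD : ∀ j, 0 < D j) (i : ℕ) {a : Ω → ℝ}
    (ha : Measurable a) (h0 : ∀ ω, 0 ≤ a ω) {z : Ω → ℕ → ℝ} (hz : Measurable z) :
    Measurable fun ω => correction x D m i (z ω) (a ω) := by
  have hz' : ∀ j, Measurable fun ω => z ω j := fun j => (measurable_pi_apply j).comp hz
  simp_rw [correction, dotProduct_wls_eq, shrink, div_eq_mul_inv]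
  have h1 := fun j => measurable_comp_of_continuousOn (continuousOn_inv_add hD j) ha h0
  have h2 := fun j => measurable_comp_of_continuousOn
    (continuousOn_dotProduct_inv_wGram hs hD (x i) (x j)) ha h0
  exact ((h1 i).const_mul _).mul ((hz' i).sub
    (Finset.measurable_fun_sum _ fun j _ => ((h2 j).mul (h1 j)).mul (hz' j)))

theorem continuousOn_mseEst (hs : Spans x m) (hD : ∀ j, 0 < D j) {i : ℕ} (hi : i < m) {c : ℝ → ℝ}
    (hc : ContinuousOn c (Set.Ici 0)) : ContinuousOn (mseEst x D m i c) (Set.Ici 0) := by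
  have hp : ∀ a : ℝ, 0 ≤ a → ∀ j, 0 < a + D j := fun a ha j => by linarith [hD j]
  have h1 : ContinuousOn (fun a => g1 D i a + D i ^ 2 / (a + D i) ^ 2 *
      (x i ⬝ᵥ ((wGram x D m 1 a)⁻¹ *ᵥ x i)) +
      c a * (2 * D i ^ 2 / ((a + D i) ^ 3 * invSum D m a 2))) (Set.Ici 0) := by
    have hne : ∀ a ∈ Set.Ici (0 : ℝ), ∀ j, a + D j ≠ 0 := fun a ha j => (hp a ha j).ne'
    refine ContinuousOn.add (ContinuousOn.add ?_ (ContinuousOn.mul ?_ ?_)) (hc.mul ?_)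
    · exact ContinuousOn.div (by fun_prop) (by fun_prop) fun a ha => hne a ha i
    · exact ContinuousOn.div (by fun_prop) (by fun_prop) fun a ha => pow_ne_zero _ (hne a ha i)
    · exact continuousOn_dotProduct_inv_wGram hs hD _ _
    · refine ContinuousOn.div (by fun_prop) (ContinuousOn.mul (by fun_prop) ?_) fun a ha =>
        mul_ne_zero (pow_ne_zero _ (hne a ha i))
          (invSum_pos (hp a ha) (Nat.zero_lt_of_lt hi) 2).ne'
      refine continuousOn_finsetSum _ fun j _ => ?_
      exact ContinuousOn.div (by fun_prop) (by fun_prop) fun a ha => pow_ne_zero _ (hne a ha j)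
  refine h1.congr fun a ha => ?_
  rw [mseEst, g2, g3, gram_eq_wGram x D m a fun j _ => hp a ha j,
    trace_inv_covV_sq fun j _ => hp a ha j]
  rfl

end Measurability

end FayHerriot

/-! ### Adjustment factors, and localization of the maximizer -/

namespace FayHerriot

variable {p : ℕ}

/-- What the asymptotic analysis uses of an adjustment factor `F`: it grows at most exponentially
beyond `A`, it is differentiable near `A`, and its logarithmic derivative near `A` is close to the
bounded sequence `κ₀`. -/
structure RegularFactor (A : ℝ) (F : ℕ → ℝ → ℝ) (κ₀ : ℕ → ℝ) : Prop where
  growth : ∃ C, 0 ≤ C ∧ ∀ᶠ m in atTop, ∀ b, 0 ≤ b → 0 ≤ F m b ∧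
    F m b ≤ F m A * Real.exp (C * max (b - A) 0)
  pos : ∀ᶠ m in atTop, ∀ b, 0 < b → 0 < F m b
  differentiableAt : ∀ᶠ m in atTop, ∀ b, 0 < b → DifferentiableAt ℝ (fun s => Real.log (F m s)) b
  deriv_near : ∀ ε > 0, ∃ r > 0, ∀ᶠ m in atTop, ∀ a, |a - A| < r →
    |deriv (fun s => Real.log (F m s)) a - κ₀ m| < ε
  bounded : ∃ M, ∀ᶠ m in atTop, |κ₀ m| ≤ M

namespace RegularFactor

variable {A : ℝ} {F G : ℕ → ℝ → ℝ} {κ₀ κ₁ : ℕ → ℝ}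

theorem one (A : ℝ) : RegularFactor A (fun _ _ => 1) fun _ => 0 where
  growth := ⟨0, le_rfl, Eventually.of_forall fun m b _ => by simp⟩
  pos := Eventually.of_forall fun m b _ => one_pos
  differentiableAt := Eventually.of_forall fun m b _ => by simp
  deriv_near := fun ε hε => ⟨1, one_pos, Eventually.of_forall fun m a _ => by simpa using hε⟩
  bounded := ⟨0, by simp⟩

theorem mul (hA : 0 < A) (hF : RegularFactor A F κ₀) (hG : RegularFactor A G κ₁) :
    RegularFactor A (fun m a => F m a * G m a) fun m => κ₀ m + κ₁ m where
  growth := by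
    obtain ⟨C₁, hC₁, h1⟩ := hF.growth
    obtain ⟨C₂, hC₂, h2⟩ := hG.growth
    refine ⟨C₁ + C₂, by positivity, ?_⟩
    filter_upwards [h1, h2] with m h1 h2 b hb
    refine ⟨mul_nonneg (h1 b hb).1 (h2 b hb).1, ?_⟩
    refine (mul_le_mul (h1 b hb).2 (h2 b hb).2 (h2 b hb).1
      (mul_nonneg (h1 A hA.le).1 (Real.exp_pos _).le)).trans_eq ?_
    rw [add_mul, Real.exp_add]
    ring
  pos := by
    filter_upwards [hF.pos, hG.pos] with m h1 h2 b hb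
    exact mul_pos (h1 b hb) (h2 b hb)
  differentiableAt := by
    filter_upwards [hF.pos, hG.pos, hF.differentiableAt, hG.differentiableAt]
      with m h1 h2 h3 h4 b hb
    refine ((h3 b hb).add (h4 b hb)).congr_of_eventuallyEq ?_
    filter_upwards [Ioi_mem_nhds hb] with s hs
    exact Real.log_mul (h1 s hs).ne' (h2 s hs).ne'
  deriv_near := fun ε hε => by
    obtain ⟨r₁, hr₁, n1⟩ := hF.deriv_near (ε / 2) (half_pos hε)
    obtain ⟨r₂, hr₂, n2⟩ := hG.deriv_near (ε / 2) (half_pos hε)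
    refine ⟨min A (min r₁ r₂), lt_min hA (lt_min hr₁ hr₂), ?_⟩
    filter_upwards [hF.pos, hG.pos, hF.differentiableAt, hG.differentiableAt, n1, n2]
      with m h1 h2 h3 h4 h5 h6 a ha
    have ha0 : 0 < a := by
      have := (abs_lt.1 (ha.trans_le (min_le_left _ _))).1
      linarith
    have h7 : (fun s => Real.log (F m s * G m s)) =ᶠ[𝓝 a]
        (fun s => Real.log (F m s)) + fun s => Real.log (G m s) := by
      filter_upwards [Ioi_mem_nhds ha0] with s hs
      exact Real.log_mul (h1 s hs).ne' (h2 s hs).ne'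
    rw [h7.deriv_eq, deriv_add (h3 a ha0) (h4 a ha0)]
    have h8 := h5 a (ha.trans_le ((min_le_right _ _).trans (min_le_left _ _)))
    have h9 := h6 a (ha.trans_le ((min_le_right _ _).trans (min_le_right _ _)))
    have e : ∀ s t u v : ℝ, s + t - (u + v) = (s - u) + (t - v) := fun _ _ _ _ => by ring
    rw [e]
    exact (abs_add_le _ _).trans_lt (by linarith)
  bounded := by
    obtain ⟨M₁, h1⟩ := hF.bounded
    obtain ⟨M₂, h2⟩ := hG.bounded
    refine ⟨M₁ + M₂, ?_⟩
    filter_upwards [h1, h2] with m h1 h2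
    exact (abs_add_le _ _).trans (add_le_add h1 h2)

end RegularFactor

theorem FactorShape.differentiableAt {L : ℝ → ℝ} (hL : FactorShape L) {a : ℝ} (ha : 0 < a) :
    DifferentiableAt ℝ (fun s => Real.log (L s)) a :=
  (hL.contDiffOn.contDiffAt (Ioi_mem_nhds ha)).differentiableAt (by norm_num)

/-- Up to A the factor is at most its value at A by monotonicity, with b = 0 reached by continuity.
Beyond A concavity puts log L below its tangent at A. -/
theorem FactorShape.le_mul_exp {L : ℝ → ℝ} (hL : FactorShape L) {A C : ℝ} (hA : 0 < A)
    (hC : deriv (fun s => Real.log (L s)) A ≤ C) {b : ℝ} (hb : 0 ≤ b) :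
    L b ≤ L A * Real.exp (C * max (b - A) 0) := by
  have hLA := hL.pos A hA
  have hmono : ∀ s, 0 < s → s ≤ A → L s ≤ L A := fun s hs hsA => by
    have := hL.strictMonoOn.monotoneOn (Set.mem_Ioi.2 hs) (Set.mem_Ioi.2 hA) hsA
    exact (Real.log_le_log_iff (hL.pos s hs) hLA).1 this
  rcases le_total b A with h | h
  · rw [max_eq_right (by linarith), mul_zero, Real.exp_zero, mul_one]
    rcases hb.eq_or_lt with rfl | hb
    · have h1 : Tendsto L (𝓝[>] 0) (𝓝 (L 0)) :=
        (hL.continuousOn 0 Set.self_mem_Ici).mono_left (nhdsWithin_mono _ Set.Ioi_subset_Ici_self)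
      refine le_of_tendsto h1 ?_
      filter_upwards [Ioo_mem_nhdsGT hA] with s hs
      exact hmono s hs.1 hs.2.le
    · exact hmono b hb h
  · have hb : 0 < b := hA.trans_le h
    rw [max_eq_left (by linarith), ← Real.log_le_log_iff (hL.pos b hb) (by positivity),
      Real.log_mul hLA.ne' (Real.exp_pos _).ne', Real.log_exp]
    rcases h.eq_or_lt with rfl | h
    · simp
    · have h1 := hL.concaveOn.slope_le_of_hasDerivAt (Set.mem_Ioi.2 hA) (Set.mem_Ioi.2 hb) h
        (hL.differentiableAt hA).hasDerivAt
      rw [slope_def_field, div_le_iff₀ (by linarith)] at h1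
      have h2 := mul_le_mul_of_nonneg_right hC (by linarith : 0 ≤ b - A)
      linarith

theorem FactorShape.regularFactor {A : ℝ} (hA : 0 < A) {i : ℕ} {L : ℕ → ℝ → ℝ}
    (hL : ∀ m, i < m → FactorShape (L m)) {κ₀ : ℕ → ℝ} (hb : ∃ M, ∀ᶠ m in atTop, |κ₀ m| ≤ M)
    (hn : ∀ ε > 0, ∃ r > 0, ∀ᶠ m in atTop, ∀ a, |a - A| < r →
      |deriv (fun s => Real.log (L m s)) a - κ₀ m| < ε) : RegularFactor A L κ₀ where
  growth := by
    obtain ⟨M, hM⟩ := hb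
    obtain ⟨r, hr, h1⟩ := hn 1 one_pos
    refine ⟨|M| + 1, by positivity, ?_⟩
    filter_upwards [hM, h1, eventually_gt_atTop i] with m hM h1 hm b hb
    refine ⟨?_, (hL m hm).le_mul_exp hA ?_ hb⟩
    · rcases hb.eq_or_lt with rfl | hb
      · exact (hL m hm).nonneg
      · exact ((hL m hm).pos b hb).le
    · have h2 := h1 A (by simpa using hr)
      linarith [(abs_lt.1 h2).2, le_abs_self (κ₀ m), le_abs_self M]
  pos := by
    filter_upwards [eventually_gt_atTop i] with m hm
    exact (hL m hm).pos
  differentiableAt := by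
    filter_upwards [eventually_gt_atTop i] with m hm b hb
    exact (hL m hm).differentiableAt hb
  deriv_near := hn
  bounded := hb

/-- The bound on second derivatives over [A/2, 2A] makes the logarithmic derivatives Lipschitz near
A, uniformly in m. -/
theorem AdjFactor.regularFactor {A : ℝ} (hA : 0 < A) {i : ℕ} {L : ℕ → ℝ → ℝ}
    (hL : AdjFactor i L) :
    RegularFactor A L fun m => deriv (fun s => Real.log (L m s)) A := by
  have hsub : Set.Icc (A / 2) (2 * A) ⊆ Set.Ioi 0 := fun a ha => by
    have := ha.1
    simp only [Set.mem_Ioi]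
    linarith
  obtain ⟨C₁, h1⟩ := hL.bigO 1 (by norm_num) _ isCompact_Icc hsub
  obtain ⟨C₂, h2⟩ := hL.bigO 2 (by norm_num) _ isCompact_Icc hsub
  have hAm : A ∈ Set.Icc (A / 2) (2 * A) := ⟨by linarith, by linarith⟩
  refine FactorShape.regularFactor hA hL.shape ⟨C₁, ?_⟩ fun ε hε => ?_
  · filter_upwards [h1] with m h1
    simpa [iteratedDeriv_one] using h1 A hAm
  · refine ⟨min (A / 2) (ε / (|C₂| + 1)), by positivity, ?_⟩
    filter_upwards [h2, eventually_gt_atTop i] with m h2 hm a ha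
    have ha1 := abs_lt.1 (ha.trans_le (min_le_left _ _))
    have ham : a ∈ Set.Icc (A / 2) (2 * A) := ⟨by linarith, by linarith⟩
    have hd : ∀ s ∈ Set.Icc (A / 2) (2 * A),
        DifferentiableAt ℝ (deriv fun s => Real.log (L m s)) s := fun s hs => by
      have h3 : ContDiffOn ℝ 1 (deriv fun s => Real.log (L m s)) (Set.Ioi 0) :=
        (hL.shape m hm).contDiffOn.deriv_of_isOpen isOpen_Ioi (by norm_num)
      exact (h3.contDiffAt (Ioi_mem_nhds (hsub hs))).differentiableAt (by norm_num)
    have h3 := (convex_Icc (A / 2) (2 * A)).norm_image_sub_le_of_norm_deriv_le hd (C := |C₂|)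
      (fun s hs => by
        have h4 := h2 s hs
        rw [iteratedDeriv_succ, iteratedDeriv_one] at h4
        exact h4.trans (le_abs_self _)) hAm ham
    rw [Real.norm_eq_abs, Real.norm_eq_abs] at h3
    have h4 := ha.trans_le (min_le_right _ _)
    rw [lt_div_iff₀ (by positivity)] at h4
    nlinarith [abs_nonneg (a - A)]

theorem AddFactor.regularFactor {A : ℝ} (hA : 0 < A) {i : ℕ} {L : ℕ → ℝ → ℝ}
    (hL : AddFactor i L) : RegularFactor A L fun _ => 0 := by
  refine FactorShape.regularFactor hA hL.shape ⟨0, by simp⟩ fun ε hε => ?_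
  obtain ⟨t, ht, h1⟩ := Metric.tendstoLocallyUniformlyOn_iff.1 (hL.littleO 1 (by norm_num)) ε hε A
    (Set.mem_Ioi.2 hA)
  rw [nhdsWithin_eq_nhds.2 (Ioi_mem_nhds hA)] at ht
  obtain ⟨r, hr, hrt⟩ := Metric.mem_nhds_iff.1 ht
  refine ⟨r, hr, ?_⟩
  filter_upwards [h1] with m h1 a ha
  have := h1 a (hrt (by simpa [Real.dist_eq] using ha))
  simpa [iteratedDeriv_one, Real.dist_eq, abs_sub_comm] using this

/-- On good paths, a maximizer of the adjusted likelihood is close to `A` and solves the score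
equation. -/
theorem RegularFactor.near_and_score {A : ℝ} (hA : 0 < A) {F : ℕ → ℝ → ℝ} {κ₀ : ℕ → ℝ}
    (hF : RegularFactor A F κ₀) {x : ℕ → Fin p → ℝ} {D : ℕ → ℝ} {K d₁ d₂ C C' lam : ℝ}
    (hb : ∀ᶠ m in atTop, Bounds x D K d₁ d₂ m) (hC : 0 ≤ C) (hC' : 0 ≤ C') (hlam : lam < 1)
    (β : Fin p → ℝ) (i : ℕ) :
    ∀ᶠ m in atTop, ∀ z a, GoodPath x D A d₂ C i m z →
      IsAdjArgmax x D m (F m) (fun j : Fin m => x j ⬝ᵥ β + z j) a → a < C' * (m : ℝ) ^ lam →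
      |a - A| ≤ scale m ^ (-18 : ℤ) ∧ scoreDiag D m z a / 2 + scoreProj x D m z a +
        deriv (fun s => Real.log (F m s)) a = 0 := by
  obtain ⟨n, hn⟩ := hb.exists
  have hd₁ := hn.d₁_pos
  have hd₂ : 0 < d₂ := hd₁.trans_le hn.d₁_le
  have hK := hn.K_pos
  obtain ⟨CF, hCF, hgrowth⟩ := hF.growth
  set c : ℝ := 1 / (4 * ((A + d₂) / d₁ + 1)) with hc
  -- One constant that dominates the coefficients of the noise, of the regression term, and of the
  -- linear gain from the determinant and the factor together.
  set E : ℝ := C + p ^ 2 * K * C ^ 2 / d₁ + (p / (A + d₁) + CF) with hE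
  have hc0 : 0 < c := by positivity
  have e1 : 0 ≤ p ^ 2 * K * C ^ 2 / d₁ := by positivity
  have e2 : 0 ≤ p / (A + d₁) := by positivity
  have hE0 : 0 ≤ E := by positivity
  have hq := eventually_quadratic_neg hA hd₂ hc0 hE0 hC' hlam
  have hsmall : ∀ᶠ m in atTop, scale m ^ (-18 : ℤ) < A :=
    ((tendsto_zpow_atTop_zero (by norm_num)).comp tendsto_scale).eventually_lt_const hA
  filter_upwards [hb, hgrowth, hF.pos, hF.differentiableAt, hq, hsmall,
    tendsto_scale.eventually_ge_atTop 1] with m hb hg hpos hdiff hq hsmall hN z a hz hmax hlt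
  have hp : ∀ b : ℝ, 0 ≤ b → ∀ j < m, 0 < b + D j := fun b hb0 j _ => hb.add_pos hb0 j
  have hN0 : scale m ≠ 0 := by linarith
  have hm := hb.m_pos
  have hres : ∀ b, 0 ≤ b → resLik x D m b (fun j : Fin m => x j ⬝ᵥ β + z j) =
      Real.exp (logLik x D m z b) := fun b hb0 => resLik_eq_exp hb.spans (hp b hb0) β z
  have hnear : |a - A| ≤ scale m ^ (-18 : ℤ) := by
    by_contra hfar
    rw [not_le] at hfar
    have h1 := hq a hmax.1 hlt.le hfar.le
    have h2 := hmax.2 A hA.le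
    rw [hres A hA.le, hres a hmax.1] at h2
    have hFA := hpos A hA
    have h3 : F m A * Real.exp (logLik x D m z A) ≤
        F m A * Real.exp (CF * max (a - A) 0 + logLik x D m z a) := by
      rw [Real.exp_add, ← mul_assoc]
      exact h2.trans (mul_le_mul_of_nonneg_right (hg a hmax.1).2 (Real.exp_pos _).le)
    have h4 := Real.exp_le_exp.1 (le_of_mul_le_mul_left h3 hFA)
    have h5 := hb.logLik_sub_le hA hmax.1 z (hz.quad_unif a hmax.1) (hz.lin_unif a hmax.1)
    set t := |a - A| / (a + d₂) with ht
    have ht0 : 0 ≤ t := by have := hmax.1; positivity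
    set X := max (a - A) 0 with hX
    have hX0 : 0 ≤ X := le_max_right _ _
    have h6 : p ^ 2 * K * (C * scale m ^ 21) ^ 2 / (m * d₁) =
        p ^ 2 * K * C ^ 2 / d₁ * scale m ^ 2 := by
      rw [← scale_pow m]
      field_simp
    rw [h6] at h5
    have h7 : t * (C * scale m ^ 21) ≤ t * (E * scale m ^ 21) := by
      gcongr
      linarith
    have h8 : 0 ≤ t * (C * scale m ^ 21) := by have := scale_nonneg m; positivity
    have h9 : p ^ 2 * K * C ^ 2 / d₁ * scale m ^ 2 ≤ E * scale m ^ 2 := by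
      gcongr
      linarith
    have h10 : 0 ≤ p ^ 2 * K * C ^ 2 / d₁ * scale m ^ 2 := by positivity
    have h11 : (p / (A + d₁) + CF) * X ≤ E * X := by
      gcongr
      linarith
    have h12 : 0 ≤ p / (A + d₁) * X := by positivity
    linarith
  refine ⟨hnear, ?_⟩
  -- Closeness to A keeps the maximizer off the boundary 0, so the first-order condition applies.
  have ha0 : 0 < a := by linarith [(abs_le.1 hnear).1]
  have hlog : ∀ b, 0 < b → Real.log (F m b * resLik x D m b (fun j : Fin m => x j ⬝ᵥ β + z j)) =
      Real.log (F m b) + logLik x D m z b := fun b hb0 => by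
    rw [hres b hb0.le, Real.log_mul (hpos b hb0).ne' (Real.exp_pos _).ne', Real.log_exp]
  have hlocal : IsLocalMax (fun b => Real.log (F m b) + logLik x D m z b) a := by
    filter_upwards [Ioi_mem_nhds ha0] with b hb0
    rw [← hlog b hb0, ← hlog a ha0]
    refine Real.log_le_log (mul_pos (hpos b hb0) ?_) (hmax.2 b (le_of_lt hb0))
    rw [hres b (le_of_lt hb0)]
    exact Real.exp_pos _
  have hder := (hdiff a ha0).hasDerivAt.add (hasDerivAt_logLik hb.spans (hp a ha0.le) z)
  have h1 := hlocal.hasDerivAt_eq_zero hder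
  rw [scoreDiag]
  linarith

end FayHerriot

/-! ### Gaussian structure of the model and the best predictor -/

namespace FayHerriot

variable {Ω : Type*} [MeasurableSpace Ω] {P : Measure Ω}

namespace NormalErrors

variable {A : ℝ} {D : ℕ → ℝ} {u e : ℕ → Ω → ℝ}

theorem hasGaussianLaw (h : NormalErrors P A D u e) {ι : Type*} [Finite ι] {f : ι → ℕ}
    (hf : Function.Injective f) :
    HasGaussianLaw (fun ω (k : ι ⊕ ι) => Sum.elim u e (Sum.map f f k) ω) P := by
  refine iIndepFun.hasGaussianLaw (fun k => ?_)
    (h.indep.precomp (Sum.map_injective.2 ⟨hf, hf⟩))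
  rcases k with j | j
  · exact (h.law_u (f j)).hasGaussianLaw
  · exact (h.law_e (f j)).hasGaussianLaw

theorem memLp_u (h : NormalErrors P A D u e) (j : ℕ) : MemLp (u j) 2 P :=
  (h.law_u j).hasGaussianLaw.memLp_two

theorem memLp_e (h : NormalErrors P A D u e) (j : ℕ) : MemLp (e j) 2 P :=
  (h.law_e j).hasGaussianLaw.memLp_two


theorem indepFun_u_e (h : NormalErrors P A D u e) (j k : ℕ) : IndepFun (u j) (e k) P :=
  h.indep.indepFun (i := Sum.inl j) (j := Sum.inr k) (by simp)

theorem covariance_u_e (h : NormalErrors P A D u e) (j k : ℕ) : cov[u j, e k; P] = 0 :=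
  (h.indepFun_u_e j k).covariance_eq_zero (h.memLp_u j) (h.memLp_e k)

theorem covariance_u_u (h : NormalErrors P A D u e) {j k : ℕ} (hjk : j ≠ k) :
    cov[u j, u k; P] = 0 :=
  (h.indep.indepFun (i := Sum.inl j) (j := Sum.inl k) (by simpa using hjk)).covariance_eq_zero
    (h.memLp_u j) (h.memLp_u k)

theorem covariance_e_e (h : NormalErrors P A D u e) {j k : ℕ} (hjk : j ≠ k) :
    cov[e j, e k; P] = 0 :=
  (h.indep.indepFun (i := Sum.inr j) (j := Sum.inr k) (by simpa using hjk)).covariance_eq_zero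
    (h.memLp_e j) (h.memLp_e k)

theorem covariance_u_self (h : NormalErrors P A D u e) (hA : 0 < A) (j : ℕ) :
    cov[u j, u j; P] = A := by
  rw [covariance_self (h.law_u j).aemeasurable, (h.law_u j).variance_eq]
  simp [hA.le]

theorem covariance_e_self (h : NormalErrors P A D u e) {j : ℕ} (hD : 0 < D j) :
    cov[e j, e j; P] = D j := by
  rw [covariance_self (h.law_e j).aemeasurable, (h.law_e j).variance_eq]
  simp [hD.le]

/-- Used with a = b = 1 for the independence of the residuals, and with the coefficients of
`bestError` for its independence of the data. For jointly Gaussian variables both follow from zero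
covariances. -/
theorem covariance_combination [IsProbabilityMeasure P] (h : NormalErrors P A D u e) (a b : ℝ) (i j : ℕ) :
    cov[fun ω => a * e i ω + b * u i ω, fun ω => u j ω + e j ω; P] =
      a * cov[e i, e j; P] + b * cov[u i, u j; P] := by
  have h1 := (h.memLp_e i).const_mul a
  have h2 := (h.memLp_u i).const_mul b
  change cov[(fun ω => a * e i ω) + fun ω => b * u i ω, u j + e j; P] = _
  rw [covariance_add_left h1 h2 ((h.memLp_u j).add (h.memLp_e j)),
    covariance_add_right h1 (h.memLp_u j) (h.memLp_e j),
    covariance_add_right h2 (h.memLp_u j) (h.memLp_e j),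
    covariance_const_mul_left, covariance_const_mul_left, covariance_const_mul_left,
    covariance_const_mul_left, covariance_comm (e i) (u j), h.covariance_u_e, h.covariance_u_e]
  ring

theorem gaussianNoise [IsProbabilityMeasure P] (h : NormalErrors P A D u e) (hA : 0 < A) (hD : ∀ j, 0 < D j) :
    GaussianNoise P (fun j => A + D j) fun j ω => u j ω + e j ω := by
  refine ⟨iIndepFun_iff_finset.2 fun s => ?_, fun j => ?_, fun j => by linarith [hD j]⟩
  · have h1 := (h.hasGaussianLaw (f := fun j : s => (j : ℕ)) Subtype.val_injective).map_fun
      (ContinuousLinearMap.pi fun j : s =>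
        ContinuousLinearMap.proj (R := ℝ) (φ := fun _ : s ⊕ s => ℝ) (Sum.inl j) +
          ContinuousLinearMap.proj (Sum.inr j))
    refine HasGaussianLaw.iIndepFun_of_covariance_eq_zero h1 fun j k hjk => ?_
    have hjk' : (j : ℕ) ≠ k := fun hn => hjk (Subtype.ext hn)
    have h2 := h.covariance_combination 1 1 j k
    rw [h.covariance_e_e hjk', h.covariance_u_u hjk'] at h2
    simp only [one_mul, mul_zero, add_zero, add_comm (e j _)] at h2
    exact h2
  · refine ⟨(h.law_u j).aemeasurable.add (h.law_e j).aemeasurable, ?_⟩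
    have h1 := gaussianReal_add_gaussianReal_of_indepFun (h.indepFun_u_e j j) (h.law_u j).map_eq
      (h.law_e j).map_eq
    rw [add_zero, ← Real.toNNReal_add hA.le (hD j).le] at h1
    exact h1

/-- The error `θ̂ - θ` of the best predictor. -/
noncomputable def _root_.FayHerriot.bestError (A : ℝ) (D : ℕ → ℝ) (u e : ℕ → Ω → ℝ) (i : ℕ) (ω : Ω) : ℝ :=
  A / (A + D i) * e i ω + -D i / (A + D i) * u i ω

/-- The error of the best predictor is independent of the data. -/
theorem indepFun_bestError [IsProbabilityMeasure P] (h : NormalErrors P A D u e) (hA : 0 < A)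
    (hD : ∀ j, 0 < D j) {i m : ℕ} (hi : i < m) :
    IndepFun (bestError A D u e i) (fun ω (j : Fin m) => u j ω + e j ω) P := by
  have h1 := (h.hasGaussianLaw (f := fun j : Fin m => (j : ℕ)) Fin.val_injective).map_fun
    ((ContinuousLinearMap.pi fun _ : Unit =>
      (A / (A + D i)) • ContinuousLinearMap.proj (R := ℝ) (φ := fun _ : Fin m ⊕ Fin m => ℝ)
        (Sum.inr ⟨i, hi⟩) + (-D i / (A + D i)) • ContinuousLinearMap.proj (Sum.inl ⟨i, hi⟩)).prod
      (ContinuousLinearMap.pi fun j : Fin m =>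
        ContinuousLinearMap.proj (R := ℝ) (φ := fun _ : Fin m ⊕ Fin m => ℝ) (Sum.inl j) +
          ContinuousLinearMap.proj (Sum.inr j)))
  have h2 : IndepFun (fun ω (_ : Unit) => bestError A D u e i ω)
      (fun ω (j : Fin m) => u j ω + e j ω) P := by
    refine HasGaussianLaw.indepFun_of_covariance_eval (X := fun _ : Unit => bestError A D u e i)
      (Y := fun (j : Fin m) ω => u j ω + e j ω) h1 fun _ j => ?_
    refine (h.covariance_combination (A / (A + D i)) (-D i / (A + D i)) i j).trans ?_
    by_cases hij : i = (j : ℕ)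
    -- In the own area the two contributions A D_i/(A + D_i) and -D_i A/(A + D_i) cancel.
    · rw [← hij, h.covariance_e_self (hD i), h.covariance_u_self hA]
      ring
    · rw [h.covariance_e_e hij, h.covariance_u_u hij]
      ring
  exact h2.comp (φ := fun y : Unit → ℝ => y ()) (measurable_pi_apply _) measurable_id

theorem gaussianNoise_u (h : NormalErrors P A D u e) (hA : 0 < A) :
    GaussianNoise P (fun _ => A) u :=
  ⟨h.indep.precomp (g := Sum.inl) Sum.inl_injective, h.law_u, fun _ => hA⟩

theorem gaussianNoise_e (h : NormalErrors P A D u e) (hD : ∀ j, 0 < D j) : GaussianNoise P D e :=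
  ⟨h.indep.precomp (g := Sum.inr) Sum.inr_injective, h.law_e, hD⟩

theorem moments_bestError [IsProbabilityMeasure P] (h : NormalErrors P A D u e) (hA : 0 < A)
    (hD : ∀ j, 0 < D j) (i : ℕ) : AllMoments P (bestError A D u e i) :=
  (((h.gaussianNoise_e hD).moments i).const_mul _).add
    (((h.gaussianNoise_u hA).moments i).const_mul _)

theorem integral_bestError [IsProbabilityMeasure P] (h : NormalErrors P A D u e) (hA : 0 < A)
    (hD : ∀ j, 0 < D j) (i : ℕ) : ∫ ω, bestError A D u e i ω ∂P = 0 := by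
  have he := h.gaussianNoise_e hD
  have hu := h.gaussianNoise_u hA
  simp only [bestError]
  rw [((he.moments i).const_mul _).integral_add ((hu.moments i).const_mul _), integral_const_mul,
    integral_const_mul, he.integral_eq_zero, hu.integral_eq_zero]
  ring

theorem integral_sq_bestError [IsProbabilityMeasure P] (h : NormalErrors P A D u e) (hA : 0 < A)
    (hD : ∀ j, 0 < D j) (i : ℕ) : ∫ ω, bestError A D u e i ω ^ 2 ∂P = g1 D i A := by
  have he := h.gaussianNoise_e hD
  have hu := h.gaussianNoise_u hA
  have me := he.moments i
  have mu := hu.moments i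
  set a := A / (A + D i) with ha
  set b := -D i / (A + D i) with hb
  have e1 : ∀ ω, bestError A D u e i ω ^ 2 =
      a ^ 2 * e i ω ^ 2 + 2 * a * b * (u i ω * e i ω) + b ^ 2 * u i ω ^ 2 := fun ω => by
    rw [bestError]
    ring
  have e2 : ∫ ω, u i ω * e i ω ∂P = 0 := by
    have := (h.indepFun_u_e i i).integral_mul_eq_mul_integral mu.aestronglyMeasurable
      me.aestronglyMeasurable
    rw [he.integral_eq_zero, mul_zero] at this
    exact this
  simp_rw [e1]
  rw [(((me.pow 2).const_mul _).add ((mu.mul me).const_mul _)).integral_add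
    ((mu.pow 2).const_mul _), ((me.pow 2).const_mul _).integral_add ((mu.mul me).const_mul _),
    integral_const_mul, integral_const_mul, integral_const_mul, e2, he.integral_sq, hu.integral_sq,
    g1, ha, hb]
  have := hD i
  field_simp
  ring

end NormalErrors

end FayHerriot

/-! ### The estimator outside negligible events -/

namespace FayHerriot

variable {Ω : Type*} {p : ℕ}

/-- Large `m` and data outside the sets `S m`. -/
def outside (S : ℕ → Set Ω) : Filter (ℕ × Ω) :=
  comap Prod.fst atTop ⊓ 𝓟 {q | q.2 ∉ S q.1}

theorem tendsto_fst_outside (S : ℕ → Set Ω) : Tendsto Prod.fst (outside S) atTop :=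
  tendsto_comap.mono_left inf_le_left

theorem eventually_notMem_outside (S : ℕ → Set Ω) : ∀ᶠ q in outside S, q.2 ∉ S q.1 :=
  mem_inf_of_right (mem_principal_self _)

/-- The residuals `y_j - x_j' β`. -/
def residual (u e : ℕ → Ω → ℝ) (ω : Ω) (j : ℕ) : ℝ := u j ω + e j ω

theorem obsVec_eq (x : ℕ → Fin p → ℝ) (β : Fin p → ℝ) (u e : ℕ → Ω → ℝ) (m : ℕ) (ω : Ω) :
    obsVec x β u e m ω = fun j : Fin m => x j ⬝ᵥ β + residual u e ω j :=
  funext fun j => by simp only [obsVec, obs, areaMean, residual]; ring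

variable {x : ℕ → Fin p → ℝ} {D : ℕ → ℝ} {β : Fin p → ℝ} {A : ℝ} {u e : ℕ → Ω → ℝ}
  {F : ℕ → ℝ → ℝ} {κ₀ : ℕ → ℝ}

/-- Outside negligible events the estimator is close to `A` and solves the score equation. -/
theorem IsAdjEstimator.exists_nearTruth [MeasurableSpace Ω] {P : Measure Ω}
    [IsProbabilityMeasure P] {Ahat : (m : ℕ) → (Fin m → ℝ) → ℝ} (hest : IsAdjEstimator P x D β u e F Ahat)
    (hmodel : NormalErrors P A D u e) (hA : 0 < A) (hF : RegularFactor A F κ₀) {K d₁ d₂ : ℝ}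
    (hb : ∀ᶠ m in atTop, Bounds x D K d₁ d₂ m) (i : ℕ) :
    ∃ (C : ℝ) (S : ℕ → Set Ω), Negligible P S ∧
      NearTruth (outside S) x D A K d₁ d₂ C i Prod.fst (fun q => residual u e q.2)
        (fun q => Ahat q.1 (obsVec x β u e q.1 q.2)) ∧
      ∀ᶠ q in outside S, scoreDiag D q.1 (residual u e q.2) (Ahat q.1 (obsVec x β u e q.1 q.2)) / 2 +
        scoreProj x D q.1 (residual u e q.2) (Ahat q.1 (obsVec x β u e q.1 q.2)) +
        deriv (fun s => Real.log (F q.1 s)) (Ahat q.1 (obsVec x β u e q.1 q.2)) = 0 := by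
  obtain ⟨n, hn⟩ := hb.exists
  have hD : ∀ j, 0 < D j := fun j => hn.d₁_pos.trans_le (hn.le_D j)
  obtain ⟨C, hC, hgood⟩ := negligible_not_goodPath (hmodel.gaussianNoise hA hD) hA hn i
  obtain ⟨C', lam, hC', -, hlam, hbad⟩ := hest.argmax_bounded
  have hmain := hF.near_and_score hA hb hC hC'.le hlam β i
  refine ⟨C, _, hgood.union hbad, ?_⟩
  set S : ℕ → Set Ω := fun m => {ω | ¬ GoodPath x D A d₂ C i m fun j => u j ω + e j ω} ∪
    {ω | ¬ (IsAdjArgmax x D m (F m) (obsVec x β u e m ω) (Ahat m (obsVec x β u e m ω)) ∧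
      Ahat m (obsVec x β u e m ω) < C' * (m : ℝ) ^ lam)} with hS
  have ht := tendsto_fst_outside S
  have hout : ∀ᶠ q in outside S, GoodPath x D A d₂ C i q.1 (residual u e q.2) ∧
      IsAdjArgmax x D q.1 (F q.1) (obsVec x β u e q.1 q.2) (Ahat q.1 (obsVec x β u e q.1 q.2)) ∧
      Ahat q.1 (obsVec x β u e q.1 q.2) < C' * (q.1 : ℝ) ^ lam := by
    filter_upwards [eventually_notMem_outside S] with q hq
    simp only [hS, Set.mem_union, Set.mem_ofPred_eq, not_or, not_not] at hq
    exact hq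
  have hboth : ∀ᶠ q in outside S,
      |Ahat q.1 (obsVec x β u e q.1 q.2) - A| ≤ scale q.1 ^ (-18 : ℤ) ∧
      scoreDiag D q.1 (residual u e q.2) (Ahat q.1 (obsVec x β u e q.1 q.2)) / 2 +
        scoreProj x D q.1 (residual u e q.2) (Ahat q.1 (obsVec x β u e q.1 q.2)) +
        deriv (fun s => Real.log (F q.1 s)) (Ahat q.1 (obsVec x β u e q.1 q.2)) = 0 := by
    filter_upwards [hout, ht.eventually hmain] with q h1 h2
    refine h2 _ _ h1.1 ?_ h1.2.2
    rw [← obsVec_eq]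
    exact h1.2.1
  exact ⟨⟨hA, ht, ht.eventually hb, hout.mono fun q h => h.1, hboth.mono fun q h => h.1,
    Eventually.of_forall fun q => hest.nonneg _ _⟩, hboth.mono fun q h => h.2⟩

section Near

variable {α : Type*} {l : Filter α} {K d₁ d₂ C : ℝ} {i : ℕ} {m : α → ℕ} {z : α → ℕ → ℝ} {a : α → ℝ}

theorem NearTruth.eventually_near (h : NearTruth l x D A K d₁ d₂ C i m z a) {r : ℝ} (hr : 0 < r) :
    ∀ᶠ q in l, |a q - A| < r := by
  have h1 : ∀ᶠ n in atTop, scale n ^ (-18 : ℤ) < r :=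
    ((tendsto_zpow_atTop_zero (by norm_num)).comp tendsto_scale).eventually_lt_const hr
  filter_upwards [h.near, h.tendsto.eventually h1] with q h2 h3
  exact h2.trans_lt h3

theorem NearTruth.tendsto_value (h : NearTruth l x D A K d₁ d₂ C i m z a) : Tendsto a l (𝓝 A) :=
  Metric.tendsto_nhds.2 fun _ hε => h.eventually_near hε

theorem RegularFactor.tendsto_deriv_sub (hF : RegularFactor A F κ₀)
    (h : NearTruth l x D A K d₁ d₂ C i m z a) :
    Tendsto (fun q => deriv (fun s => Real.log (F (m q) s)) (a q) - κ₀ (m q)) l (𝓝 0) := by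
  refine Metric.tendsto_nhds.2 fun ε hε => ?_
  obtain ⟨r, hr, h1⟩ := hF.deriv_near ε hε
  filter_upwards [h.eventually_near hr, h.tendsto.eventually h1] with q h2 h3
  rw [Real.dist_eq, sub_zero]
  exact h3 _ h2

theorem RegularFactor.ord_deriv (hF : RegularFactor A F κ₀)
    (h : NearTruth l x D A K d₁ d₂ C i m z a) :
    Ord l m 0 fun q => deriv (fun s => Real.log (F (m q) s)) (a q) := by
  obtain ⟨M, hM⟩ := hF.bounded
  have h1 := (Metric.tendsto_nhds.1 (hF.tendsto_deriv_sub h)) 1 one_pos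
  refine Ord.of_bound (C := 1 + M) ?_
  filter_upwards [h1, h.tendsto.eventually hM] with q h2 h3
  rw [Real.dist_eq, sub_zero] at h2
  rw [zpow_zero, mul_one, Real.norm_eq_abs]
  have := abs_add_le (deriv (fun s => Real.log (F (m q) s)) (a q) - κ₀ (m q)) (κ₀ (m q))
  rw [sub_add_cancel] at this
  linarith

theorem Coupled.tendsto_diff {L c : ℕ → ℝ → ℝ} (hc : Coupled D i L c) (hA : 0 < A)
    (hm : Tendsto m l atTop) (ha : Tendsto a l (𝓝 A)) :
    Tendsto (fun q => deriv (fun s => Real.log (L (m q) s)) (a q) -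
      (2 - c (m q) (a q)) / (a q + D i)) l (𝓝 0) := by
  refine Metric.tendsto_nhds.2 fun ε hε => ?_
  obtain ⟨t, ht, h1⟩ := Metric.tendstoLocallyUniformlyOn_iff.1 hc.diff_eq ε hε A
    (Set.mem_Ioi.2 hA)
  rw [nhdsWithin_eq_nhds.2 (Ioi_mem_nhds hA)] at ht
  filter_upwards [ha ht, hm.eventually h1] with q h2 h3
  rw [dist_comm]
  exact h3 _ h2

theorem Coupled.ord {L c : ℕ → ℝ → ℝ} (hc : Coupled D i L c) (hA : 0 < A)
    (hm : Tendsto m l atTop) : Ord l m 0 fun q => c (m q) A := by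
  obtain ⟨M, hM⟩ := (hc.bigO A hA.le).bound
  refine Ord.of_bound (C := M) ?_
  filter_upwards [hm.eventually hM] with q hq
  simpa using hq

/-- No bound on c' near A is available; instead c inherits its continuity from the factor. By the
coupling, (2 - c)/(· + D_i) follows (log L)' both at a and at A, and these two derivatives approach
each other. -/
theorem Coupled.tendsto_sub {L c : ℕ → ℝ → ℝ} (hc : Coupled D i L c) (hD : 0 < D i)
    {κ₀ : ℕ → ℝ} (hL : RegularFactor A L κ₀) (h : NearTruth l x D A K d₁ d₂ C i m z a) :
    Tendsto (fun q => c (m q) (a q) - c (m q) A) l (𝓝 0) := by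
  have hA := h.A_pos
  have ha := h.tendsto_value
  have t1 := hc.tendsto_diff hA h.tendsto ha
  have t2 := hc.tendsto_diff (a := fun _ => A) hA h.tendsto tendsto_const_nhds
  have t3 := hL.tendsto_deriv_sub h
  have t4 := hL.tendsto_deriv_sub (z := z) (a := fun _ => A)
    ⟨hA, h.tendsto, h.bounds, h.good, by
      filter_upwards with q
      simpa using zpow_nonneg (scale_nonneg (m q)) (-18), Eventually.of_forall fun _ => hA.le⟩
  have t5 : Tendsto (fun q => (a q + D i) * ((2 - c (m q) (a q)) / (a q + D i) -
      (2 - c (m q) A) / (A + D i))) l (𝓝 ((A + D i) * 0)) := by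
    refine (ha.add_const (D i)).mul ?_
    have := ((t2.sub t1).add t3).sub t4
    simp only [sub_zero, add_zero] at this
    refine this.congr fun q => ?_
    ring
  have t6 : Tendsto (fun q => (2 - c (m q) A) / (A + D i) * (a q - A)) l (𝓝 0) := by
    obtain ⟨M, hM⟩ := IsBigO.bound (hc.ord hA h.tendsto)
    have hbd : ∀ᶠ q in l, |(2 - c (m q) A) / (A + D i)| ≤ (2 + M) / (A + D i) := by
      filter_upwards [hM] with q hq
      simp only [zpow_zero, norm_one, mul_one, Real.norm_eq_abs] at hq
      rw [abs_div, abs_of_pos (add_pos hA hD)]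
      gcongr
      exact (abs_sub _ _).trans (by rw [abs_two]; linarith)
    have h2 : Tendsto (fun q => a q - A) l (𝓝 0) := by simpa using ha.sub_const A
    exact bdd_le_mul_tendsto_zero' _ hbd h2
  have t7 := (t5.add t6).neg
  rw [mul_zero, add_zero, neg_zero] at t7
  refine t7.congr' ?_
  filter_upwards [h.nonneg] with q hq
  have h1 : a q + D i ≠ 0 := by positivity
  have h2 : A + D i ≠ 0 := by positivity
  field_simp
  ring

theorem chiSum_two_eq {n : ℕ} (hi : i < n) (z : ℕ → ℝ) :
    chiSum D n A 2 z = (A + D i)⁻¹ ^ 2 * (z i ^ 2 - (A + D i)) +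
      ∑ j ∈ (Finset.range n).erase i, 1 / (A + D j) ^ 2 * (z j ^ 2 - (A + D j)) := by
  rw [chiSum_eq, ← Finset.add_sum_erase (Finset.range n)
    (fun j => 1 / (A + D j) ^ 2 * (z j ^ 2 - (A + D j))) (Finset.mem_range.2 hi), one_div, inv_pow]

/-- The excess differs from its leading term by order -35 and both have order -18, so their squares
differ by order -53. Removing the i-th summand from χ₂ costs only order 2 - 40 + 1 = -37. -/
theorem NearTruth.sq_sub_sq_isLittleO (h : NearTruth l x D A K d₁ d₂ C i m z a)
    (hi : ∀ᶠ q in l, i < m q) {κ : α → ℝ} (hκ : Ord l m 0 κ)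
    (hscore : ∀ᶠ q in l, scoreDiag D (m q) (z q) (a q) / 2 + scoreProj x D (m q) (z q) (a q) +
      κ q = 0) :
    (fun q => (shrink D i A * z q i - correction x D (m q) i (z q) (a q)) ^ 2 -
      errorLeading x D A (m q) i (z q) ^ 2) =o[l] fun q => scale (m q) ^ (-40 : ℤ) := by
  have hm := h.tendsto
  have hx : Ord l m 0 fun _ => x i := Ord.const _
  have t1 := h.ord_correction_sub hκ hscore
  have t2 := ((((h.ord_coord.pow 2).mono hm (by norm_num : (1 * (2 : ℕ) : ℤ) ≤ 2)).sub
    ((Ord.const (A + D i)).mono hm (by norm_num : (0 : ℤ) ≤ 2))).mul hm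
      ((h.ord_inv_invSum 2).mul hm h.ord_coord)).const_mul
        (D i * (A + D i)⁻¹ ^ 2 * (A + D i)⁻¹ ^ 2)
  have t3 : Ord l m (-35) fun q => shrink D i A * z q i - correction x D (m q) i (z q) (a q) -
      errorLeading x D A (m q) i (z q) := by
    refine ((t2.mono hm (by norm_num)).sub t1).congr ?_
    filter_upwards [hi] with q hq
    rw [errorLeading, chiSum_two_eq hq, correction, correction]
    ring
  have t4 := (hx.dotProduct hm h.ord_wls).const_mul (shrink D i A)
  have t5 := (((h.ord_chi (k := 2) (by norm_num)).mul hm (h.ord_inv_invSum 2)).mul hm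
    h.ord_coord).const_mul (D i * (A + D i)⁻¹ ^ 2)
  have t6 : Ord l m (-18) fun q => errorLeading x D A (m q) i (z q) := by
    refine (((t4.mono hm (by norm_num)).add (t5.mono hm (by norm_num))).sub
      (t2.mono hm (by norm_num))).congr ?_
    filter_upwards [hi] with q hq
    rw [errorLeading, chiSum_two_eq hq]
    ring
  have t7 := t3.mul hm ((t3.mono hm (by norm_num : (-35 : ℤ) ≤ -18)).add (t6.const_mul 2))
  refine (Ord.isLittleO hm (t7.congr (Eventually.of_forall fun q => ?_)) (by norm_num))
  ring

end Near

end FayHerriot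

/-! ### Mean squared error and expectation of its estimator -/

namespace FayHerriot

variable {Ω : Type*} [MeasurableSpace Ω] {P : Measure Ω} {p : ℕ}
  {x : ℕ → Fin p → ℝ} {D : ℕ → ℝ} {β : Fin p → ℝ} {A : ℝ} {u e : ℕ → Ω → ℝ}
  {F : ℕ → ℝ → ℝ} {κ₀ : ℕ → ℝ} {Ahat : (m : ℕ) → (Fin m → ℝ) → ℝ} {K d₁ d₂ : ℝ}

section Moments

variable [IsProbabilityMeasure P] {Z : ℕ → Ω → ℝ}

theorem polyMoments_absSum (h : GaussianNoise P (fun j => A + D j) Z) {n : ℕ}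
    (hb : Bounds x D K d₁ d₂ n) :
    PolyMoments P fun m ω => absSum m fun j => Z j ω :=
  h.polyMoments_sum_abs (B := A + d₂) fun j => by linarith [hb.D_le j]

theorem polyMoments_inv_invSum (hA : 0 < A) (hb : ∀ᶠ m in atTop, Bounds x D K d₁ d₂ m) :
    PolyMoments P fun m (_ : Ω) => (invSum D m A 2)⁻¹ :=
  PolyMoments.of_bounded (C := (A + d₂) ^ 2) (by
    filter_upwards [hb] with m hm
    have h1 := hm.le_invSum hA.le
    have h2 : 0 < A + d₂ := by linarith [hm.d₁_pos, hm.d₁_le]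
    rw [abs_of_nonneg (inv_nonneg.2 (le_trans (by positivity) h1))]
    exact inv_le_of_inv_le₀ (by positivity) h1)

theorem polyMoments_natCast : PolyMoments P fun m (_ : Ω) => (m : ℝ) :=
  PolyMoments.of_isBigO (r := 1) (by simpa using isBigO_refl _ _)

theorem polyMoments_invSum (hA : 0 < A) (hb : ∀ᶠ m in atTop, Bounds x D K d₁ d₂ m) (k : ℕ) :
    PolyMoments P fun m (_ : Ω) => invSum D m A k :=
  PolyMoments.of_isBigO (r := 1) (IsBigO.of_bound (1 / A ^ k) (by
    filter_upwards [hb] with m hm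
    rw [pow_one, Real.norm_of_nonneg (Nat.cast_nonneg m), invSum,
      Real.norm_of_nonneg (Finset.sum_nonneg fun j _ => by
        have := hm.add_pos hA.le j; positivity)]
    refine (Finset.sum_le_card_nsmul _ _ (1 / A ^ k) fun j _ => ?_).trans_eq (by
      rw [Finset.card_range, nsmul_eq_mul, mul_comm])
    have h1 : A ≤ A + D j := by linarith [hm.le_D j, hm.d₁_pos]
    gcongr))

theorem polyMoments_chiSum (h : GaussianNoise P (fun j => A + D j) Z) (hA : 0 < A)
    (hb : ∀ᶠ m in atTop, Bounds x D K d₁ d₂ m) (k : ℕ) :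
    PolyMoments P fun m ω => chiSum D m A k fun j => Z j ω := by
  obtain ⟨n, hn⟩ := hb.exists
  refine ((((polyMoments_absSum h hn).pow 2).add
    (polyMoments_natCast.mul (PolyMoments.const (A + d₂)))).const_mul (d₁⁻¹ ^ k)).of_abs_le
    (Eventually.of_forall fun m => (moments_chiSum h m k).aestronglyMeasurable) ?_
  filter_upwards [hb] with m hm ω
  exact (hm.abs_chiSum_le hA.le k _).trans (le_abs_self _)

theorem polyMoments_scoreProj (h : GaussianNoise P (fun j => A + D j) Z) (hA : 0 < A)
    (hb : ∀ᶠ m in atTop, Bounds x D K d₁ d₂ m) :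
    PolyMoments P fun m ω => scoreProj x D m (fun j => Z j ω) A := by
  obtain ⟨n, hn⟩ := hb.exists
  have hS := (polyMoments_absSum h hn).pow 2
  refine (((PolyMoments.const (p / d₁)).add (hS.const_mul (p * (K * d₁⁻¹ ^ 2) * (p * K ^ 2 * (d₂ / d₁))))).add
    ((polyMoments_natCast.mul hS).const_mul
      (p * (p * K ^ 2 * d₁⁻¹ ^ 2) * (p * K ^ 2 * (d₂ / d₁)) ^ 2))).of_abs_le
    (Eventually.of_forall fun m => (moments_scoreProj h).aestronglyMeasurable) ?_
  filter_upwards [hb] with m hm ω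
  exact (hm.abs_scoreProj_le hA.le _).trans (le_abs_self _)

theorem polyMoments_leadingSum (h : GaussianNoise P (fun j => A + D j) Z) (hA : 0 < A)
    (hb : ∀ᶠ m in atTop, Bounds x D K d₁ d₂ m) :
    PolyMoments P fun m ω => leadingSum x D A m fun j => Z j ω := by
  have c2 := polyMoments_chiSum h hA hb 2
  have c3 := polyMoments_chiSum h hA hb 3
  have t := polyMoments_inv_invSum (P := P) hA hb
  exact ((c2.sub ((c3.mul (c2.mul t)).const_mul 2)).add
    (((polyMoments_invSum hA hb 3).mul ((c2.mul t).pow 2)).const_mul 2)).add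
    ((polyMoments_scoreProj h hA hb).const_mul 2)

theorem polyMoments_errorLeading (h : GaussianNoise P (fun j => A + D j) Z) (hA : 0 < A)
    (hb : ∀ᶠ m in atTop, Bounds x D K d₁ d₂ m) (i : ℕ) :
    PolyMoments P fun m ω => errorLeading x D A m i fun j => Z j ω := by
  obtain ⟨n, hn⟩ := hb.exists
  have c2 := polyMoments_chiSum h hA hb 2
  have t := polyMoments_inv_invSum (P := P) hA hb
  have mz := PolyMoments.of_allMoments (h.moments i)
  have hS := polyMoments_absSum h hn
  have t1 : PolyMoments P fun m ω => x i ⬝ᵥ wls x D m A fun j => Z j ω := by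
    refine (hS.const_mul (p * K * (p * K ^ 2 * (d₂ / d₁)))).of_abs_le (Eventually.of_forall fun m =>
      (moments_dotProduct_wls h _ _).aestronglyMeasurable) ?_
    filter_upwards [hb] with m hm ω
    refine le_trans ((hm.abs_dotProduct_le i _).trans ?_) (le_abs_self _)
    have := hm.K_pos
    rw [mul_assoc (p * K)]
    gcongr
    exact hm.norm_wls_le hA.le _
  refine ((t1.const_mul (shrink D i A)).add ((t.const_mul (D i * (A + D i)⁻¹ ^ 2)).mul
    ((c2.sub ((mz.pow 2).sub (PolyMoments.const (A + D i)) |>.const_mul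
      ((A + D i)⁻¹ ^ 2))).mul mz))).congr ?_
  filter_upwards [eventually_gt_atTop i] with m hm ω
  rw [errorLeading, chiSum_two_eq hm]
  ring

end Moments

/-- The extension of a vector by zeros. -/
def extendZero {m : ℕ} (y : Fin m → ℝ) (j : ℕ) : ℝ := if h : j < m then y ⟨j, h⟩ else 0

theorem measurable_extendZero {m : ℕ} : Measurable (extendZero (m := m)) := by
  refine measurable_pi_iff.2 fun j => ?_
  by_cases h : j < m
  · simpa [extendZero, h] using measurable_pi_apply _
  · simp [extendZero, h]

theorem correction_congr {m i : ℕ} (hi : i < m) {z z' : ℕ → ℝ} (h : ∀ j < m, z j = z' j) (a : ℝ) :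
    correction x D m i z a = correction x D m i z' a := by
  rw [correction, correction, dotProduct_wls_eq, dotProduct_wls_eq, h i hi,
    Finset.sum_congr rfl fun j hj => by rw [h j (Finset.mem_range.1 hj)]]

/-- The difference between the EBLUP and the best predictor. -/
noncomputable def excess (x : ℕ → Fin p → ℝ) (D : ℕ → ℝ) (β : Fin p → ℝ) (A : ℝ) (u e : ℕ → Ω → ℝ)
    (Ahat : (m : ℕ) → (Fin m → ℝ) → ℝ) (i m : ℕ) (ω : Ω) : ℝ :=
  shrink D i A * residual u e ω i -
    correction x D m i (residual u e ω) (Ahat m (obsVec x β u e m ω))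

theorem eblupError_eq {m i : ℕ} (hb : Bounds x D K d₁ d₂ m) (hA : 0 < A)
    (h0 : ∀ m y, 0 ≤ Ahat m y) (ω : Ω) :
    eblupError x D β u e i m (Ahat m) ω =
      bestError A D u e i ω + excess x D β A u e Ahat i m ω := by
  have hp : ∀ j < m, 0 < Ahat m (obsVec x β u e m ω) + D j := fun j _ => hb.add_pos (h0 _ _) j
  have h1 := betaTilde_eq x D m _ hp (isUnit_det_wGram hb.spans 1 hp) β (residual u e ω)
  rw [← obsVec_eq] at h1
  have hv := (hb.add_pos hA.le i).ne'
  rw [eblupError, predictor, h1, dotProduct_add, excess, correction, bestError, wls, obs, areaMean,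
    shrink, shrink, residual]
  field_simp
  ring

/-- To use the independence of the best predictor's error, the excess has to be a fixed function of
the m observed residuals; extension by zeros supplies the path beyond them. -/
theorem excess_eq_comp (x : ℕ → Fin p → ℝ) (D : ℕ → ℝ) (β : Fin p → ℝ) (A : ℝ) (u e : ℕ → Ω → ℝ)
    (Ahat : (m : ℕ) → (Fin m → ℝ) → ℝ) {i m : ℕ} (hi : i < m) (ω : Ω) :
    excess x D β A u e Ahat i m ω = (fun y : Fin m → ℝ => shrink D i A * extendZero y i -
      correction x D m i (extendZero y) (Ahat m fun j => x j ⬝ᵥ β + y j))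
        (fun j : Fin m => u j ω + e j ω) := by
  simp only [excess]
  rw [obsVec_eq, correction_congr hi (z' := extendZero fun j : Fin m => u j ω + e j ω)
    fun j hj => by simp [extendZero, hj, residual]]
  simp [extendZero, hi, residual]

theorem measurable_excess_comp {m i : ℕ} (hb : Bounds x D K d₁ d₂ m) (hmeas : Measurable (Ahat m))
    (h0 : ∀ m y, 0 ≤ Ahat m y) :
    Measurable fun y : Fin m → ℝ => shrink D i A * extendZero y i -
      correction x D m i (extendZero y) (Ahat m fun j => x j ⬝ᵥ β + y j) := by
  have hD : ∀ j, 0 < D j := fun j => hb.d₁_pos.trans_le (hb.le_D j)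
  have h1 : Measurable fun y : Fin m → ℝ => Ahat m fun j => x j ⬝ᵥ β + y j :=
    hmeas.comp (by fun_prop)
  exact (((measurable_pi_apply i).comp measurable_extendZero).const_mul _).sub
    (measurable_correction hb.spans hD i h1 (fun y => h0 _ _) measurable_extendZero)

variable [IsProbabilityMeasure P]

theorem NormalErrors.aemeasurable_residual (h : NormalErrors P A D u e) (m : ℕ) :
    AEMeasurable (fun ω (j : Fin m) => u j ω + e j ω) P :=
  aemeasurable_pi_lambda _ fun j => (h.law_u j).aemeasurable.add (h.law_e j).aemeasurable

theorem NormalErrors.polyMoments_excess (hmodel : NormalErrors P A D u e) (hA : 0 < A)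
    (hb : ∀ᶠ m in atTop, Bounds x D K d₁ d₂ m) (hest : IsAdjEstimator P x D β u e F Ahat) (i : ℕ) :
    PolyMoments P fun m ω => excess x D β A u e Ahat i m ω := by
  obtain ⟨n, hn⟩ := hb.exists
  have hD : ∀ j, 0 < D j := fun j => hn.d₁_pos.trans_le (hn.le_D j)
  have hZ := hmodel.gaussianNoise hA hD
  have hS := polyMoments_absSum hZ hn
  have mz : PolyMoments P fun _ ω => |u i ω + e i ω| :=
    PolyMoments.of_allMoments ((hZ.moments i).of_abs_le
      (continuous_abs.comp_aestronglyMeasurable (hZ.moments i).aestronglyMeasurable)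
      fun ω => by simp)
  refine (mz.add (mz.add (hS.const_mul (p * K * (p * K ^ 2 * (d₂ / d₁)))))).of_abs_le ?_ ?_
  · filter_upwards [hb, eventually_gt_atTop i] with m hm hi
    have h1 := (measurable_excess_comp (i := i) (A := A) (β := β) hm (hest.measurable m)
      hest.nonneg).comp_aemeasurable (hmodel.aemeasurable_residual m)
    refine (h1.congr (Eventually.of_forall fun ω => ?_)).aestronglyMeasurable
    exact (excess_eq_comp x D β A u e Ahat hi ω).symm
  · filter_upwards [hb] with m hm ω
    refine le_trans ?_ (le_abs_self _)
    have hs := hm.shrink_mem hA.le i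
    rw [excess]
    refine (abs_sub _ _).trans (add_le_add ?_ (hm.abs_correction_le (hest.nonneg _ _) i _))
    rw [abs_mul, abs_of_nonneg hs.1]
    exact mul_le_of_le_one_left (abs_nonneg _) hs.2

theorem isBigO_inv_invSum (hb : ∀ᶠ m in atTop, Bounds x D K d₁ d₂ m) (hA : 0 < A) :
    (fun m => (invSum D m A 2)⁻¹) =O[atTop] fun m : ℕ => (m : ℝ)⁻¹ := by
  refine IsBigO.of_bound ((A + d₂) ^ 2) ?_
  filter_upwards [hb] with m hm
  have h2 : 0 < A + d₂ := by linarith [hm.d₁_pos, hm.d₁_le]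
  have hm0 := hm.m_pos
  have h1 : m * (1 / (A + d₂) ^ 2) ≤ invSum D m A 2 := by
    rw [← nsmul_eq_mul]
    nth_rw 1 [← Finset.card_range m]
    refine Finset.card_nsmul_le_sum _ _ _ fun j _ => ?_
    have := hm.add_pos hA.le j
    have := hm.D_le j
    gcongr
  rw [norm_inv, Real.norm_of_nonneg (le_trans (by positivity) h1), norm_inv,
    Real.norm_of_nonneg hm0.le]
  calc (invSum D m A 2)⁻¹ ≤ (m * (1 / (A + d₂) ^ 2))⁻¹ := by gcongr
    _ = _ := by field_simp

/-- The mean squared error of the EBLUP. -/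
theorem NormalErrors.mse_isLittleO (hmodel : NormalErrors P A D u e) (hA : 0 < A)
    (hb : ∀ᶠ m in atTop, Bounds x D K d₁ d₂ m) (hF : RegularFactor A F κ₀)
    (hest : IsAdjEstimator P x D β u e F Ahat) (i : ℕ) :
    (∀ᶠ m in atTop, Integrable (fun ω => eblupError x D β u e i m (Ahat m) ω ^ 2) P) ∧
      (fun m : ℕ => mse P x D β u e i m (Ahat m) - (g1 D i A + g2 x D m i A + g3 D m i A))
        =o[atTop] fun m : ℕ => (m : ℝ)⁻¹ := by
  obtain ⟨n, hn⟩ := hb.exists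
  have hD : ∀ j, 0 < D j := fun j => hn.d₁_pos.trans_le (hn.le_D j)
  have hZ := hmodel.gaussianNoise hA hD
  have mE := hmodel.polyMoments_excess hA hb hest i
  have mL := polyMoments_errorLeading hZ hA hb i
  have mT := hmodel.moments_bestError hA hD i
  have hkey : ∀ᶠ m in atTop,
      AllMoments P (fun ω => eblupError x D β u e i m (Ahat m) ω) ∧
      mse P x D β u e i m (Ahat m) = g1 D i A + ∫ ω, excess x D β A u e Ahat i m ω ^ 2 ∂P := by
    filter_upwards [hb, mE.moments, eventually_gt_atTop i] with m hm hE hi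
    have e1 : ∀ ω, eblupError x D β u e i m (Ahat m) ω =
        bestError A D u e i ω + excess x D β A u e Ahat i m ω := eblupError_eq hm hA hest.nonneg
    refine ⟨by simp_rw [e1]; exact mT.add hE, ?_⟩
    -- The error of the best predictor is centred and independent of the excess, which is a function
    -- of the residuals.
    have e2 : ∫ ω, bestError A D u e i ω * excess x D β A u e Ahat i m ω ∂P = 0 := by
      have h1 := (hmodel.indepFun_bestError hA hD hi).comp measurable_id
        (measurable_excess_comp (i := i) (A := A) (β := β) hm (hest.measurable m) hest.nonneg)
      have h2 : (fun y : Fin m → ℝ => shrink D i A * extendZero y i -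
          correction x D m i (extendZero y) (Ahat m fun j => x j ⬝ᵥ β + y j)) ∘
          (fun ω (j : Fin m) => u j ω + e j ω) = excess x D β A u e Ahat i m :=
        funext fun ω => (excess_eq_comp x D β A u e Ahat hi ω).symm
      rw [h2] at h1
      have h3 := h1.integral_mul_eq_mul_integral mT.aestronglyMeasurable hE.aestronglyMeasurable
      refine h3.trans ?_
      simp [hmodel.integral_bestError hA hD i]
    have e3 : ∀ ω, eblupError x D β u e i m (Ahat m) ω ^ 2 = bestError A D u e i ω ^ 2 +
        2 * (bestError A D u e i ω * excess x D β A u e Ahat i m ω) +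
        excess x D β A u e Ahat i m ω ^ 2 := fun ω => by rw [e1]; ring
    rw [mse]
    simp_rw [e3]
    rw [((mT.pow 2).add ((mT.mul hE).const_mul 2)).integral_add (hE.pow 2),
      (mT.pow 2).integral_add ((mT.mul hE).const_mul 2), integral_const_mul, e2,
      hmodel.integral_sq_bestError hA hD]
    ring
  refine ⟨hkey.mono fun m h => (h.1.pow 2).integrable, ?_⟩
  obtain ⟨C, S, hS, hnear, hscore⟩ := hest.exists_nearTruth hmodel hA hF hb i
  have hdiff := hnear.sq_sub_sq_isLittleO (hnear.tendsto.eventually (eventually_gt_atTop i))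
    (hF.ord_deriv hnear) hscore
  simp_rw [zpow_neg_forty] at hdiff
  have h1 := ((mE.pow 2).sub (mL.pow 2)).integral_isLittleO hS hdiff
  have h2 : (fun m => 2 * D i ^ 2 * (A + D i)⁻¹ ^ 5 * (invSum D m A 2)⁻¹ ^ 2)
      =o[atTop] fun m : ℕ => (m : ℝ)⁻¹ := by
    refine IsLittleO.const_mul_left ?_ _
    simp_rw [sq]
    have h3 := isBigO_inv_invSum hb hA
    have h4 : (fun m : ℕ => (m : ℝ)⁻¹) =o[atTop] fun _ => (1 : ℝ) :=
      (isLittleO_one_iff ℝ).2 tendsto_inv_atTop_nhds_zero_nat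
    simpa using h3.mul_isLittleO (h3.trans_isLittleO h4)
  refine (h1.sub h2).congr' ?_ EventuallyEq.rfl
  filter_upwards [hkey, mE.moments, mL.moments, eventually_gt_atTop i, hb] with m hk hE hL hi hm
  rw [hk.2, (hE.pow 2).integral_sub (hL.pow 2), integral_sq_errorLeading hZ hm.spans hi]
  ring

/-- The leading sum is centred and χ₂² has mean 2τ, so the curvature term of g₁ yields -g₃. What
remains beside g₁ + g₂ + g₃ is proportional to κ - (2 - c)/(A + D_i), the defect in condition (1).
-/
theorem integral_mseEstLeading {m : ℕ} (hZ : GaussianNoise P (fun j => A + D j) (fun j ω => u j ω + e j ω))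
    (hm : Bounds x D K d₁ d₂ m) (hA : 0 < A) (i : ℕ) (κ c : ℝ) :
    ∫ ω, NearTruth.mseEstLeading x D A m i (residual u e ω) κ c ∂P =
      g1 D i A + g2 x D m i A + g3 D m i A +
        2 * (D i ^ 2 * (A + D i)⁻¹ ^ 2) * ((κ - (2 - c) / (A + D i)) * (invSum D m A 2)⁻¹) := by
  have hm0 : 0 < m := hm.pos
  have m1 : AllMoments P fun ω => leadingSum x D A m (residual u e ω) := moments_leadingSum hZ
  have m2 : AllMoments P fun ω => chiSum D m A 2 (residual u e ω) := moments_chiSum hZ m 2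
  have i1 : ∫ ω, leadingSum x D A m (residual u e ω) ∂P = 0 :=
    integral_leadingSum hZ hm.spans hm0
  have i2 : ∫ ω, chiSum D m A 2 (residual u e ω) * chiSum D m A 2 (residual u e ω) ∂P =
      2 * invSum D m A 2 := integral_chiSum_mul_chiSum hZ 1 1
  have hτ := (invSum_pos hZ.pos hm0 2).ne'
  have hv : A + D i ≠ 0 := (hZ.pos i).ne'
  have e1 : ∀ ω, NearTruth.mseEstLeading x D A m i (residual u e ω) κ c =
      D i ^ 2 * (A + D i)⁻¹ ^ 2 * (invSum D m A 2)⁻¹ * leadingSum x D A m (residual u e ω) -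
      D i ^ 2 * (A + D i)⁻¹ ^ 3 * (invSum D m A 2)⁻¹ ^ 2 *
        (chiSum D m A 2 (residual u e ω) * chiSum D m A 2 (residual u e ω)) +
      (g1 D i A + D i ^ 2 * (A + D i)⁻¹ ^ 2 * (2 * κ * (invSum D m A 2)⁻¹) +
        g2 x D m i A + c * g3 D m i A) := fun ω => by
    rw [NearTruth.mseEstLeading]; ring
  simp_rw [e1]
  rw [((m1.const_mul _).sub ((m2.mul m2).const_mul _)).integral_add (AllMoments.const _),
    (m1.const_mul _).integral_sub ((m2.mul m2).const_mul _), integral_const_mul,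
    integral_const_mul, i1, i2, integral_const, probReal_univ, one_smul, hm.g3_eq hA.le]
  field_simp
  ring

/-- The expectation of the estimator of the mean squared error. -/
theorem NormalErrors.integral_mseEst_isLittleO (hmodel : NormalErrors P A D u e) (hA : 0 < A)
    (hb : ∀ᶠ m in atTop, Bounds x D K d₁ d₂ m) (hF : RegularFactor A F κ₀) {i : ℕ}
    {L c : ℕ → ℝ → ℝ} (hc : Coupled D i L c) (hL : RegularFactor A L κ₀)
    (hκ : ∀ m, κ₀ m = deriv (fun s => Real.log (L m s)) A)
    (hest : IsAdjEstimator P x D β u e F Ahat) :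
    (∀ᶠ m in atTop,
        Integrable (fun ω => mseEst x D m i (c m) (Ahat m (obsVec x β u e m ω))) P) ∧
      (fun m : ℕ => (∫ ω, mseEst x D m i (c m) (Ahat m (obsVec x β u e m ω)) ∂P) -
        (g1 D i A + g2 x D m i A + g3 D m i A)) =o[atTop] fun m : ℕ => (m : ℝ)⁻¹ := by
  obtain ⟨n, hn⟩ := hb.exists
  have hD : ∀ j, 0 < D j := fun j => hn.d₁_pos.trans_le (hn.le_D j)
  have hZ := hmodel.gaussianNoise hA hD
  obtain ⟨M, hM, hcM⟩ := hc.exists_abs_le (hD i)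
  have mE : PolyMoments P fun m ω => mseEst x D m i (c m) (Ahat m (obsVec x β u e m ω)) := by
    refine (PolyMoments.const (d₂ + d₂ * (p * K * (p * K * (d₂ / d₁) * K)) +
      (2 * d₁⁻¹ + M) * (2 * d₂ ^ 2 * (d₂ / d₁) ^ 2))).of_abs_le ?_ ?_
    · filter_upwards [hb, eventually_gt_atTop i] with m hm hi
      have h1 : Measurable fun y : Fin m → ℝ =>
          mseEst x D m i (c m) (Ahat m fun j => x j ⬝ᵥ β + y j) :=
        measurable_comp_of_continuousOn (continuousOn_mseEst hm.spans hD hi (hc.continuousOn m hi))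
          ((hest.measurable m).comp (by fun_prop)) fun y => hest.nonneg _ _
      refine ((h1.comp_aemeasurable (hmodel.aemeasurable_residual m)).congr
        (Eventually.of_forall fun ω => ?_)).aestronglyMeasurable
      simp only [obsVec_eq, residual, Function.comp]
    · filter_upwards [hb, hcM] with m hm hcm ω
      exact (hm.abs_mseEst_le hM (hest.nonneg _ _) i (hcm _ (hest.nonneg _ _))).trans
        (le_abs_self _)
  refine ⟨mE.moments.mono fun m h => h.integrable, ?_⟩
  obtain ⟨C, S, hS, hnear, hscore⟩ := hest.exists_nearTruth hmodel hA hF hb i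
  have hdiff := hnear.mseEst_sub_isLittleO (hF.ord_deriv hnear) hscore
    (hF.tendsto_deriv_sub hnear) (hc.ord hA hnear.tendsto) (hc.tendsto_sub (hD i) hL hnear)
  simp_rw [zpow_neg_forty] at hdiff
  have hκb : PolyMoments P fun m (_ : Ω) => κ₀ m := by
    obtain ⟨B, hB⟩ := hF.bounded
    exact PolyMoments.of_bounded hB
  have hcb : PolyMoments P fun m (_ : Ω) => c m A :=
    PolyMoments.of_isBigO (r := 0) (by simpa using hc.bigO A hA.le)
  have hg2 : PolyMoments P fun m (_ : Ω) => g2 x D m i A :=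
    PolyMoments.of_bounded (hb.mono fun m hm => hm.abs_g2_le hA.le i)
  have hg3 : PolyMoments P fun m (_ : Ω) => g3 D m i A :=
    PolyMoments.of_bounded (hb.mono fun m hm => hm.abs_g3_le hA.le i)
  have c2 := polyMoments_chiSum hZ hA hb 2
  have t := polyMoments_inv_invSum (P := P) hA hb
  have mL : PolyMoments P fun m ω =>
      NearTruth.mseEstLeading x D A m i (residual u e ω) (κ₀ m) (c m A) :=
    ((((PolyMoments.const _).add ((((polyMoments_leadingSum hZ hA hb).add
      (hκb.const_mul 2)).mul t).const_mul _)).sub (((c2.mul t).pow 2).const_mul _)).add hg2).add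
      (hcb.mul hg3)
  have h1 := (mE.sub mL).integral_isLittleO hS hdiff
  have h2 : (fun m => 2 * (D i ^ 2 * (A + D i)⁻¹ ^ 2) * ((κ₀ m - (2 - c m A) / (A + D i)) *
      (invSum D m A 2)⁻¹)) =o[atTop] fun m : ℕ => (m : ℝ)⁻¹ := by
    refine IsLittleO.const_mul_left ?_ _
    have h3 : (fun m => κ₀ m - (2 - c m A) / (A + D i)) =o[atTop] fun _ => (1 : ℝ) := by
      refine (isLittleO_one_iff ℝ).2 ?_
      simp_rw [hκ]
      exact hc.tendsto_diff (a := fun _ => A) hA tendsto_id tendsto_const_nhds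
    simpa using h3.mul_isBigO (isBigO_inv_invSum hb hA)
  refine (h1.add h2).congr' ?_ EventuallyEq.rfl
  filter_upwards [mE.moments, mL.moments, hb] with m hE hLm hm
  rw [hE.integral_sub hLm, integral_mseEstLeading hZ hm hA]
  ring

end FayHerriot

/-! ### The theorem -/

theorem theorem1 {Ω : Type*} [MeasurableSpace Ω] (P : Measure Ω) [IsProbabilityMeasure P]
    {p : ℕ} (x : ℕ → Fin p → ℝ) (D : ℕ → ℝ) (β : Fin p → ℝ) (A : ℝ) (hA : 0 < A)
    (u e : ℕ → Ω → ℝ) (hmodel : NormalErrors P A D u e) (hreg : Regular x D)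
    (i : ℕ) (L c : ℕ → ℝ → ℝ) (hL : AdjFactor i L) (hc : Coupled D i L c) :
    -- Parts (i)-(iii), for the factor `L` and for the factor `L * Ladd`
    (∀ F : ℕ → ℝ → ℝ,
      (F = L ∨ ∃ Ladd : ℕ → ℝ → ℝ, AddFactor i Ladd ∧ F = fun m a => L m a * Ladd m a) →
      ∀ Ahat : (m : ℕ) → (Fin m → ℝ) → ℝ, IsAdjEstimator P x D β u e F Ahat →
        -- (i)
        ((∀ᶠ m in atTop, Integrable (fun ω => eblupError x D β u e i m (Ahat m) ω ^ 2) P) ∧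
          (fun m : ℕ => mse P x D β u e i m (Ahat m) -
              (g1 D i A + g2 x D m i A + g3 D m i A)) =o[atTop] (fun m : ℕ => (m : ℝ)⁻¹) ∧
          ∀ Are : (m : ℕ) → (Fin m → ℝ) → ℝ,
            IsAdjEstimator P x D β u e (fun _ _ => 1) Are →
            (fun m : ℕ => mse P x D β u e i m (Ahat m) - mse P x D β u e i m (Are m))
              =o[atTop] (fun m : ℕ => (m : ℝ)⁻¹)) ∧
        -- (ii)
        ((∀ᶠ m in atTop,
            Integrable (fun ω => mseEst x D m i (c m) (Ahat m (obsVec x β u e m ω))) P) ∧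
          (fun m : ℕ => (∫ ω, mseEst x D m i (c m) (Ahat m (obsVec x β u e m ω)) ∂P) -
              mse P x D β u e i m (Ahat m)) =o[atTop] (fun m : ℕ => (m : ℝ)⁻¹)) ∧
        -- (iii)
        (∀ m, i < m → (design x m).rank = p → (∀ a, 0 ≤ a → 0 ≤ c m a) →
          ∀ y : Fin m → ℝ, (x i ≠ 0 ∨ 0 < Ahat m y) →
            0 < mseEst x D m i (c m) (Ahat m y))) ∧
    -- (iv), for the factor `L * Ladd`, and for the factor `L` alone if it vanishes at `0`
    (∀ m, i < m → (design x m).rank = p →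
      (∃ C : ℝ, ∀ a, 0 < a →
        Real.log (L m a) ≤ C + ∫ s in (0 : ℝ)..a, (2 - c m s) / (s + D i)) →
      ((∀ a, 0 ≤ a → 0 ≤ c m a) ∧ p + 4 < m ∨
        p < m ∧ (fun a : ℝ => Real.exp (Real.log (a ^ 2) - ∫ s in (1 : ℝ)..a, c m s / s))
          =o[atTop] (fun a : ℝ => a ^ (((m : ℝ) - p) / 2))) →
      ∀ F : ℝ → ℝ,
        ((∃ Ladd : ℕ → ℝ → ℝ, AddFactor i Ladd ∧ F = fun a => L m a * Ladd m a) ∨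
          (L m 0 = 0 ∧ F = L m)) →
        ∀ y : Fin m → ℝ, (∃ a, 0 < a ∧ IsAdjArgmax x D m F y a) ∧
          ∀ a, IsAdjArgmax x D m F y a → 0 < a) := by
  obtain ⟨K, d₁, d₂, hb⟩ := hreg.exists_bounds
  obtain ⟨d, _, hd, hdD⟩ := hreg.variance
  have hD : ∀ j, 0 < D j := fun j => hd.trans_le (hdD j).1
  refine ⟨fun F hF Ahat hest => ?_, fun m hm hrank hbdd hcase F hF y => ?_⟩
  · have hFreg : RegularFactor A F fun m => deriv (fun s => Real.log (L m s)) A := by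
      rcases hF with rfl | ⟨Ladd, hadd, rfl⟩
      · exact hL.regularFactor hA
      -- The logarithmic derivative of the additional factor tends to 0 near A, so the product has
      -- the same κ₀ as `L`.
      · simpa using (hL.regularFactor hA).mul hA (hadd.regularFactor hA)
    have h1 := hmodel.mse_isLittleO hA hb hFreg hest i
    have h2 := hmodel.integral_mseEst_isLittleO hA hb hFreg hc (hL.regularFactor hA)
      (fun _ => rfl) hest
    refine ⟨⟨h1.1, h1.2, fun Are hre => ?_⟩, ⟨h2.1, ?_⟩, fun m hm hrank hc0 y hy => ?_⟩
    -- The MSE expansion does not involve the factor, so it holds with the same terms for the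
    -- constant factor 1 of REML.
    · refine (h1.2.sub (hmodel.mse_isLittleO hA hb (RegularFactor.one A) hre i).2).congr_left
        fun m => ?_
      ring
    · refine (h2.2.sub h1.2).congr_left fun m => ?_
      ring
    · exact mseEst_pos (spans_of_rank_eq hrank) hm hD (hest.nonneg m y)
        (hc0 _ (hest.nonneg m y)) hy
  · have hs := hL.shape m hm
    have hlim := factor_mul_rpow_tendsto_zero (p := p) (hD i) hs.pos (hc.continuousOn m hm)
      (hc.le_two m hm) hbdd hcase
    rcases hF with ⟨Ladd, hadd, rfl⟩ | ⟨h0, rfl⟩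
    · have ha := hadd.shape m hm
      obtain ⟨C, hC⟩ := hadd.bounded m hm
      refine exists_pos_isAdjArgmax (spans_of_rank_eq hrank) hd (fun j => (hdD j).1)
        (hs.continuousOn.mul ha.continuousOn) (by simp [hadd.zero m hm])
        (fun a h => mul_pos (hs.pos a h) (ha.pos a h)) (C := C) (fun a h => ?_) hlim y
      rw [mul_comm]
      exact mul_le_mul_of_nonneg_right (hC a h).le (hs.pos a h).le
    · exact exists_pos_isAdjArgmax (spans_of_rank_eq hrank) hd (fun j => (hdD j).1)
        hs.continuousOn h0 hs.pos (C := 1) (fun a _ => (one_mul _).ge) hlim y
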